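/- Let $\alpha,\beta,\gamma,\delta\in\mathbb C$, let $F\in\mathbb C[x,y]$ be irreducible, and let $F(x,y)=0$ define an algebraic solution of the sixth Painlevé equation $$y_{xx}=\tfrac12\Big(\tfrac1y+\tfrac1{y-1}+\tfrac1{y-x}\Big)y_x^2-\Big(\tfrac1x+\tfrac1{x-1}+\tfrac1{y-x}\Big)y_x+\tfrac{y(y-1)(y-x)}{x^2(x-1)^2}\Big\{\alpha-\beta\tfrac{x}{y^2}+\gamma\tfrac{x-1}{(y-1)^2}-\big(\delta-\tfrac12\big)\tfrac{x(x-1)}{(y-x)^2}\Big\},$$ that is, let $y_0$ be a holomorphic solution of this equation on an open set $U\subset\mathbb C\setminus\{0,1\}$ (with $y_0(x)\ne 0,1,x$ on $U$) such that $F(x,y_0(x))=0$ on $U$. Put $x(\tau)=\vartheta_4(\tau)^4/\vartheta_3(\tau)^4$ for $\operatorname{Im}\tau>0$, where $\vartheta_3(\tau)=\sum_{k\in\mathbb Z}e^{\pi i k^2\tau}$ and $\vartheta_4(\tau)=\sum_{k\in\mathbb Z}(-1)^ke^{\pi i k^2\tau}$, and let $\operatorname{Im}\tau_0>0$, $x(\tau_0)\in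 U$. For a non-constant function $f$ of $t$ write $[f,t]=\dfrac{f'''}{f'^3}-\dfrac32\,\dfrac{f''^2}{f'^4}$. Then the function $y_0(x(\tau))$, defined near $\tau_0$, extends to a single-valued meromorphic function $y(\tau)$ on the whole upper half-plane, and $F(x(\tau),y(\tau))=0$. At every $\tau$ at which $y$ is finite and $F_x,F_y$ do not vanish at $(x(\tau),y(\tau))$, one has $\dot y(\tau)\neq0$ and $$[y,\tau]=\big([F,x]-[F,y]\big)F_y^{2}+3\,\frac{F_y}{F_x}\Big(\ln\frac{F_y}{F_x}\Big)_{xy}-\frac12\,\frac{x^2-x+1}{x^2(x-1)^2}\,\frac{F_y^{2}}{F_x^{2}}\,,$$ where $[F,x]$, $[F,y]$ are formed with the partial derivatives of $F$ in $x$, respectively in $y$, and the right-hand side is taken at $(x(\tau),y(\tau))$. If the solution is not a constant (that is, $F_x\not\equiv0$), this holds at all $\tau$ in the upper half-plane outside a set that has no accumulation point in it, and the equation is Fuchsian: writing its right-hand side as $Q(x,y)$, for every parametrization $x=\xi(t)$, $y=\upsilon(t)$ of the curve $F=0$ by functions meromorphic at $t=0$ with $\upsilon$ non-constant, $Q(\xi(t),\upsilon(t))$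 is meromorphic at $t=0$, and the equation $[t,\tau]=\big(Q(\xi,\upsilon)-[\upsilon,t]\big)\upsilon'(t)^2$ obtained by the substitution $y=\upsilon(t)$ has a right-hand side with a pole of order at most two at $t=0$. -/

import Mathlib

open Filter Topology

noncomputable section

/-- The open upper half-plane, as a subset of `ℂ`. -/
def upperHalf : Set ℂ := {τ : ℂ | 0 < τ.im}

/-- The theta constant `ϑ₃(τ) = ∑ₖ exp(π i k² τ)`. -/
def thetaConst3 (τ : ℂ) : ℂ := jacobiTheta₂ 0 τ

/-- The theta constant `ϑ₄(τ) = ∑ₖ (-1)ᵏ exp(π i k² τ)`. -/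
def thetaConst4 (τ : ℂ) : ℂ := jacobiTheta₂ (1 / 2) τ

/-- The modular function `x(τ) = ϑ₄(τ)⁴ / ϑ₃(τ)⁴`. -/
def modularX (τ : ℂ) : ℂ := thetaConst4 τ ^ 4 / thetaConst3 τ ^ 4

/-- The meromorphic derivative `[f, t] = f''' / f' ^ 3 - (3/2) f'' ^ 2 / f' ^ 4`. -/
def merDeriv (f : ℂ → ℂ) (t : ℂ) : ℂ :=
  iteratedDeriv 3 f t / deriv f t ^ 3 - 3 / 2 * (iteratedDeriv 2 f t ^ 2 / deriv f t ^ 4)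

/-- `y` is a holomorphic solution of the sixth Painlevé equation with parameters `α, β, γ, δ`
on the set `U` (all denominators of the equation are non-zero there). -/
structure IsPainleveVISolutionOn (α β γ δ : ℂ) (y : ℂ → ℂ) (U : Set ℂ) : Prop where
  analytic : AnalyticOnNhd ℂ y U
  indep_ne_zero : ∀ x ∈ U, x ≠ 0
  indep_ne_one : ∀ x ∈ U, x ≠ 1
  ne_zero : ∀ x ∈ U, y x ≠ 0
  ne_one : ∀ x ∈ U, y x ≠ 1
  ne_self : ∀ x ∈ U, y x ≠ x
  equation : ∀ x ∈ U,
    iteratedDeriv 2 y x =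
      1 / 2 * (1 / y x + 1 / (y x - 1) + 1 / (y x - x)) * deriv y x ^ 2
      - (1 / x + 1 / (x - 1) + 1 / (y x - x)) * deriv y x
      + y x * (y x - 1) * (y x - x) / (x ^ 2 * (x - 1) ^ 2)
        * (α - β * (x / y x ^ 2) + γ * ((x - 1) / (y x - 1) ^ 2)
            - (δ - 1 / 2) * (x * (x - 1) / (y x - x) ^ 2))

/-- The value `F(x, y)`; the variable `0` is `x`, the variable `1` is `y`. -/
def evalXY (F : MvPolynomial (Fin 2) ℂ) (x y : ℂ) : ℂ := MvPolynomial.eval ![x, y] F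

/-- The partial derivative `F_x(x, y)`. -/
def partialX (F : MvPolynomial (Fin 2) ℂ) (x y : ℂ) : ℂ := evalXY (MvPolynomial.pderiv 0 F) x y

/-- The partial derivative `F_y(x, y)`. -/
def partialY (F : MvPolynomial (Fin 2) ℂ) (x y : ℂ) : ℂ := evalXY (MvPolynomial.pderiv 1 F) x y

/-- The right-hand side
`([F,x] - [F,y]) F_y² + 3 (F_y/F_x) (ln (F_y/F_x))_{xy} - ½ (x²-x+1)/(x²(x-1)²) F_y²/F_x²`.
The mixed derivative `∂ₓ∂_y` of the logarithm is written as `∂ₓ` of the logarithmic derivative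
in `y`, so that no branch of the logarithm has to be chosen. -/
def fuchsRHS (F : MvPolynomial (Fin 2) ℂ) (x y : ℂ) : ℂ :=
  (merDeriv (fun s => evalXY F s y) x - merDeriv (fun t => evalXY F x t) y) * partialY F x y ^ 2
  + 3 * (partialY F x y / partialX F x y)
      * deriv (fun s => logDeriv (fun t => partialY F s t / partialX F s t) y) x
  - 1 / 2 * ((x ^ 2 - x + 1) / (x ^ 2 * (x - 1) ^ 2))
      * (partialY F x y ^ 2 / partialX F x y ^ 2)

/-- The equation `[y, τ] = Q(x, y)` on the curve `F(x, y) = 0` is of Fuchsian class: at every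
place of the curve, finite or infinite, given by a meromorphic parametrization
`x = ξ(t)`, `y = υ(t)` near `t = 0` with `υ` non-constant, `Q` is meromorphic, and the equation
`[t, τ] = (Q(ξ, υ) - [υ, t]) υ'²` that results from the substitution `y = υ(t)` (it is the
normal form `Ψ'' = ½ q(t) Ψ` with `q` this right-hand side) has at worst a regular singular point
at `t = 0`, that is, its right-hand side has there a pole of order at most two. -/
def IsFuchsianOnCurve (F : MvPolynomial (Fin 2) ℂ) (Q : ℂ → ℂ → ℂ) : Prop :=
  ∀ ξ υ : ℂ → ℂ, MeromorphicAt ξ 0 → MeromorphicAt υ 0 →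
    (∀ᶠ t in 𝓝[≠] (0 : ℂ), evalXY F (ξ t) (υ t) = 0) →
    (¬ ∃ c : ℂ, ∀ᶠ t in 𝓝[≠] (0 : ℂ), υ t = c) →
    MeromorphicAt (fun t => Q (ξ t) (υ t)) 0 ∧
    (-2 : WithTop ℤ) ≤
      meromorphicOrderAt (fun t => (Q (ξ t) (υ t) - merDeriv υ t) * deriv υ t ^ 2) 0

end

/-!
The theorem combines a local computation with a global continuation argument.

**The equation.** Differentiating `F(x(τ), y(τ)) = 0` three times expresses `[y, τ]` through
`[x, τ]` and the partial derivatives of `F` (`deriv_ne_zero_and_merDeriv_eq`), so the equation for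
`y` amounts to `[x, τ] = -(x² - x + 1) / (2 x² (x - 1)²)` for the modular function
(`merDeriv_modularX`). This follows from identities between the fourth powers of the theta constants
and their logarithmic derivatives. Each of the identities says that some function, built so as to be
modular of level one, is a cusp form of weight four, hence zero: Jacobi's identity (`quartic3_eq`),
the relations `logDeriv_quartic_sub`, and the Darboux–Halphen equation (`deriv_logDeriv_quartic3`).
Likewise the square of the product of the fourth powers is a cusp form of weight twelve, hence a
multiple of the discriminant, and has no zeros. Therefore `x(τ)` is holomorphic, avoids `0` and
`1`, and has no critical points.

**The Fuchsian property.** The same chain rule holds for an arbitrary parametrization of the curve.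
It turns `(Q - [υ, t]) υ'²` into `-(ξ² - ξ + 1) ξ'² / (2 ξ² (ξ - 1)²) - [ξ, t] ξ'²`, a polynomial in
the logarithmic derivatives of `ξ`, `ξ - 1` and `ξ'`, and the derivative of the last one; so the
poles have order at most two (`isFuchsianOnCurve_fuchsRHS`).

**Continuation.** An algebraic function with an arbitrary curve would be ramified over points
`x₀ ≠ 0, 1`, and its pullback to the half-plane would not be single-valued. The curves of solutions
are not ramified there, by the Painlevé property of the equation. For algebraic solutions this can
be seen as follows. By irreducibility of `F` all points of the curve satisfy the equation, as a
polynomial expressing this is divisible by `F` (`painleveVIAlong_of_solution`). A branch ramified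
over `x₀` is a meromorphic function `υ(t)` with `x = x₀ + r tⁿ`, and for a primitive `n`-th root of
unity `ζ` the function `υ(ζ t)` is another solution. If `y` takes one of the values `0`, `1`, `x₀`,
`∞` at `t = 0`, one passes to `v = y`, `y - 1`, `y - x`, `1 / y`, respectively. Both functions are
then formal solutions of an equation which is either regular, or has, up to factors, the leading
part `v v'' = v'² / 2 + c₀`. If they were different, their difference would have a leading term
`e tᵏ` with `k` not divisible by `n`, whereas comparison of coefficients in the equation forces
`k / n` to be `0`, `1` or `2` (`PowerSeries.rescale_eq_of_regular`,
`PowerSeries.rescale_eq_of_singular`, `eventually_comp_mul_eq`).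

Consequently the curve splits into finitely many meromorphic branches near each `x₀ ≠ 0, 1`
(`exists_isBranchSet_of_solution`). Puiseux series enter through the half-plane as the universal
covering of a punctured disc: on it the branches are holomorphic and periodic, hence meromorphic in
`exp(2 π i τ / n)` (`exists_isBranchSet_of_monodromy`). As `x(τ)` is a local biholomorphism into
`ℂ \ {0, 1}`, the pulled back curve also splits locally into meromorphic branches, and the monodromy
theorem on the convex half-plane (`exists_isBranchOn`) extends `y₀(x(τ))` to a meromorphic function.
-/

/-! ### Cusp forms of level one, in terms of functions on the half-plane -/

open scoped MatrixGroups Manifold ModularForm in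
/-- A holomorphic function on the half-plane with the transformation behaviour of a modular form
of weight `k` and level one, and with limit `0` at `i∞`, is a cusp form. -/
theorem exists_cuspForm_of_transform {k : ℕ} {f : ℂ → ℂ} (hf : DifferentiableOn ℂ f upperHalf)
    (hT : ∀ τ ∈ upperHalf, f (τ + 1) = f τ) (hS : ∀ τ ∈ upperHalf, f (-1 / τ) = τ ^ k * f τ)
    (h0 : Tendsto f (comap Complex.im atTop) (𝓝 0)) :
    ∃ g : CuspForm 𝒮ℒ k, ∀ τ : UpperHalfPlane, g τ = f τ := by
  have hne : ∀ τ : UpperHalfPlane, (τ : ℂ) ≠ 0 := fun τ => τ.ne_zero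
  let F : UpperHalfPlane → ℂ := fun τ => f τ
  have hTF : (F ∣[(k : ℤ)] ModularGroup.T) = F := by
    ext τ
    have := hT τ τ.2
    have hden : UpperHalfPlane.denom (ModularGroup.T : GL (Fin 2) ℝ) τ = 1 := by
      rw [ModularGroup.denom_apply]
      simp [ModularGroup.T]
    rw [ModularForm.SL_slash_apply, UpperHalfPlane.modular_T_smul, hden]
    simp [F, add_comm (1 : ℂ), this]
  have hSF : (F ∣[(k : ℤ)] ModularGroup.S) = F := by
    ext τ
    have := hS τ τ.2
    rw [ModularForm.SL_slash_apply, UpperHalfPlane.modular_S_smul]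
    have h2 : (-(τ : ℂ))⁻¹ = -1 / (τ : ℂ) := by
      rw [neg_div, one_div, inv_neg]
    simp only [F, ModularGroup.denom_S, h2, this]
    field_simp [hne τ]
    rw [zpow_neg, zpow_natCast]
    field_simp [hne τ]
  have hinv := SlashInvariantForm.slash_action_generators_SL2Z (k := (k : ℤ)) hSF hTF
  refine ⟨⟨⟨F, ?_⟩, ?_, ?_⟩, fun τ => rfl⟩
  · rintro A ⟨A, rfl⟩
    exact hinv A
  · rw [UpperHalfPlane.mdifferentiable_iff]
    refine hf.congr fun z hz => ?_
    change f (UpperHalfPlane.ofComplex z) = f z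
    rw [UpperHalfPlane.ofComplex_apply_of_im_pos hz]
  · intro c hc
    rw [OnePoint.isZeroAt_iff_forall_SL2Z hc]
    intro γ _
    have h3 : (F ∣[(k : ℤ)] γ) = F := hinv γ
    rw [h3]
    exact h0.comp UpperHalfPlane.tendsto_coe_atImInfty

/-- There are no cusp forms of weight four and level one. -/
theorem eq_zero_of_weight_four {f : ℂ → ℂ} (hf : DifferentiableOn ℂ f upperHalf)
    (hT : ∀ τ ∈ upperHalf, f (τ + 1) = f τ) (hS : ∀ τ ∈ upperHalf, f (-1 / τ) = τ ^ 4 * f τ)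
    (h0 : Tendsto f (comap Complex.im atTop) (𝓝 0)) {τ : ℂ} (hτ : τ ∈ upperHalf) : f τ = 0 := by
  obtain ⟨g, hg⟩ := exists_cuspForm_of_transform hf hT hS h0
  have := rank_zero_iff_forall_zero.mp
    (CuspForm.rank_eq_zero_of_weight_lt_twelve (k := ((4 : ℕ) : ℤ)) (by norm_num)) g
  rw [← hg ⟨τ, hτ⟩, this]
  rfl

/-- A cusp form of weight twelve and level one which is not identically zero is a multiple of the
discriminant, hence vanishes nowhere. -/
theorem ne_zero_of_weight_twelve {f : ℂ → ℂ} (hf : DifferentiableOn ℂ f upperHalf)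
    (hT : ∀ τ ∈ upperHalf, f (τ + 1) = f τ) (hS : ∀ τ ∈ upperHalf, f (-1 / τ) = τ ^ 12 * f τ)
    (h0 : Tendsto f (comap Complex.im atTop) (𝓝 0)) {σ τ : ℂ} (hσ : σ ∈ upperHalf)
    (hfσ : f σ ≠ 0) (hτ : τ ∈ upperHalf) : f τ ≠ 0 := by
  obtain ⟨g, hg⟩ := exists_cuspForm_of_transform hf hT hS h0
  obtain ⟨c, hc⟩ := CuspForm.exists_smul_discriminant_of_weight_eq_twelve g
  have hval : ∀ z : UpperHalfPlane, f z = c * ModularForm.discriminant z := fun z => by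
    rw [← hg z, ← hc]; rfl
  have h1 := hval ⟨σ, hσ⟩
  have h2 := hval ⟨τ, hτ⟩
  simp only at h1 h2
  rw [h1] at hfσ
  rw [h2]
  exact mul_ne_zero (left_ne_zero_of_mul hfσ) (ModularForm.discriminant_ne_zero _)

theorem isOpen_upperHalf : IsOpen upperHalf := isOpen_lt continuous_const Complex.continuous_im

theorem convex_upperHalf : Convex ℝ upperHalf := convex_halfSpace_im_gt 0

theorem ne_zero_of_mem_upperHalf {τ : ℂ} (hτ : τ ∈ upperHalf) : τ ≠ 0 := by
  rintro rfl
  simp [upperHalf] at hτ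

theorem neg_one_div_mem_upperHalf {τ : ℂ} (hτ : τ ∈ upperHalf) : -1 / τ ∈ upperHalf := by
  have h := UpperHalfPlane.im_inv_neg_coe_pos ⟨τ, hτ⟩
  simpa [upperHalf, neg_div, inv_neg] using h

/-- A holomorphic function with a limit at `i∞` has derivative tending to `0` there, by Cauchy's
estimate on discs of radius one. -/
theorem tendsto_deriv_at_I_infty {f : ℂ → ℂ} {c : ℂ} (hf : DifferentiableOn ℂ f upperHalf)
    (h : Tendsto f (comap Complex.im atTop) (𝓝 c)) :
    Tendsto (deriv f) (comap Complex.im atTop) (𝓝 0) := by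
  rw [Metric.tendsto_nhds] at h ⊢
  intro ε hε
  have h1 := h (ε / 2) (by positivity)
  rw [eventually_comap, eventually_atTop] at h1
  obtain ⟨A, hA⟩ := h1
  rw [eventually_comap, eventually_atTop]
  refine ⟨max A 0 + 2, fun y hy τ hτy => ?_⟩
  subst hτy
  have him : ∀ z ∈ Metric.closedBall τ 1, max A 0 < z.im := by
    intro z hz
    have h2 : |(z - τ).im| ≤ 1 := (Complex.abs_im_le_norm _).trans (by
      simpa [dist_eq_norm] using hz)
    have h3 := (abs_le.mp h2).1
    simp only [Complex.sub_im] at h3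
    linarith
  have hd : DifferentiableOn ℂ (fun z => f z - c) (Metric.closedBall τ 1) :=
    (hf.mono fun z hz => (le_max_right A 0).trans_lt (him z hz)).sub_const c
  have hcl : DiffContOnCl ℂ (fun z => f z - c) (Metric.ball τ 1) :=
    DifferentiableOn.diffContOnCl (by rwa [closure_ball _ one_ne_zero])
  have := Complex.norm_deriv_le_of_forall_mem_sphere_norm_le (C := ε / 2) one_pos hcl
    (fun z hz => by
      have h4 := hA z.im ((le_max_left A 0).trans
        (him z (Metric.sphere_subset_closedBall hz)).le) z rfl
      rw [dist_eq_norm] at h4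
      exact h4.le)
  rw [deriv_sub_const] at this
  rw [dist_zero_right]
  linarith

section

open scoped Real

/-! ### Fourth powers of the theta constants -/

/-- The factor `∑ₖ exp(π i (k² + k) τ)` of the theta constant `ϑ₂(τ) = exp(π i τ / 4) ∑ₖ …`. Unlike
`ϑ₂` itself it is periodic, and has a limit different from zero at `i∞`. -/
noncomputable def thetaConst2Factor (τ : ℂ) : ℂ := jacobiTheta₂ (τ / 2) τ

/-- The fourth power of `ϑ₂(τ) = ∑ₖ exp(π i (k + 1/2)² τ)`. -/
noncomputable def quartic2 (τ : ℂ) : ℂ := Complex.exp (π * Complex.I * τ) * thetaConst2Factor τ ^ 4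

/-- The fourth power of `ϑ₃`. -/
noncomputable def quartic3 (τ : ℂ) : ℂ := thetaConst3 τ ^ 4

/-- The fourth power of `ϑ₄`. -/
noncomputable def quartic4 (τ : ℂ) : ℂ := thetaConst4 τ ^ 4

theorem thetaConst3_add_one (τ : ℂ) : thetaConst3 (τ + 1) = thetaConst4 τ := by
  unfold thetaConst3 thetaConst4 jacobiTheta₂ jacobiTheta₂_term
  refine tsum_congr fun n => ?_
  obtain ⟨m, hm⟩ : ∃ m : ℤ, n ^ 2 - n = 2 * m := by
    obtain ⟨m, hm⟩ := Int.even_mul_succ_self (n - 1)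
    exact ⟨m, by linear_combination hm⟩
  have hm' : (n : ℂ) ^ 2 = n + 2 * m := by
    have : ((n ^ 2 - n : ℤ) : ℂ) = ((2 * m : ℤ) : ℂ) := by rw [hm]
    push_cast at this
    linear_combination this
  rw [Complex.exp_eq_exp_iff_exists_int]
  exact ⟨m, by linear_combination (π * Complex.I) * hm'⟩

theorem thetaConst4_add_one (τ : ℂ) : thetaConst4 (τ + 1) = thetaConst3 τ := by
  rw [← thetaConst3_add_one, thetaConst3, thetaConst3, add_assoc, one_add_one_eq_two,
    jacobiTheta₂_add_right]

theorem thetaConst2Factor_add_one (τ : ℂ) :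
    thetaConst2Factor (τ + 1) = thetaConst2Factor τ := by
  unfold thetaConst2Factor jacobiTheta₂ jacobiTheta₂_term
  refine tsum_congr fun n => ?_
  obtain ⟨m, hm⟩ : ∃ m : ℤ, n * (n + 1) = m + m := Int.even_mul_succ_self n
  have hm' : (n : ℂ) * (n + 1) = m + m := by exact_mod_cast hm
  rw [Complex.exp_eq_exp_iff_exists_int]
  exact ⟨m, by linear_combination (π * Complex.I) * hm'⟩

theorem quartic2_add_one (τ : ℂ) : quartic2 (τ + 1) = -quartic2 τ := by
  rw [quartic2, quartic2, thetaConst2Factor_add_one, mul_add, Complex.exp_add, mul_one,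
    Complex.exp_pi_mul_I]
  ring

theorem quartic3_add_one (τ : ℂ) : quartic3 (τ + 1) = quartic4 τ := by
  rw [quartic3, quartic4, thetaConst3_add_one]

theorem quartic4_add_one (τ : ℂ) : quartic4 (τ + 1) = quartic3 τ := by
  rw [quartic3, quartic4, thetaConst4_add_one]

theorem cpow_half_pow_four (z : ℂ) : (z ^ (1 / 2 : ℂ)) ^ 4 = z ^ 2 := by
  have : (z ^ (1 / 2 : ℂ)) ^ 2 = z := by
    simp
  rw [show 4 = 2 * 2 from rfl, pow_mul, this]

/-- Jacobi's functional equation, freed from the square root by taking fourth powers. -/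
theorem jacobiTheta₂_pow_four (z : ℂ) {τ : ℂ} (hτ : τ ≠ 0) :
    jacobiTheta₂ (z / τ) (-1 / τ) ^ 4 =
      -τ ^ 2 * (Complex.exp (4 * π * Complex.I * z ^ 2 / τ) * jacobiTheta₂ z τ ^ 4) := by
  have h := jacobiTheta₂_functional_equation z τ
  have h1 : (-Complex.I * τ) ^ (1 / 2 : ℂ) ≠ 0 := by
    rw [Ne, Complex.cpow_eq_zero_iff]
    simp [hτ]
  have h2 := cpow_half_pow_four (-Complex.I * τ)
  rw [h, mul_pow, mul_pow, div_pow, h2, ← Complex.exp_nat_mul]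
  have h3 : Complex.exp (4 * π * Complex.I * z ^ 2 / τ) *
      Complex.exp (((4 : ℕ) : ℂ) * (-π * Complex.I * z ^ 2 / τ)) = 1 := by
    rw [← Complex.exp_add, ← Complex.exp_zero]
    congr 1
    push_cast
    ring
  have h4 : (-Complex.I * τ) ^ 2 = -τ ^ 2 := by
    rw [mul_pow, neg_sq, Complex.I_sq]
    ring
  rw [h4]
  have h5 : τ ^ 2 ≠ 0 := pow_ne_zero 2 hτ
  generalize jacobiTheta₂ (z / τ) (-1 / τ) = J
  have h6 : -τ ^ 2 * (1 / -τ ^ 2) = 1 := by field_simp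
  linear_combination (-J ^ 4) * h3 - (J ^ 4 * (Complex.exp (4 * π * Complex.I * z ^ 2 / τ) *
      Complex.exp (((4 : ℕ) : ℂ) * (-π * Complex.I * z ^ 2 / τ)))) * h6

theorem quartic3_neg_one_div {τ : ℂ} (hτ : τ ≠ 0) :
    quartic3 (-1 / τ) = -τ ^ 2 * quartic3 τ := by
  have := jacobiTheta₂_pow_four 0 hτ
  simpa [quartic3, thetaConst3] using this

theorem quartic4_neg_one_div {τ : ℂ} (hτ : τ ≠ 0) :
    quartic4 (-1 / τ) = -τ ^ 2 * quartic2 τ := by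
  have := jacobiTheta₂_pow_four (τ / 2) hτ
  rw [show τ / 2 / τ = 1 / 2 by field_simp,
    show 4 * π * Complex.I * (τ / 2) ^ 2 / τ = π * Complex.I * τ by field_simp; ring] at this
  exact this

theorem quartic2_neg_one_div {τ : ℂ} (hτ : τ ≠ 0) :
    quartic2 (-1 / τ) = -τ ^ 2 * quartic4 τ := by
  have := jacobiTheta₂_pow_four (1 / 2) hτ
  have h2 : thetaConst2Factor (-1 / τ) = jacobiTheta₂ (1 / 2 / τ) (-1 / τ) := by
    rw [thetaConst2Factor, ← jacobiTheta₂_neg_left]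
    congr 1
    ring
  rw [quartic2, h2, this, quartic4, thetaConst4]
  have h3 : Complex.exp (π * Complex.I * (-1 / τ)) *
      Complex.exp (4 * π * Complex.I * (1 / 2) ^ 2 / τ) = 1 := by
    rw [← Complex.exp_add, Complex.exp_eq_one_iff]
    exact ⟨0, by ring⟩
  linear_combination (-τ ^ 2 * jacobiTheta₂ (1 / 2) τ ^ 4) * h3

theorem differentiableOn_thetaConst3 : DifferentiableOn ℂ thetaConst3 upperHalf := fun _ hτ =>
  (differentiableAt_jacobiTheta₂_snd 0 hτ).differentiableWithinAt

theorem differentiableOn_thetaConst4 : DifferentiableOn ℂ thetaConst4 upperHalf := fun _ hτ =>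
  (differentiableAt_jacobiTheta₂_snd (1 / 2) hτ).differentiableWithinAt

theorem differentiableOn_thetaConst2Factor :
    DifferentiableOn ℂ thetaConst2Factor upperHalf := fun τ hτ => by
  have h := (hasFDerivAt_jacobiTheta₂ (τ / 2) hτ).differentiableAt
  have h2 : DifferentiableAt ℂ (fun τ : ℂ => (τ / 2, τ)) τ := by fun_prop
  exact (DifferentiableAt.comp (f := fun τ : ℂ => (τ / 2, τ))
    (g := fun p : ℂ × ℂ => jacobiTheta₂ p.1 p.2) τ h h2).differentiableWithinAt

theorem differentiableOn_quartic2 : DifferentiableOn ℂ quartic2 upperHalf := by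
  have : DifferentiableOn ℂ (fun τ => Complex.exp (π * Complex.I * τ)) upperHalf := by fun_prop
  exact this.mul (differentiableOn_thetaConst2Factor.pow 4)

theorem differentiableOn_quartic3 : DifferentiableOn ℂ quartic3 upperHalf :=
  differentiableOn_thetaConst3.pow 4

theorem differentiableOn_quartic4 : DifferentiableOn ℂ quartic4 upperHalf :=
  differentiableOn_thetaConst4.pow 4

theorem tendsto_exp_at_I_infty :
    Tendsto (fun τ : ℂ => Complex.exp (π * Complex.I * τ)) (comap Complex.im atTop) (𝓝 0) := by
  rw [tendsto_zero_iff_norm_tendsto_zero]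
  have : (fun τ : ℂ => ‖Complex.exp (π * Complex.I * τ)‖) =
      (fun y : ℝ => Real.exp (-(π * y))) ∘ Complex.im := by
    ext τ
    simp [Complex.norm_exp]
  rw [this]
  refine Tendsto.comp ?_ tendsto_comap
  exact Real.tendsto_exp_neg_atTop_nhds_zero.comp (tendsto_id.const_mul_atTop Real.pi_pos)

theorem tendsto_thetaConst3 : Tendsto thetaConst3 (comap Complex.im atTop) (𝓝 1) := by
  have h := isBigO_at_im_infty_jacobiTheta_sub_one
  have h2 : Tendsto (fun τ : ℂ => Real.exp (-π * τ.im)) (comap Complex.im atTop) (𝓝 0) := by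
    have : (fun τ : ℂ => Real.exp (-π * τ.im)) =
        (fun y : ℝ => Real.exp (-(π * y))) ∘ Complex.im := by
      ext τ
      simp
    rw [this]
    refine Tendsto.comp ?_ tendsto_comap
    exact Real.tendsto_exp_neg_atTop_nhds_zero.comp (tendsto_id.const_mul_atTop Real.pi_pos)
  have h3 := (h.trans_tendsto h2).add_const 1
  simp only [sub_add_cancel, zero_add] at h3
  exact h3.congr fun τ => jacobiTheta_eq_jacobiTheta₂ τ

theorem tendsto_thetaConst4 : Tendsto thetaConst4 (comap Complex.im atTop) (𝓝 1) := by
  have h : Tendsto (fun τ : ℂ => τ + 1) (comap Complex.im atTop) (comap Complex.im atTop) := by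
    rw [tendsto_comap_iff]
    exact tendsto_comap.congr fun τ => by simp
  exact (tendsto_thetaConst3.comp h).congr thetaConst3_add_one

/-- Only the terms `k = 0` and `k = -1` of the series survive in the limit. -/
theorem tendsto_thetaConst2Factor :
    Tendsto thetaConst2Factor (comap Complex.im atTop) (𝓝 2) := by
  have hterm : ∀ (n : ℤ) (τ : ℂ), jacobiTheta₂_term n (τ / 2) τ =
      Complex.exp (π * Complex.I * ((n * (n + 1) : ℤ) : ℂ) * τ) := by
    intro n τ
    rw [jacobiTheta₂_term]
    congr 1
    push_cast
    ring
  have hnorm : ∀ (n : ℤ) (τ : ℂ), ‖jacobiTheta₂_term n (τ / 2) τ‖ =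
      Real.exp (-(π * ((n * (n + 1) : ℤ) : ℝ) * τ.im)) := by
    intro n τ
    rw [hterm, Complex.norm_exp]
    congr 1
    rw [show (π : ℂ) * Complex.I * ((n * (n + 1) : ℤ) : ℂ) * τ =
      ((π * ((n * (n + 1) : ℤ) : ℝ) : ℝ) : ℂ) * (Complex.I * τ) by push_cast; ring,
      Complex.re_ofReal_mul]
    simp
  have hnn : ∀ n : ℤ, 0 ≤ n * (n + 1) := by
    intro n
    rcases le_or_gt 0 n with h | h
    · positivity
    · nlinarith
  let g : ℤ → ℂ := fun n => if n ∈ ({0, -1} : Finset ℤ) then 1 else 0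
  have hg : ∑' n, g n = 2 := by
    rw [tsum_eq_sum (s := ({0, -1} : Finset ℤ)) (fun n hn => by simp [g] at hn ⊢; tauto)]
    rw [Finset.sum_pair (by norm_num)]
    norm_num [g]
  rw [← hg]
  unfold thetaConst2Factor jacobiTheta₂
  refine tendsto_tsum_of_dominated_convergence
    (bound := fun n : ℤ => ‖jacobiTheta₂_term n (Complex.I / 2) Complex.I‖) ?_ ?_ ?_
  · exact ((summable_jacobiTheta₂_term_iff _ _).mpr (by simp)).norm
  · intro n
    simp only [hterm]
    by_cases hn : n ∈ ({0, -1} : Finset ℤ)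
    · have : n * (n + 1) = 0 := by
        simp only [Finset.mem_insert, Finset.mem_singleton] at hn
        rcases hn with rfl | rfl <;> simp
      simp only [g, if_pos hn, this]
      simpa using tendsto_const_nhds
    · have hpos : 0 < n * (n + 1) := by
        refine lt_of_le_of_ne (hnn n) fun h => hn ?_
        rcases mul_eq_zero.mp h.symm with h | h
        · simp [h]
        · simp [show n = -1 by linarith]
      simp only [g, if_neg hn]
      obtain ⟨m, hm⟩ := Int.eq_ofNat_of_zero_le hpos.le
      have hm0 : m ≠ 0 := by
        rintro rfl
        simp at hm
        rcases hm with h | h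
        · simp [h] at hpos
        · simp [h] at hpos
      have := tendsto_exp_at_I_infty.pow m
      rw [zero_pow hm0] at this
      refine this.congr fun τ => ?_
      rw [← Complex.exp_nat_mul, hm]
      congr 1
      push_cast
      ring
  · rw [eventually_comap]
    filter_upwards [eventually_ge_atTop 1] with y hy τ hτ n
    rw [hnorm, hnorm, hτ, Complex.I_im, mul_one]
    apply Real.exp_le_exp.mpr
    have h1 : (0 : ℝ) ≤ ((n * (n + 1) : ℤ) : ℝ) := by exact_mod_cast hnn n
    have := mul_le_mul_of_nonneg_left hy (mul_nonneg Real.pi_pos.le h1)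
    linarith

theorem tendsto_quartic2 : Tendsto quartic2 (comap Complex.im atTop) (𝓝 0) := by
  have := tendsto_exp_at_I_infty.mul (tendsto_thetaConst2Factor.pow 4)
  rwa [zero_mul] at this

theorem tendsto_quartic3 : Tendsto quartic3 (comap Complex.im atTop) (𝓝 1) := by
  simpa only [one_pow] using! tendsto_thetaConst3.pow 4

theorem tendsto_quartic4 : Tendsto quartic4 (comap Complex.im atTop) (𝓝 1) := by
  simpa only [one_pow] using! tendsto_thetaConst4.pow 4

/-- Jacobi's identity `ϑ₃⁴ = ϑ₂⁴ + ϑ₄⁴`: the square of the difference is a cusp form of weight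
four. -/
theorem quartic3_eq {τ : ℂ} (hτ : τ ∈ upperHalf) : quartic3 τ = quartic2 τ + quartic4 τ := by
  have h := eq_zero_of_weight_four (f := fun τ => (quartic3 τ - quartic2 τ - quartic4 τ) ^ 2)
    (((differentiableOn_quartic3.sub differentiableOn_quartic2).sub
      differentiableOn_quartic4).pow 2)
    (fun τ _ => by
      simp only [quartic2_add_one, quartic3_add_one, quartic4_add_one]
      ring)
    (fun τ hτ => by
      have h0 := ne_zero_of_mem_upperHalf hτ
      simp only [quartic2_neg_one_div h0, quartic3_neg_one_div h0, quartic4_neg_one_div h0]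
      ring)
    (by
      have := ((tendsto_quartic3.sub tendsto_quartic2).sub tendsto_quartic4).pow 2
      simpa using this) hτ
  have := pow_eq_zero_iff (two_ne_zero) |>.mp h
  linear_combination this

theorem exists_forall_le_im_of_eventually {p : ℂ → Prop}
    (h : ∀ᶠ τ in comap Complex.im atTop, p τ) : ∃ A : ℝ, 0 < A ∧ ∀ τ : ℂ, A ≤ τ.im → p τ := by
  rw [eventually_comap, eventually_atTop] at h
  obtain ⟨A, hA⟩ := h
  exact ⟨max A 1, by positivity, fun τ hτ => hA τ.im ((le_max_left _ _).trans hτ) τ rfl⟩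

/-- The theta constants have no zeros: the square of the product of the quartics is a cusp form of
weight twelve. -/
theorem quartic_mul_ne_zero {τ : ℂ} (hτ : τ ∈ upperHalf) :
    quartic2 τ * quartic3 τ * quartic4 τ ≠ 0 := by
  have hev : ∀ᶠ τ in comap Complex.im atTop, quartic2 τ * quartic3 τ * quartic4 τ ≠ 0 := by
    filter_upwards [tendsto_thetaConst2Factor.eventually_ne two_ne_zero,
      tendsto_quartic3.eventually_ne one_ne_zero, tendsto_quartic4.eventually_ne one_ne_zero]
      with τ h2 h3 h4
    exact mul_ne_zero (mul_ne_zero (mul_ne_zero (Complex.exp_ne_zero _) (pow_ne_zero 4 h2)) h3) h4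
  obtain ⟨A, hA, hA'⟩ := exists_forall_le_im_of_eventually hev
  have h := ne_zero_of_weight_twelve
    (f := fun τ => (quartic2 τ * quartic3 τ * quartic4 τ) ^ 2)
    (((differentiableOn_quartic2.mul differentiableOn_quartic3).mul
      differentiableOn_quartic4).pow 2)
    (fun τ _ => by
      simp only [quartic2_add_one, quartic3_add_one, quartic4_add_one]
      ring)
    (fun τ hτ => by
      have h0 := ne_zero_of_mem_upperHalf hτ
      simp only [quartic2_neg_one_div h0, quartic3_neg_one_div h0, quartic4_neg_one_div h0]
      ring)
    (by
      have := ((tendsto_quartic2.mul tendsto_quartic3).mul tendsto_quartic4).pow 2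
      simpa using this)
    (σ := A * Complex.I) (by simpa [upperHalf] using hA)
    (pow_ne_zero 2 (hA' _ (by simp))) hτ
  exact fun h0 => h (by simp [h0])

theorem quartic2_ne_zero {τ : ℂ} (hτ : τ ∈ upperHalf) : quartic2 τ ≠ 0 :=
  left_ne_zero_of_mul (left_ne_zero_of_mul (quartic_mul_ne_zero hτ))

theorem quartic3_ne_zero {τ : ℂ} (hτ : τ ∈ upperHalf) : quartic3 τ ≠ 0 :=
  right_ne_zero_of_mul (left_ne_zero_of_mul (quartic_mul_ne_zero hτ))

theorem quartic4_ne_zero {τ : ℂ} (hτ : τ ∈ upperHalf) : quartic4 τ ≠ 0 :=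
  right_ne_zero_of_mul (quartic_mul_ne_zero hτ)

/-! ### Logarithmic derivatives of the theta constants -/

theorem hasDerivAt_neg_one_div {τ : ℂ} (hτ : τ ≠ 0) :
    HasDerivAt (fun z : ℂ => -1 / z) (1 / τ ^ 2) τ := by
  have := (hasDerivAt_inv hτ).neg
  simp only [neg_neg] at this
  rw [one_div]
  refine this.congr_of_eventuallyEq (Eventually.of_forall fun z => ?_)
  simp [neg_div]

theorem DifferentiableOn.hasDerivAt_upperHalf {f : ℂ → ℂ} (hf : DifferentiableOn ℂ f upperHalf)
    {τ : ℂ} (hτ : τ ∈ upperHalf) : HasDerivAt f (_root_.deriv f τ) τ :=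
  (hf.differentiableAt (isOpen_upperHalf.mem_nhds hτ)).hasDerivAt

/-- The logarithmic derivative of a form of weight two transforms with the additional term `2 τ`,
like a quasimodular form. -/
theorem logDeriv_neg_one_div {f g : ℂ → ℂ} (hf : DifferentiableOn ℂ f upperHalf)
    (hg : DifferentiableOn ℂ g upperHalf)
    (h : ∀ τ ∈ upperHalf, f (-1 / τ) = -τ ^ 2 * g τ) {τ : ℂ} (hτ : τ ∈ upperHalf)
    (hgτ : g τ ≠ 0) : logDeriv f (-1 / τ) = τ ^ 2 * logDeriv g τ + 2 * τ := by
  have h0 := ne_zero_of_mem_upperHalf hτ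
  have h1 := (hf.hasDerivAt_upperHalf (neg_one_div_mem_upperHalf hτ)).comp τ
    (hasDerivAt_neg_one_div h0)
  have h2 : HasDerivAt (fun z : ℂ => -z ^ 2 * g z) (-(2 * τ) * g τ + -τ ^ 2 * deriv g τ) τ := by
    have h3 := ((hasDerivAt_pow 2 τ).neg).mul (hg.hasDerivAt_upperHalf hτ)
    convert! h3 using 1
    simp
  have h4 := h2.congr_of_eventuallyEq (f₁ := f ∘ fun z : ℂ => -1 / z)
    ((isOpen_upperHalf.eventually_mem hτ).mono h)
  have h5 := h1.unique h4
  rw [logDeriv_apply, logDeriv_apply, h τ hτ]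
  field_simp at h5 ⊢
  linear_combination -h5

theorem deriv_neg_one_div {f g : ℂ → ℂ} (hf : DifferentiableOn ℂ f upperHalf)
    (hg : DifferentiableOn ℂ g upperHalf)
    (h : ∀ τ ∈ upperHalf, f (-1 / τ) = τ ^ 2 * g τ + 2 * τ) {τ : ℂ} (hτ : τ ∈ upperHalf) :
    deriv f (-1 / τ) = τ ^ 4 * deriv g τ + 2 * τ ^ 3 * g τ + 2 * τ ^ 2 := by
  have h0 := ne_zero_of_mem_upperHalf hτ
  have h1 := (hf.hasDerivAt_upperHalf (neg_one_div_mem_upperHalf hτ)).comp τ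
    (hasDerivAt_neg_one_div h0)
  have h2 : HasDerivAt (fun z : ℂ => z ^ 2 * g z + 2 * z)
      (2 * τ * g τ + τ ^ 2 * deriv g τ + 2) τ := by
    have h3 := ((hasDerivAt_pow 2 τ).mul (hg.hasDerivAt_upperHalf hτ)).add
      ((hasDerivAt_id τ).const_mul 2)
    simpa using! h3
  have h4 := h2.congr_of_eventuallyEq (f₁ := f ∘ fun z : ℂ => -1 / z)
    ((isOpen_upperHalf.eventually_mem hτ).mono h)
  have h5 := h1.unique h4
  generalize deriv f (-1 / τ) = D at h5 ⊢
  field_simp at h5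
  linear_combination h5

theorem deriv_add_one {f g : ℂ → ℂ} (h : ∀ τ, f (τ + 1) = g τ) (τ : ℂ) :
    deriv f (τ + 1) = deriv g τ := by
  rw [← deriv_comp_add_const]
  exact congrArg (fun F => deriv F τ) (funext h)

theorem logDeriv_quartic2_add_one (τ : ℂ) : logDeriv quartic2 (τ + 1) = logDeriv quartic2 τ := by
  have h : deriv quartic2 (τ + 1) = deriv (fun τ => -quartic2 τ) τ :=
    deriv_add_one quartic2_add_one τ
  rw [logDeriv_apply, logDeriv_apply, h, quartic2_add_one, deriv.fun_neg, neg_div_neg_eq]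

theorem logDeriv_quartic3_add_one (τ : ℂ) : logDeriv quartic3 (τ + 1) = logDeriv quartic4 τ := by
  rw [logDeriv_apply, logDeriv_apply, deriv_add_one quartic3_add_one, quartic3_add_one]

theorem logDeriv_quartic4_add_one (τ : ℂ) : logDeriv quartic4 (τ + 1) = logDeriv quartic3 τ := by
  rw [logDeriv_apply, logDeriv_apply, deriv_add_one quartic4_add_one, quartic4_add_one]

theorem logDeriv_quartic2_neg_one_div {τ : ℂ} (hτ : τ ∈ upperHalf) :
    logDeriv quartic2 (-1 / τ) = τ ^ 2 * logDeriv quartic4 τ + 2 * τ :=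
  logDeriv_neg_one_div differentiableOn_quartic2 differentiableOn_quartic4
    (fun _ h => quartic2_neg_one_div (ne_zero_of_mem_upperHalf h)) hτ (quartic4_ne_zero hτ)

theorem logDeriv_quartic3_neg_one_div {τ : ℂ} (hτ : τ ∈ upperHalf) :
    logDeriv quartic3 (-1 / τ) = τ ^ 2 * logDeriv quartic3 τ + 2 * τ :=
  logDeriv_neg_one_div differentiableOn_quartic3 differentiableOn_quartic3
    (fun _ h => quartic3_neg_one_div (ne_zero_of_mem_upperHalf h)) hτ (quartic3_ne_zero hτ)

theorem logDeriv_quartic4_neg_one_div {τ : ℂ} (hτ : τ ∈ upperHalf) :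
    logDeriv quartic4 (-1 / τ) = τ ^ 2 * logDeriv quartic2 τ + 2 * τ :=
  logDeriv_neg_one_div differentiableOn_quartic4 differentiableOn_quartic2
    (fun _ h => quartic4_neg_one_div (ne_zero_of_mem_upperHalf h)) hτ (quartic2_ne_zero hτ)

theorem differentiableOn_logDeriv {f : ℂ → ℂ} (hf : DifferentiableOn ℂ f upperHalf)
    (h : ∀ τ ∈ upperHalf, f τ ≠ 0) : DifferentiableOn ℂ (logDeriv f) upperHalf :=
  (hf.deriv isOpen_upperHalf).div hf h

theorem differentiableOn_logDeriv_quartic2 :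
    DifferentiableOn ℂ (logDeriv quartic2) upperHalf :=
  differentiableOn_logDeriv differentiableOn_quartic2 fun _ => quartic2_ne_zero

theorem differentiableOn_logDeriv_quartic3 :
    DifferentiableOn ℂ (logDeriv quartic3) upperHalf :=
  differentiableOn_logDeriv differentiableOn_quartic3 fun _ => quartic3_ne_zero

theorem differentiableOn_logDeriv_quartic4 :
    DifferentiableOn ℂ (logDeriv quartic4) upperHalf :=
  differentiableOn_logDeriv differentiableOn_quartic4 fun _ => quartic4_ne_zero

theorem tendsto_logDeriv_at_I_infty {f : ℂ → ℂ} {c : ℂ} (hf : DifferentiableOn ℂ f upperHalf)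
    (h : Tendsto f (comap Complex.im atTop) (𝓝 c)) (hc : c ≠ 0) :
    Tendsto (logDeriv f) (comap Complex.im atTop) (𝓝 0) := by
  have := (tendsto_deriv_at_I_infty hf h).div h hc
  rwa [zero_div] at this

theorem tendsto_logDeriv_quartic3 :
    Tendsto (logDeriv quartic3) (comap Complex.im atTop) (𝓝 0) :=
  tendsto_logDeriv_at_I_infty differentiableOn_quartic3 tendsto_quartic3 one_ne_zero

theorem tendsto_logDeriv_quartic4 :
    Tendsto (logDeriv quartic4) (comap Complex.im atTop) (𝓝 0) :=
  tendsto_logDeriv_at_I_infty differentiableOn_quartic4 tendsto_quartic4 one_ne_zero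

theorem eventually_mem_upperHalf : ∀ᶠ τ in comap Complex.im atTop, τ ∈ upperHalf := by
  rw [eventually_comap]
  filter_upwards [eventually_gt_atTop 0] with y hy τ hτ
  rw [← hτ] at hy
  exact hy

theorem tendsto_logDeriv_quartic2 :
    Tendsto (logDeriv quartic2) (comap Complex.im atTop) (𝓝 (π * Complex.I)) := by
  have h1 : DifferentiableOn ℂ (fun τ => thetaConst2Factor τ ^ 4) upperHalf :=
    differentiableOn_thetaConst2Factor.pow 4
  have h2 := (tendsto_logDeriv_at_I_infty h1 (tendsto_thetaConst2Factor.pow 4)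
    (by norm_num)).const_add (π * Complex.I)
  rw [add_zero] at h2
  refine h2.congr' ?_
  filter_upwards [eventually_mem_upperHalf] with τ hτ
  have h3 : HasDerivAt (fun τ => Complex.exp (π * Complex.I * τ))
      (Complex.exp (π * Complex.I * τ) * (π * Complex.I)) τ := by
    have := (hasDerivAt_id τ).const_mul (π * Complex.I)
    simpa using this.cexp
  have h4 := h3.mul (h1.hasDerivAt_upperHalf hτ)
  have h5 : deriv quartic2 τ = _ := h4.deriv
  have h6 := quartic2_ne_zero hτ
  rw [quartic2] at h6
  have h7 : thetaConst2Factor τ ≠ 0 := fun h => h6 (by simp [h])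
  have h8 := left_ne_zero_of_mul h6
  rw [logDeriv_apply, logDeriv_apply, h5, quartic2]
  field_simp

/-- The three differences that vanish by `logDeriv_quartic_sub` transform under the modular group
like the quartics themselves. The sum of their squares, and their pairing with the
quartics, are therefore cusp forms of weight four. -/
theorem logDeriv_quartic_relations {τ : ℂ} (hτ : τ ∈ upperHalf) :
    ((logDeriv quartic3 τ - logDeriv quartic4 τ - π * Complex.I * quartic2 τ) ^ 2 +
      (logDeriv quartic2 τ - logDeriv quartic3 τ - π * Complex.I * quartic4 τ) ^ 2 +
      (logDeriv quartic2 τ - logDeriv quartic4 τ - π * Complex.I * quartic3 τ) ^ 2 = 0) ∧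
    ((logDeriv quartic3 τ - logDeriv quartic4 τ - π * Complex.I * quartic2 τ) * quartic2 τ +
      (logDeriv quartic2 τ - logDeriv quartic3 τ - π * Complex.I * quartic4 τ) * quartic4 τ +
      (logDeriv quartic2 τ - logDeriv quartic4 τ - π * Complex.I * quartic3 τ) *
        quartic3 τ = 0) := by
  have d1 := (differentiableOn_logDeriv_quartic3.sub differentiableOn_logDeriv_quartic4).sub
    (differentiableOn_quartic2.const_mul (π * Complex.I))
  have d2 := (differentiableOn_logDeriv_quartic2.sub differentiableOn_logDeriv_quartic3).sub
    (differentiableOn_quartic4.const_mul (π * Complex.I))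
  have d3 := (differentiableOn_logDeriv_quartic2.sub differentiableOn_logDeriv_quartic4).sub
    (differentiableOn_quartic3.const_mul (π * Complex.I))
  have t1 := (tendsto_logDeriv_quartic3.sub tendsto_logDeriv_quartic4).sub
    (tendsto_quartic2.const_mul (π * Complex.I))
  have t2 := (tendsto_logDeriv_quartic2.sub tendsto_logDeriv_quartic3).sub
    (tendsto_quartic4.const_mul (π * Complex.I))
  have t3 := (tendsto_logDeriv_quartic2.sub tendsto_logDeriv_quartic4).sub
    (tendsto_quartic3.const_mul (π * Complex.I))
  simp only [mul_zero, mul_one, sub_zero, sub_self] at t1 t2 t3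
  constructor
  · refine eq_zero_of_weight_four (((d1.pow 2).add (d2.pow 2)).add (d3.pow 2))
      (fun τ _ => ?_) (fun τ hτ => ?_) ?_ hτ
    · simp only [Pi.add_apply, Pi.pow_apply, Pi.sub_apply, quartic2_add_one, quartic3_add_one,
        quartic4_add_one, logDeriv_quartic2_add_one, logDeriv_quartic3_add_one,
        logDeriv_quartic4_add_one]
      ring
    · have h0 := ne_zero_of_mem_upperHalf hτ
      simp only [Pi.add_apply, Pi.pow_apply, Pi.sub_apply, quartic2_neg_one_div h0,
        quartic3_neg_one_div h0, quartic4_neg_one_div h0,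
        logDeriv_quartic2_neg_one_div hτ, logDeriv_quartic3_neg_one_div hτ,
        logDeriv_quartic4_neg_one_div hτ]
      ring
    · simpa using! ((t1.pow 2).add (t2.pow 2)).add (t3.pow 2)
  · refine eq_zero_of_weight_four (((d1.mul differentiableOn_quartic2).add
      (d2.mul differentiableOn_quartic4)).add (d3.mul differentiableOn_quartic3))
      (fun τ _ => ?_) (fun τ hτ => ?_) ?_ hτ
    · simp only [Pi.add_apply, Pi.mul_apply, Pi.sub_apply, quartic2_add_one, quartic3_add_one,
        quartic4_add_one, logDeriv_quartic2_add_one, logDeriv_quartic3_add_one,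
        logDeriv_quartic4_add_one]
      ring
    · have h0 := ne_zero_of_mem_upperHalf hτ
      simp only [Pi.add_apply, Pi.mul_apply, Pi.sub_apply, quartic2_neg_one_div h0,
        quartic3_neg_one_div h0, quartic4_neg_one_div h0,
        logDeriv_quartic2_neg_one_div hτ, logDeriv_quartic3_neg_one_div hτ,
        logDeriv_quartic4_neg_one_div hτ]
      ring
    · simpa using! ((t1.mul tendsto_quartic2).add (t2.mul tendsto_quartic4)).add
        (t3.mul tendsto_quartic3)

/-- The logarithmic derivatives of the quartics differ by the quartics. The relations of
`logDeriv_quartic_relations` force this wherever `ϑ₂⁸ + ϑ₂⁴ϑ₄⁴ + ϑ₄⁸ ≠ 0`, in particular near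
`i∞`, hence everywhere. -/
theorem logDeriv_quartic_sub {τ : ℂ} (hτ : τ ∈ upperHalf) :
    logDeriv quartic3 τ - logDeriv quartic4 τ = π * Complex.I * quartic2 τ ∧
      logDeriv quartic2 τ - logDeriv quartic3 τ = π * Complex.I * quartic4 τ := by
  -- eliminate `u2` from the quadratic form and the linear form
  have key : ∀ u1 u2 a c : ℂ, u1 ^ 2 + u2 ^ 2 + (u1 + u2) ^ 2 = 0 →
      u1 * a + u2 * c + (u1 + u2) * (a + c) = 0 → a ^ 2 + a * c + c ^ 2 ≠ 0 →
      u1 = 0 ∧ u2 = 0 := by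
    intro u1 u2 a c h1 h2 h3
    have e1 : u1 ^ 2 * (3 * (a ^ 2 + a * c + c ^ 2)) = 0 := by
      linear_combination (a + 2 * c) ^ 2 * h1 / 2 -
        (u1 * (a + 2 * c) + u2 * (a + 2 * c) - u1 * (2 * a + c)) * h2
    have e2 : u1 = 0 := by
      rcases mul_eq_zero.mp e1 with h | h
      · exact pow_eq_zero_iff two_ne_zero |>.mp h
      · exact absurd (mul_eq_zero.mp h) (by simp [h3])
    subst e2
    refine ⟨rfl, ?_⟩
    have e3 : u2 ^ 2 = 0 := by linear_combination h1 / 2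
    exact pow_eq_zero_iff two_ne_zero |>.mp e3
  let v1 : ℂ → ℂ := fun τ => logDeriv quartic3 τ - logDeriv quartic4 τ - π * Complex.I * quartic2 τ
  let v2 : ℂ → ℂ := fun τ => logDeriv quartic2 τ - logDeriv quartic3 τ - π * Complex.I * quartic4 τ
  have hev : ∀ᶠ τ in comap Complex.im atTop, v1 τ = 0 ∧ v2 τ = 0 := by
    have hlim := ((tendsto_quartic2.pow 2).add (tendsto_quartic2.mul tendsto_quartic4)).add
      (tendsto_quartic4.pow 2)
    filter_upwards [hlim.eventually_ne (b₂ := 0) (by norm_num),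
      eventually_mem_upperHalf] with τ h1 hτ
    obtain ⟨r1, r2⟩ := logDeriv_quartic_relations hτ
    have e3 : logDeriv quartic2 τ - logDeriv quartic4 τ - π * Complex.I * quartic3 τ =
        v1 τ + v2 τ := by
      rw [quartic3_eq hτ]
      ring
    rw [e3] at r1 r2
    rw [show (v1 τ + v2 τ) * quartic3 τ = (v1 τ + v2 τ) * (quartic2 τ + quartic4 τ) by
      rw [quartic3_eq hτ]] at r2
    exact key _ _ _ _ r1 r2 h1
  obtain ⟨A, hA, hA'⟩ := exists_forall_le_im_of_eventually hev
  have hσ : (A + 1 : ℝ) * Complex.I ∈ upperHalf := by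
    simp [upperHalf]
    linarith
  have hnear : ∀ᶠ τ in 𝓝 (((A + 1 : ℝ) : ℂ) * Complex.I), v1 τ = 0 ∧ v2 τ = 0 := by
    have : IsOpen {τ : ℂ | A < τ.im} := isOpen_lt continuous_const Complex.continuous_im
    filter_upwards [this.mem_nhds (by simp)] with τ h
    exact hA' τ (le_of_lt h)
  have d1 : DifferentiableOn ℂ v1 upperHalf :=
    (differentiableOn_logDeriv_quartic3.sub differentiableOn_logDeriv_quartic4).sub
      (differentiableOn_quartic2.const_mul (π * Complex.I))
  have d2 : DifferentiableOn ℂ v2 upperHalf :=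
    (differentiableOn_logDeriv_quartic2.sub differentiableOn_logDeriv_quartic3).sub
      (differentiableOn_quartic4.const_mul (π * Complex.I))
  have z1 := (d1.analyticOnNhd isOpen_upperHalf).eqOn_zero_of_preconnected_of_eventuallyEq_zero
    convex_upperHalf.isPreconnected hσ (hnear.mono fun _ h => h.1) hτ
  have z2 := (d2.analyticOnNhd isOpen_upperHalf).eqOn_zero_of_preconnected_of_eventuallyEq_zero
    convex_upperHalf.isPreconnected hσ (hnear.mono fun _ h => h.2) hτ
  exact ⟨sub_eq_zero.mp z1, sub_eq_zero.mp z2⟩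

/-- Derivatives of the relations of `logDeriv_quartic_sub`. -/
theorem deriv_logDeriv_quartic_sub {τ : ℂ} (hτ : τ ∈ upperHalf) :
    deriv (logDeriv quartic3) τ - deriv (logDeriv quartic4) τ =
        π * Complex.I * quartic2 τ * logDeriv quartic2 τ ∧
      deriv (logDeriv quartic2) τ - deriv (logDeriv quartic3) τ =
        π * Complex.I * quartic4 τ * logDeriv quartic4 τ := by
  have hL2 := differentiableOn_logDeriv_quartic2.hasDerivAt_upperHalf hτ
  have hL3 := differentiableOn_logDeriv_quartic3.hasDerivAt_upperHalf hτ
  have hL4 := differentiableOn_logDeriv_quartic4.hasDerivAt_upperHalf hτ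
  have h2 := (differentiableOn_quartic2.hasDerivAt_upperHalf hτ).const_mul (π * Complex.I)
  have h4 := (differentiableOn_quartic4.hasDerivAt_upperHalf hτ).const_mul (π * Complex.I)
  have hmem := isOpen_upperHalf.eventually_mem hτ
  have e1 := (hL3.sub hL4).unique
    (h2.congr_of_eventuallyEq (hmem.mono fun σ hσ => (logDeriv_quartic_sub hσ).1))
  have e2 := (hL2.sub hL3).unique
    (h4.congr_of_eventuallyEq (hmem.mono fun σ hσ => (logDeriv_quartic_sub hσ).2))
  rw [e1, e2, logDeriv_apply, logDeriv_apply]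
  have n2 := quartic2_ne_zero hτ
  have n4 := quartic4_ne_zero hτ
  constructor <;> field_simp

/-- The Darboux–Halphen equation for the logarithmic derivatives of the quartics: the difference
of its two sides is a cusp form of weight four. -/
theorem deriv_logDeriv_quartic3 {τ : ℂ} (hτ : τ ∈ upperHalf) :
    deriv (logDeriv quartic3) τ = 1 / 2 * (logDeriv quartic3 τ * logDeriv quartic2 τ +
      logDeriv quartic3 τ * logDeriv quartic4 τ - logDeriv quartic2 τ * logDeriv quartic4 τ) := by
  let G : ℂ → ℂ := fun τ => deriv (logDeriv quartic3) τ -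
    1 / 2 * (logDeriv quartic3 τ * logDeriv quartic2 τ +
      logDeriv quartic3 τ * logDeriv quartic4 τ - logDeriv quartic2 τ * logDeriv quartic4 τ)
  have d2 := differentiableOn_logDeriv_quartic2
  have d3 := differentiableOn_logDeriv_quartic3
  have d4 := differentiableOn_logDeriv_quartic4
  have hG : DifferentiableOn ℂ G upperHalf := (d3.deriv isOpen_upperHalf).sub
    ((((d3.mul d2).add (d3.mul d4)).sub (d2.mul d4)).const_mul (1 / 2))
  have hT : ∀ τ ∈ upperHalf, G (τ + 1) = G τ := by
    intro τ hτ
    simp only [G, logDeriv_quartic2_add_one, logDeriv_quartic3_add_one,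
      logDeriv_quartic4_add_one, deriv_add_one logDeriv_quartic3_add_one]
    linear_combination -(deriv_logDeriv_quartic_sub hτ).1 +
      logDeriv quartic2 τ * (logDeriv_quartic_sub hτ).1
  have hS : ∀ τ ∈ upperHalf, G (-1 / τ) = τ ^ 4 * G τ := by
    intro τ hτ
    simp only [G, logDeriv_quartic2_neg_one_div hτ, logDeriv_quartic3_neg_one_div hτ,
      logDeriv_quartic4_neg_one_div hτ,
      deriv_neg_one_div d3 d3 (fun _ => logDeriv_quartic3_neg_one_div) hτ]
    ring
  have h0 : Tendsto G (comap Complex.im atTop) (𝓝 0) := by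
    have t2 := tendsto_logDeriv_quartic2
    have t3 := tendsto_logDeriv_quartic3
    have t4 := tendsto_logDeriv_quartic4
    have := (tendsto_deriv_at_I_infty d3 t3).sub
      ((((t3.mul t2).add (t3.mul t4)).sub (t2.mul t4)).const_mul (1 / 2))
    simpa only [zero_mul, mul_zero, add_zero, sub_zero] using! this
  exact sub_eq_zero.mp (eq_zero_of_weight_four hG hT hS h0 hτ)

/-! ### The modular function -/

theorem modularX_eq (τ : ℂ) : modularX τ = quartic4 τ / quartic3 τ := rfl

theorem modularX_ne_zero {τ : ℂ} (hτ : τ ∈ upperHalf) : modularX τ ≠ 0 :=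
  div_ne_zero (quartic4_ne_zero hτ) (quartic3_ne_zero hτ)

theorem modularX_sub_one {τ : ℂ} (hτ : τ ∈ upperHalf) :
    modularX τ - 1 = -quartic2 τ / quartic3 τ := by
  have := quartic3_ne_zero hτ
  rw [modularX_eq, div_sub_one this, quartic3_eq hτ]
  ring

theorem modularX_ne_one {τ : ℂ} (hτ : τ ∈ upperHalf) : modularX τ ≠ 1 := by
  rw [← sub_ne_zero, modularX_sub_one hτ]
  exact div_ne_zero (neg_ne_zero.mpr (quartic2_ne_zero hτ)) (quartic3_ne_zero hτ)

theorem differentiableOn_modularX : DifferentiableOn ℂ modularX upperHalf :=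
  differentiableOn_quartic4.div differentiableOn_quartic3 fun _ => quartic3_ne_zero

theorem analyticAt_modularX {τ : ℂ} (hτ : τ ∈ upperHalf) : AnalyticAt ℂ modularX τ :=
  differentiableOn_modularX.analyticAt (isOpen_upperHalf.mem_nhds hτ)

theorem deriv_modularX {τ : ℂ} (hτ : τ ∈ upperHalf) :
    deriv modularX τ = modularX τ * (logDeriv quartic4 τ - logDeriv quartic3 τ) := by
  have h : deriv modularX τ = _ := ((differentiableOn_quartic4.hasDerivAt_upperHalf hτ).div
    (differentiableOn_quartic3.hasDerivAt_upperHalf hτ) (quartic3_ne_zero hτ)).deriv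
  have n3 := quartic3_ne_zero hτ
  have n4 := quartic4_ne_zero hτ
  rw [h, modularX_eq, logDeriv_apply, logDeriv_apply]
  field_simp

theorem deriv_modularX_ne_zero {τ : ℂ} (hτ : τ ∈ upperHalf) : deriv modularX τ ≠ 0 := by
  rw [deriv_modularX hτ, ← neg_sub, (logDeriv_quartic_sub hτ).1]
  have := quartic2_ne_zero hτ
  have := modularX_ne_zero hτ
  simp_all

/-- The Schwarzian equation of the modular function. -/
theorem merDeriv_modularX {τ : ℂ} (hτ : τ ∈ upperHalf) :
    merDeriv modularX τ = -(1 / 2) * ((modularX τ ^ 2 - modularX τ + 1) /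
      (modularX τ ^ 2 * (modularX τ - 1) ^ 2)) := by
  let M : ℂ → ℂ := fun τ => logDeriv quartic4 τ - logDeriv quartic3 τ
  let N : ℂ → ℂ := fun τ => logDeriv quartic4 τ + logDeriv quartic2 τ - logDeriv quartic3 τ
  have hmem := isOpen_upperHalf.eventually_mem hτ
  have d1 : ∀ σ ∈ upperHalf, HasDerivAt modularX (modularX σ * M σ) σ := fun σ hσ => by
    have := differentiableOn_modularX.hasDerivAt_upperHalf hσ
    rwa [deriv_modularX hσ] at this
  have hM : ∀ σ ∈ upperHalf, HasDerivAt M (M σ * logDeriv quartic2 σ) σ := fun σ hσ => by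
    have := (differentiableOn_logDeriv_quartic4.hasDerivAt_upperHalf hσ).sub
      (differentiableOn_logDeriv_quartic3.hasDerivAt_upperHalf hσ)
    convert! this using 1
    have e1 := (deriv_logDeriv_quartic_sub hσ).1
    have e2 := (logDeriv_quartic_sub hσ).1
    simp only [M]
    linear_combination -logDeriv quartic2 σ * e2 + e1
  have d2 : ∀ σ ∈ upperHalf, HasDerivAt (fun σ => modularX σ * M σ)
      (modularX σ * M σ * N σ) σ := fun σ hσ => by
    convert! (d1 σ hσ).mul (hM σ hσ) using 1
    simp only [M, N]
    ring
  have e1 := (deriv_logDeriv_quartic_sub hτ).1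
  have e2 := (deriv_logDeriv_quartic_sub hτ).2
  have e3 := deriv_logDeriv_quartic3 hτ
  have hN := ((differentiableOn_logDeriv_quartic4.hasDerivAt_upperHalf hτ).add
    (differentiableOn_logDeriv_quartic2.hasDerivAt_upperHalf hτ)).sub
    (differentiableOn_logDeriv_quartic3.hasDerivAt_upperHalf hτ)
  have d3 := (d2 τ hτ).mul hN
  have f1 : deriv modularX =ᶠ[𝓝 τ] fun σ => modularX σ * M σ :=
    hmem.mono fun σ hσ => (d1 σ hσ).deriv
  have f2 : deriv (deriv modularX) =ᶠ[𝓝 τ] fun σ => modularX σ * M σ * N σ :=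
    hmem.mono fun σ hσ => by
      have := (isOpen_upperHalf.eventually_mem hσ).mono fun σ hσ => (d1 σ hσ).deriv
      rw [EventuallyEq.deriv_eq this]
      exact (d2 σ hσ).deriv
  have f3 : deriv (deriv (deriv modularX)) τ = _ := f2.deriv_eq.trans d3.deriv
  have g1 := f1.eq_of_nhds
  have g2 := f2.eq_of_nhds
  have n2 := quartic2_ne_zero hτ
  have n3 := quartic3_ne_zero hτ
  have n4 := quartic4_ne_zero hτ
  have s1 := (logDeriv_quartic_sub hτ).1
  have s2 := (logDeriv_quartic_sub hτ).2
  have s0 := quartic3_eq hτ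
  rw [merDeriv, iteratedDeriv_succ, iteratedDeriv_succ, iteratedDeriv_one, f3, g1, g2,
    modularX_sub_one hτ, modularX_eq]
  simp only [M, N, Pi.add_apply, Pi.sub_apply]
  generalize deriv (logDeriv quartic2) τ = D2 at *
  generalize deriv (logDeriv quartic3) τ = D3 at *
  generalize deriv (logDeriv quartic4) τ = D4 at *
  generalize logDeriv quartic2 τ = L2 at *
  generalize logDeriv quartic3 τ = L3 at *
  generalize logDeriv quartic4 τ = L4 at *
  generalize quartic2 τ = a at *
  generalize quartic3 τ = b at *
  generalize quartic4 τ = c at *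
  have hp : (π * Complex.I : ℂ) ≠ 0 :=
    mul_ne_zero (Complex.ofReal_ne_zero.mpr Real.pi_ne_zero) Complex.I_ne_zero
  generalize (π * Complex.I : ℂ) = p at *
  obtain rfl : L4 = L3 - p * a := by linear_combination -s1
  obtain rfl : L2 = L3 + p * c := by linear_combination s2
  obtain rfl : D4 = D3 - p * a * (L3 + p * c) := by linear_combination -e1
  obtain rfl : D2 = D3 + p * c * (L3 - p * a) := by linear_combination e2
  subst e3 s0
  have e : L3 - p * a - L3 = -(p * a) := by ring
  rw [e]
  field_simp
  ring

end

/-! ### Calculus of polynomials along parametrized curves -/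

theorem evalXY_add (F G : MvPolynomial (Fin 2) ℂ) (x y : ℂ) :
    evalXY (F + G) x y = evalXY F x y + evalXY G x y := map_add _ _ _

theorem evalXY_mul (F G : MvPolynomial (Fin 2) ℂ) (x y : ℂ) :
    evalXY (F * G) x y = evalXY F x y * evalXY G x y := map_mul _ _ _

theorem analyticAt_evalXY (F : MvPolynomial (Fin 2) ℂ) {ξ υ : ℂ → ℂ} {t : ℂ}
    (hξ : AnalyticAt ℂ ξ t) (hυ : AnalyticAt ℂ υ t) :
    AnalyticAt ℂ (fun t => evalXY F (ξ t) (υ t)) t := by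
  induction F using MvPolynomial.induction_on with
  | C a => simpa [evalXY] using analyticAt_const
  | add p q hp hq => simpa only [evalXY_add] using! hp.add hq
  | mul_X p i hp =>
    simp only [evalXY_mul]
    refine hp.mul ?_
    fin_cases i
    · simpa [evalXY] using hξ
    · simpa [evalXY] using hυ

theorem hasDerivAt_evalXY (F : MvPolynomial (Fin 2) ℂ) {ξ υ : ℂ → ℂ} {t ξ' υ' : ℂ}
    (hξ : HasDerivAt ξ ξ' t) (hυ : HasDerivAt υ υ' t) :
    HasDerivAt (fun t => evalXY F (ξ t) (υ t))
      (partialX F (ξ t) (υ t) * ξ' + partialY F (ξ t) (υ t) * υ') t := by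
  induction F using MvPolynomial.induction_on with
  | C a => simpa [evalXY, partialX, partialY] using hasDerivAt_const t a
  | add p q hp hq =>
    simp only [evalXY_add, partialX, partialY, map_add] at hp hq ⊢
    convert! hp.add hq using 1
    ring
  | mul_X p i hp =>
    have hX : HasDerivAt (fun t => evalXY (MvPolynomial.X i) (ξ t) (υ t))
        (partialX (MvPolynomial.X i) (ξ t) (υ t) * ξ' +
          partialY (MvPolynomial.X i) (ξ t) (υ t) * υ') t := by
      fin_cases i
      · simpa [evalXY, partialX, partialY, MvPolynomial.pderiv_X] using hξ
      · simpa [evalXY, partialX, partialY, MvPolynomial.pderiv_X] using hυ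
    simp only [evalXY_mul, partialX, partialY, MvPolynomial.pderiv_mul, evalXY_add] at hp hX ⊢
    convert! hp.mul hX using 1
    ring

theorem pderiv_comm (F : MvPolynomial (Fin 2) ℂ) :
    MvPolynomial.pderiv 1 (MvPolynomial.pderiv 0 F) =
      MvPolynomial.pderiv 0 (MvPolynomial.pderiv 1 F) := by
  induction F using MvPolynomial.induction_on with
  | C a => simp
  | add p q hp hq => simp [hp, hq]
  | mul_X p i hp =>
    simp only [MvPolynomial.pderiv_mul, map_add, hp]
    fin_cases i <;> simp [MvPolynomial.pderiv_X]

theorem hasDerivAt_evalXY_left (F : MvPolynomial (Fin 2) ℂ) (x y : ℂ) :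
    HasDerivAt (fun s => evalXY F s y) (partialX F x y) x := by
  simpa using hasDerivAt_evalXY F (hasDerivAt_id x) (hasDerivAt_const x y)

theorem hasDerivAt_evalXY_right (F : MvPolynomial (Fin 2) ℂ) (x y : ℂ) :
    HasDerivAt (fun s => evalXY F x s) (partialY F x y) y := by
  simpa using hasDerivAt_evalXY F (hasDerivAt_const y x) (hasDerivAt_id y)

theorem deriv_evalXY_left (F : MvPolynomial (Fin 2) ℂ) (y : ℂ) :
    deriv (fun s => evalXY F s y) = fun s => evalXY (MvPolynomial.pderiv 0 F) s y :=
  funext fun x => (hasDerivAt_evalXY_left F x y).deriv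

theorem deriv_evalXY_right (F : MvPolynomial (Fin 2) ℂ) (x : ℂ) :
    deriv (fun s => evalXY F x s) = fun s => evalXY (MvPolynomial.pderiv 1 F) x s :=
  funext fun y => (hasDerivAt_evalXY_right F x y).deriv

/-- The term `(ln (F_y / F_x))_{xy}` of the uniformization equation, in terms of the partial
derivatives of `F`. -/
theorem deriv_logDeriv_partial (F : MvPolynomial (Fin 2) ℂ) {x y : ℂ}
    (hx : partialX F x y ≠ 0) (hy : partialY F x y ≠ 0) :
    deriv (fun s => logDeriv (fun t => partialY F s t / partialX F s t) y) x =
      (partialX (MvPolynomial.pderiv 1 (MvPolynomial.pderiv 1 F)) x y * partialY F x y -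
        partialY (MvPolynomial.pderiv 1 F) x y * partialX (MvPolynomial.pderiv 1 F) x y) /
          partialY F x y ^ 2 -
      (partialX (MvPolynomial.pderiv 0 (MvPolynomial.pderiv 1 F)) x y * partialX F x y -
        partialX (MvPolynomial.pderiv 1 F) x y * partialX (MvPolynomial.pderiv 0 F) x y) /
          partialX F x y ^ 2 := by
  have hcont : ∀ G : MvPolynomial (Fin 2) ℂ, evalXY G x y ≠ 0 → ∀ᶠ s in 𝓝 x, evalXY G s y ≠ 0 :=
    fun G h => (hasDerivAt_evalXY_left G x y).continuousAt.eventually_ne h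
  have h1 : (fun s => logDeriv (fun t => partialY F s t / partialX F s t) y) =ᶠ[𝓝 x]
      fun s => evalXY (MvPolynomial.pderiv 1 (MvPolynomial.pderiv 1 F)) s y /
        evalXY (MvPolynomial.pderiv 1 F) s y -
        evalXY (MvPolynomial.pderiv 0 (MvPolynomial.pderiv 1 F)) s y /
        evalXY (MvPolynomial.pderiv 0 F) s y := by
    filter_upwards [hcont _ hx, hcont _ hy] with s hsx hsy
    change logDeriv (fun t => evalXY (MvPolynomial.pderiv 1 F) s t /
      evalXY (MvPolynomial.pderiv 0 F) s t) y = _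
    rw [logDeriv_div y hsy hsx (hasDerivAt_evalXY_right _ s y).differentiableAt
      (hasDerivAt_evalXY_right _ s y).differentiableAt, logDeriv_apply, logDeriv_apply]
    simp only [deriv_evalXY_right, pderiv_comm]
  rw [h1.deriv_eq]
  exact (((hasDerivAt_evalXY_left _ x y).div (hasDerivAt_evalXY_left _ x y) hy).sub
    ((hasDerivAt_evalXY_left _ x y).div (hasDerivAt_evalXY_left _ x y) hx)).deriv

/-- The rational function `-(x² - x + 1) / (2 x² (x - 1)²)`, the value of `[x, τ]` for the modular
function `x(τ)`. -/
noncomputable def modularSchwarzian (x : ℂ) : ℂ :=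
  -(1 / 2) * ((x ^ 2 - x + 1) / (x ^ 2 * (x - 1) ^ 2))

/-- Chain rule for the Schwarzian along the curve `F = 0`: for an arbitrary parametrization, the
right-hand side of the uniformization equation differs from `[υ, t]` by a multiple of the defect of
`ξ` in the Schwarzian equation of the modular function. -/
theorem deriv_ne_zero_and_merDeriv_eq (F : MvPolynomial (Fin 2) ℂ) {ξ υ : ℂ → ℂ} {t : ℂ}
    (hξ : AnalyticAt ℂ ξ t) (hυ : AnalyticAt ℂ υ t)
    (hF : ∀ᶠ s in 𝓝 t, evalXY F (ξ s) (υ s) = 0) (hξ' : deriv ξ t ≠ 0)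
    (hX : partialX F (ξ t) (υ t) ≠ 0) (hY : partialY F (ξ t) (υ t) ≠ 0) :
    deriv υ t ≠ 0 ∧ fuchsRHS F (ξ t) (υ t) = merDeriv υ t +
      (modularSchwarzian (ξ t) - merDeriv ξ t) * (deriv ξ t ^ 2 / deriv υ t ^ 2) := by
  have hd : ∀ {f : ℂ → ℂ}, AnalyticAt ℂ f t → ∀ᶠ s in 𝓝 t, HasDerivAt f (deriv f s) s :=
    fun hf => hf.eventually_analyticAt.mono fun s hs => hs.differentiableAt.hasDerivAt
  have hzero : ∀ {f g : ℂ → ℂ}, (∀ᶠ s in 𝓝 t, f s = 0) → (∀ᶠ s in 𝓝 t, HasDerivAt f (g s) s) →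
      ∀ᶠ s in 𝓝 t, g s = 0 := by
    intro f g hf hfg
    filter_upwards [hf.eventually_nhds, hfg] with s hs hs'
    have : f =ᶠ[𝓝 s] fun _ => 0 := hs
    rw [← hs'.deriv, this.deriv_eq, deriv_const]
  -- the first three derivatives of the relation `F(ξ, υ) = 0`
  have x1 := hd hξ
  have x2 := hd hξ.deriv
  have x3 := hd hξ.deriv.deriv
  have y1 := hd hυ
  have y2 := hd hυ.deriv
  have y3 := hd hυ.deriv.deriv
  have e1 := hzero hF (x1.and y1 |>.mono fun s hs => hasDerivAt_evalXY F hs.1 hs.2)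
  have e2 := hzero e1 (by
    filter_upwards [x1, x2, y1, y2] with s x1 x2 y1 y2
    exact ((hasDerivAt_evalXY (MvPolynomial.pderiv 0 F) x1 y1).mul x2).add
      ((hasDerivAt_evalXY (MvPolynomial.pderiv 1 F) x1 y1).mul y2))
  have e3 := hzero e2 (by
    filter_upwards [x1, x2, x3, y1, y2, y3] with s x1 x2 x3 y1 y2 y3
    exact ((((((hasDerivAt_evalXY _ x1 y1).mul x2).add
      ((hasDerivAt_evalXY _ x1 y1).mul y2)).mul x2).add
      ((hasDerivAt_evalXY _ x1 y1).mul x3))).add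
      ((((((hasDerivAt_evalXY _ x1 y1).mul x2).add
      ((hasDerivAt_evalXY _ x1 y1).mul y2)).mul y2).add
      ((hasDerivAt_evalXY _ x1 y1).mul y3))))
  replace e1 := e1.self_of_nhds
  replace e2 := e2.self_of_nhds
  replace e3 := e3.self_of_nhds
  have hυ' : deriv υ t ≠ 0 := by
    intro h
    rw [h, mul_zero, add_zero] at e1
    exact mul_ne_zero hX hξ' e1
  refine ⟨hυ', ?_⟩
  simp only [fuchsRHS, deriv_logDeriv_partial F hX hY, merDeriv, iteratedDeriv_succ,
    iteratedDeriv_zero, deriv_evalXY_left, deriv_evalXY_right]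
  simp only [partialX, partialY, pderiv_comm, Pi.add_apply, Pi.mul_apply] at e1 e2 e3 hX hY ⊢
  rw [modularSchwarzian]
  generalize ξ t = x at *
  generalize υ t = y at *
  generalize (x ^ 2 - x + 1) / (x ^ 2 * (x - 1) ^ 2) = S at *
  generalize evalXY (MvPolynomial.pderiv 0 (MvPolynomial.pderiv 0 (MvPolynomial.pderiv 0 F))) x y =
    Fxxx at *
  generalize evalXY (MvPolynomial.pderiv 0 (MvPolynomial.pderiv 0 (MvPolynomial.pderiv 1 F))) x y =
    Fxxy at *
  generalize evalXY (MvPolynomial.pderiv 0 (MvPolynomial.pderiv 1 (MvPolynomial.pderiv 1 F))) x y =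
    Fxyy at *
  generalize evalXY (MvPolynomial.pderiv 1 (MvPolynomial.pderiv 1 (MvPolynomial.pderiv 1 F))) x y =
    Fyyy at *
  generalize evalXY (MvPolynomial.pderiv 0 (MvPolynomial.pderiv 0 F)) x y = Fxx at *
  generalize evalXY (MvPolynomial.pderiv 0 (MvPolynomial.pderiv 1 F)) x y = Fxy at *
  generalize evalXY (MvPolynomial.pderiv 1 (MvPolynomial.pderiv 1 F)) x y = Fyy at *
  generalize evalXY (MvPolynomial.pderiv 0 F) x y = Fx at *
  generalize evalXY (MvPolynomial.pderiv 1 F) x y = Fy at *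
  generalize deriv (deriv (deriv ξ)) t = x3 at *
  generalize deriv (deriv ξ) t = x2 at *
  generalize deriv ξ t = x1 at *
  generalize deriv (deriv (deriv υ)) t = y3 at *
  generalize deriv (deriv υ) t = y2 at *
  generalize deriv υ t = y1 at *
  obtain rfl : y1 = -(Fx * x1) / Fy := by
    field_simp
    linear_combination e1
  obtain rfl : y2 = -((Fxx * x1 + Fxy * (-(Fx * x1) / Fy)) * x1 + Fx * x2 +
      (Fxy * x1 + Fyy * (-(Fx * x1) / Fy)) * (-(Fx * x1) / Fy)) / Fy := by
    rw [eq_div_iff hY]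
    linear_combination e2
  -- the third relation determines `y3`
  have hy3 := congrArg (fun L => y3 - L / Fy) e3
  simp only [zero_div, sub_zero] at hy3
  rw [← hy3]
  field_simp
  ring

/-! ### Pole orders in the Fuchsian equation -/

theorem neg_one_le_meromorphicOrderAt_logDeriv {f : ℂ → ℂ} {x : ℂ}
    (hf : MeromorphicAt f x) : (-1 : WithTop ℤ) ≤ meromorphicOrderAt (logDeriv f) x := by
  by_cases h : meromorphicOrderAt f x = ⊤
  · have h0 : f =ᶠ[𝓝[≠] x] fun _ => 0 := meromorphicOrderAt_eq_top_iff.mp h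
    have h1 : meromorphicOrderAt (logDeriv f) x = ⊤ := by
      rw [meromorphicOrderAt_eq_top_iff]
      filter_upwards [h0] with z hz
      simp [logDeriv_apply, hz]
    rw [h1]
    exact le_top
  · by_cases h2 : meromorphicOrderAt f x = 0
    · exact le_trans (by decide) (meromorphicOrderAt_logDeriv_nonneg hf h2)
    · exact (meromorphicOrderAt_logDeriv_eq_neg_one hf h2 h).ge

theorem neg_two_le_meromorphicOrderAt_mul {f g : ℂ → ℂ} {x : ℂ} (hf : MeromorphicAt f x)
    (hg : MeromorphicAt g x) (hf' : (-1 : WithTop ℤ) ≤ meromorphicOrderAt f x)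
    (hg' : (-1 : WithTop ℤ) ≤ meromorphicOrderAt g x) :
    (-2 : WithTop ℤ) ≤ meromorphicOrderAt (f * g) x := by
  rw [meromorphicOrderAt_mul hf hg]
  exact le_trans (by decide) (add_le_add hf' hg')

theorem neg_two_le_meromorphicOrderAt_add {f g : ℂ → ℂ} {x : ℂ} (hf : MeromorphicAt f x)
    (hg : MeromorphicAt g x) (hf' : (-2 : WithTop ℤ) ≤ meromorphicOrderAt f x)
    (hg' : (-2 : WithTop ℤ) ≤ meromorphicOrderAt g x) :
    (-2 : WithTop ℤ) ≤ meromorphicOrderAt (f + g) x :=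
  (le_min hf' hg').trans (meromorphicOrderAt_add hf hg)

theorem neg_two_le_meromorphicOrderAt_const_mul (c : ℂ) {f : ℂ → ℂ} {x : ℂ}
    (hf : MeromorphicAt f x) (hf' : (-2 : WithTop ℤ) ≤ meromorphicOrderAt f x) :
    (-2 : WithTop ℤ) ≤ meromorphicOrderAt ((fun _ => c) * f) x := by
  rw [meromorphicOrderAt_mul (MeromorphicAt.const c x) hf]
  exact hf'.trans (le_add_of_nonneg_left analyticAt_const.meromorphicOrderAt_nonneg)

theorem neg_two_le_meromorphicOrderAt_deriv {f : ℂ → ℂ} {x : ℂ} (hf : MeromorphicAt f x)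
    (hf' : (-1 : WithTop ℤ) ≤ meromorphicOrderAt f x) :
    (-2 : WithTop ℤ) ≤ meromorphicOrderAt (deriv f) x := by
  rcases hf'.eq_or_lt with h | h
  · exact (meromorphicOrderAt_deriv_eq_sub_one (n := -1) (by norm_num) h.symm).ge
  · have h0 : 0 ≤ meromorphicOrderAt f x := by
      cases h2 : meromorphicOrderAt f x with
      | top => exact le_top
      | coe n =>
        rw [h2] at h
        have h3 : (-1 : ℤ) < n := WithTop.coe_lt_coe.mp h
        have h4 : 0 ≤ n := by omega
        exact_mod_cast h4
    obtain ⟨g, hg, hfg⟩ := hf.meromorphicOrderAt_nonneg_iff.mp h0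
    rw [meromorphicOrderAt_congr (EventuallyEq.nhdsNE_deriv hfg)]
    exact le_trans (by decide) hg.deriv.meromorphicOrderAt_nonneg

/-- The Schwarzian derivative `f'''/f' - (3/2) (f''/f')²` has poles of order at most two. -/
theorem neg_two_le_meromorphicOrderAt_merDeriv_mul_sq {f : ℂ → ℂ} {x : ℂ}
    (hf : MeromorphicAt f x) (hne : ∀ᶠ t in 𝓝[≠] x, deriv f t ≠ 0) :
    (-2 : WithTop ℤ) ≤ meromorphicOrderAt (fun t => merDeriv f t * deriv f t ^ 2) x := by
  have h1 := hf.deriv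
  have h2 := h1.logDeriv
  have h3 := h2.deriv
  have e : (fun t => merDeriv f t * deriv f t ^ 2) =ᶠ[𝓝[≠] x]
      deriv (logDeriv (deriv f)) +
        (fun _ => (-1 / 2 : ℂ)) * (logDeriv (deriv f) * logDeriv (deriv f)) := by
    filter_upwards [hne, h1.eventually_analyticAt, h1.deriv.eventually_analyticAt] with t h ha ha'
    have hd : deriv (logDeriv (deriv f)) t = _ :=
      (ha'.differentiableAt.hasDerivAt.div ha.differentiableAt.hasDerivAt h).deriv
    simp only [Pi.add_apply, Pi.mul_apply]
    rw [hd, logDeriv_apply, merDeriv, iteratedDeriv_succ, iteratedDeriv_succ, iteratedDeriv_one]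
    field_simp
    ring
  rw [meromorphicOrderAt_congr e]
  have o2 := neg_one_le_meromorphicOrderAt_logDeriv h1
  exact neg_two_le_meromorphicOrderAt_add h3 ((MeromorphicAt.const _ x).mul (h2.mul h2))
    (neg_two_le_meromorphicOrderAt_deriv h2 o2)
    (neg_two_le_meromorphicOrderAt_const_mul _ (h2.mul h2)
      (neg_two_le_meromorphicOrderAt_mul h2 h2 o2 o2))

theorem meromorphicAt_merDeriv {f : ℂ → ℂ} {x : ℂ} (hf : MeromorphicAt f x) :
    MeromorphicAt (merDeriv f) x := by
  unfold merDeriv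
  simp only [iteratedDeriv_succ, iteratedDeriv_zero]
  have h1 := hf.deriv
  have h2 := h1.deriv
  have h3 := h2.deriv
  exact (h3.div (h1.pow 3)).sub ((MeromorphicAt.const _ x).mul ((h2.pow 2).div (h1.pow 4)))

/-- Written with the logarithmic derivatives `f'/f` and `f'/(f-1)`, the pulled back quadratic
differential of the modular function is visibly of order at least `-2`, also where `f` takes one
of the values `0, 1, ∞`. -/
theorem neg_two_le_meromorphicOrderAt_modularSchwarzian {f : ℂ → ℂ} {x : ℂ}
    (hf : MeromorphicAt f x) (h0 : ∀ᶠ t in 𝓝[≠] x, f t ≠ 0) (h1 : ∀ᶠ t in 𝓝[≠] x, f t ≠ 1) :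
    (-2 : WithTop ℤ) ≤
      meromorphicOrderAt (fun t => modularSchwarzian (f t) * deriv f t ^ 2) x := by
  let g : ℂ → ℂ := fun t => f t - 1
  have hg : MeromorphicAt g x := hf.sub (MeromorphicAt.const 1 x)
  have l0 := hf.logDeriv
  have l1 := hg.logDeriv
  have o0 := neg_one_le_meromorphicOrderAt_logDeriv hf
  have o1 := neg_one_le_meromorphicOrderAt_logDeriv hg
  have e : (fun t => modularSchwarzian (f t) * deriv f t ^ 2) =ᶠ[𝓝[≠] x]
      ((fun _ => (-1 / 2 : ℂ)) * (logDeriv f * logDeriv f) +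
        (fun _ => (-1 / 2 : ℂ)) * (logDeriv g * logDeriv g)) +
        (fun _ => (1 / 2 : ℂ)) * (logDeriv f * logDeriv g) := by
    filter_upwards [h0, h1] with t h0 h1
    have h1' : f t - 1 ≠ 0 := sub_ne_zero.mpr h1
    have hd : deriv g t = deriv f t := deriv_sub_const 1
    simp only [Pi.add_apply, Pi.mul_apply, modularSchwarzian, logDeriv_apply, hd, g]
    field_simp
    ring
  rw [meromorphicOrderAt_congr e]
  have m1 := (MeromorphicAt.const (-1 / 2 : ℂ) x).mul (l0.mul l0)
  have m2 := (MeromorphicAt.const (-1 / 2 : ℂ) x).mul (l1.mul l1)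
  have m3 := (MeromorphicAt.const (1 / 2 : ℂ) x).mul (l0.mul l1)
  refine neg_two_le_meromorphicOrderAt_add (m1.add m2) m3
    (neg_two_le_meromorphicOrderAt_add m1 m2 ?_ ?_) ?_
  · exact neg_two_le_meromorphicOrderAt_const_mul _ (l0.mul l0)
      (neg_two_le_meromorphicOrderAt_mul l0 l0 o0 o0)
  · exact neg_two_le_meromorphicOrderAt_const_mul _ (l1.mul l1)
      (neg_two_le_meromorphicOrderAt_mul l1 l1 o1 o1)
  · exact neg_two_le_meromorphicOrderAt_const_mul _ (l0.mul l1)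
      (neg_two_le_meromorphicOrderAt_mul l0 l1 o0 o1)

theorem eventually_ne_of_not_eventuallyConst {f : ℂ → ℂ} {x : ℂ} (hf : MeromorphicAt f x)
    (hc : ¬ ∃ c : ℂ, ∀ᶠ t in 𝓝[≠] x, f t = c) (c : ℂ) : ∀ᶠ t in 𝓝[≠] x, f t ≠ c := by
  have := (meromorphicOrderAt_ne_top_iff_eventually_ne_zero
    (hf.fun_sub (MeromorphicAt.const c x))).mp fun h => hc ⟨c, by
      filter_upwards [meromorphicOrderAt_eq_top_iff.mp h] with t ht
      exact sub_eq_zero.mp ht⟩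
  filter_upwards [this] with t ht
  exact sub_ne_zero.mp ht

theorem eventually_deriv_ne_zero_of_not_eventuallyConst {f : ℂ → ℂ} {x : ℂ}
    (hf : MeromorphicAt f x) (hc : ¬ ∃ c : ℂ, ∀ᶠ t in 𝓝[≠] x, f t = c) :
    ∀ᶠ t in 𝓝[≠] x, deriv f t ≠ 0 := by
  rw [← meromorphicOrderAt_ne_top_iff_eventually_ne_zero hf.deriv]
  have hsub : ∀ c : ℂ, MeromorphicAt (fun t => f t - c) x :=
    fun c => hf.fun_sub (MeromorphicAt.const c x)
  obtain ⟨c, h0⟩ : ∃ c : ℂ, meromorphicOrderAt (fun t => f t - c) x ≠ 0 := by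
    by_cases h : meromorphicOrderAt f x = 0
    · obtain ⟨c, -, hlim⟩ := tendsto_ne_zero_of_meromorphicOrderAt_eq_zero hf h
      refine ⟨c, ((tendsto_zero_iff_meromorphicOrderAt_pos (hsub c)).mp ?_).ne'⟩
      simpa using hlim.sub_const c
    · exact ⟨0, by simpa using h⟩
  have htop := (meromorphicOrderAt_ne_top_iff_eventually_ne_zero (hsub c)).mpr
    ((eventually_ne_of_not_eventuallyConst hf hc c).mono fun t ht => sub_ne_zero.mpr ht)
  lift meromorphicOrderAt (fun t => f t - c) x to ℤ using htop with n hn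
  have := meromorphicOrderAt_deriv_eq_sub_one
    (Int.cast_ne_zero.mpr (by exact_mod_cast h0)) hn.symm
  rw [show deriv (fun t => f t - c) = deriv f from funext fun t => deriv_sub_const c] at this
  rw [this]
  exact WithTop.coe_ne_top

/-- If `F_x` and `F_y` do not vanish identically along parametrizations of the curve `F = 0`, the
uniformization equation is Fuchsian. -/
theorem isFuchsianOnCurve_of_eventually_ne_zero {F : MvPolynomial (Fin 2) ℂ}
    (hξ' : ∀ ξ υ : ℂ → ℂ, MeromorphicAt ξ 0 → MeromorphicAt υ 0 →
      (∀ᶠ t in 𝓝[≠] (0 : ℂ), evalXY F (ξ t) (υ t) = 0) →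
      (¬ ∃ c : ℂ, ∀ᶠ t in 𝓝[≠] (0 : ℂ), υ t = c) → ¬ ∃ c : ℂ, ∀ᶠ t in 𝓝[≠] (0 : ℂ), ξ t = c)
    (hne : ∀ ξ υ : ℂ → ℂ, MeromorphicAt ξ 0 → MeromorphicAt υ 0 →
      (∀ᶠ t in 𝓝[≠] (0 : ℂ), evalXY F (ξ t) (υ t) = 0) →
      (¬ ∃ c : ℂ, ∀ᶠ t in 𝓝[≠] (0 : ℂ), ξ t = c) →
      ∀ᶠ t in 𝓝[≠] (0 : ℂ), partialX F (ξ t) (υ t) ≠ 0 ∧ partialY F (ξ t) (υ t) ≠ 0) :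
    IsFuchsianOnCurve F (fuchsRHS F) := by
  intro ξ υ hξ hυ hF hc
  have hcξ := hξ' ξ υ hξ hυ hF hc
  have hne' := hne ξ υ hξ hυ hF hcξ
  have hdξ := eventually_deriv_ne_zero_of_not_eventuallyConst hξ hcξ
  have hval := eventually_ne_of_not_eventuallyConst hξ hcξ
  have key : ∀ᶠ t in 𝓝[≠] (0 : ℂ), deriv υ t ≠ 0 ∧ fuchsRHS F (ξ t) (υ t) = merDeriv υ t +
      (modularSchwarzian (ξ t) - merDeriv ξ t) * (deriv ξ t ^ 2 / deriv υ t ^ 2) := by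
    filter_upwards [hne', hdξ, hξ.eventually_analyticAt, hυ.eventually_analyticAt,
      eventually_eventually_nhdsWithin.mpr hF, self_mem_nhdsWithin] with t h1 h2 h3 h4 h5 h6
    exact deriv_ne_zero_and_merDeriv_eq F h3 h4
      (by rwa [IsOpen.nhdsWithin_eq isOpen_compl_singleton h6] at h5) h2 h1.1 h1.2
  have hS : MeromorphicAt (fun t => modularSchwarzian (ξ t)) 0 := by
    unfold modularSchwarzian
    have c1 := MeromorphicAt.const (1 : ℂ) (0 : ℂ)
    exact (MeromorphicAt.const _ 0).mul ((((hξ.pow 2).sub hξ).add c1).div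
      ((hξ.pow 2).mul ((hξ.sub c1).pow 2)))
  constructor
  · refine MeromorphicAt.congr (((meromorphicAt_merDeriv hυ).add
      ((hS.sub (meromorphicAt_merDeriv hξ)).mul ((hξ.deriv.pow 2).div (hυ.deriv.pow 2))))) ?_
    filter_upwards [key] with t ht
    exact ht.2.symm
  · have e : (fun t => (fuchsRHS F (ξ t) (υ t) - merDeriv υ t) * deriv υ t ^ 2) =ᶠ[𝓝[≠] 0]
        (fun t => modularSchwarzian (ξ t) * deriv ξ t ^ 2) +
          (fun _ => (-1 : ℂ)) * fun t => merDeriv ξ t * deriv ξ t ^ 2 := by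
      filter_upwards [key] with t ht
      have := ht.1
      simp only [Pi.add_apply, Pi.mul_apply]
      rw [ht.2]
      field_simp
      ring
    rw [meromorphicOrderAt_congr e]
    have m := (meromorphicAt_merDeriv hξ).mul (hξ.deriv.pow 2)
    exact neg_two_le_meromorphicOrderAt_add (hS.mul (hξ.deriv.pow 2))
      ((MeromorphicAt.const _ 0).mul m)
      (neg_two_le_meromorphicOrderAt_modularSchwarzian hξ (hval 0) (hval 1))
      (neg_two_le_meromorphicOrderAt_const_mul _ m
        (neg_two_le_meromorphicOrderAt_merDeriv_mul_sq hξ hdξ))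

/-! ### Elimination for irreducible plane curves -/

open Polynomial in
/-- Clearing denominators in the Bézout identity over the field of fractions. -/
theorem Polynomial.exists_mul_add_mul_eq_C {R : Type*} [CommRing R] [IsDomain R]
    [UniqueFactorizationMonoid R] [NormalizedGCDMonoid R] {P Q : R[X]} (hP : Irreducible P)
    (hdeg : P.natDegree ≠ 0) (hPQ : ¬ P ∣ Q) :
    ∃ (A B : R[X]) (r : R), r ≠ 0 ∧ A * P + B * Q = C r := by
  let K := FractionRing R
  let φ := algebraMap R K
  have hφ : Function.Injective φ := IsFractionRing.injective R K
  have hmap : Function.Injective (Polynomial.map φ) := Polynomial.map_injective φ hφ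
  have hirr : Irreducible (P.map φ) :=
    ((hP.isPrimitive hdeg).irreducible_iff_irreducible_map_fraction_map).mp hP
  have hclear : ∀ a : K[X], ∃ (b : R) (A : R[X]), b ≠ 0 ∧ A.map φ = C (φ b) * a := by
    intro a
    obtain ⟨b, hb, h⟩ := IsLocalization.integerNormalization_spec (nonZeroDivisors R) a
    refine ⟨b, _, nonZeroDivisors.ne_zero hb, h.trans ?_⟩
    rw [Algebra.smul_def]
    rfl
  have hndvd : ¬ P.map φ ∣ Q.map φ := by
    rintro ⟨a, ha⟩
    obtain ⟨b, A, hb, hA⟩ := hclear a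
    have h1 : C b * Q = P * A := hmap (by
      rw [Polynomial.map_mul, Polynomial.map_mul, map_C, hA, ha]
      ring)
    rcases hP.prime.dvd_or_dvd (Dvd.intro _ h1.symm) with h | h
    · have := natDegree_le_of_dvd h (C_ne_zero.mpr hb)
      rw [natDegree_C] at this
      omega
    · exact hPQ h
  obtain ⟨a, b, hab⟩ := (hirr.coprime_iff_not_dvd.mpr hndvd)
  obtain ⟨c, A, hc, hA⟩ := hclear a
  obtain ⟨d, B, hd, hB⟩ := hclear b
  refine ⟨C d * A, C c * B, c * d, mul_ne_zero hc hd, hmap ?_⟩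
  simp only [Polynomial.map_add, Polynomial.map_mul, map_C, hA, hB, map_mul]
  linear_combination (C (φ c) * C (φ d)) * hab

open Polynomial in
/-- A polynomial in `x, y`, as a polynomial in `y` with coefficients in `ℂ[x]`. -/
noncomputable def asPolyInY (F : MvPolynomial (Fin 2) ℂ) : ℂ[X][X] :=
  (Polynomial.Bivariate.equivMvPolynomial ℂ).symm F

theorem eval_map_asPolyInY (F : MvPolynomial (Fin 2) ℂ) (x y : ℂ) :
    ((asPolyInY F).map (Polynomial.evalRingHom x)).eval y = evalXY F x y := by
  induction F using MvPolynomial.induction_on with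
  | C a => simp [asPolyInY, evalXY]
  | add p q hp hq =>
    rw [evalXY_add, ← hp, ← hq]
    simp [asPolyInY]
  | mul_X p i hp =>
    rw [evalXY_mul, ← hp]
    fin_cases i <;> simp [asPolyInY, evalXY]

theorem asPolyInY_pderiv_one (F : MvPolynomial (Fin 2) ℂ) :
    asPolyInY (MvPolynomial.pderiv 1 F) = Polynomial.derivative (asPolyInY F) := by
  have h := Polynomial.Bivariate.pderiv_one_equivMvPolynomial (asPolyInY F)
  simp only [asPolyInY, AlgEquiv.apply_symm_apply] at h
  simp only [asPolyInY, h, AlgEquiv.symm_apply_apply]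

theorem irreducible_asPolyInY {F : MvPolynomial (Fin 2) ℂ} (hF : Irreducible F) :
    Irreducible (asPolyInY F) :=
  (MulEquiv.irreducible_iff (Polynomial.Bivariate.equivMvPolynomial ℂ).symm).mpr hF

/-- The points of the curve `F = 0` with `G = 0` lie over finitely many `x`, the roots of a
polynomial in the elimination ideal. -/
theorem exists_eval_eq_zero_of_not_dvd {F G : MvPolynomial (Fin 2) ℂ} (hF : Irreducible F)
    (hdeg : (asPolyInY F).natDegree ≠ 0) (hFG : ¬ F ∣ G) :
    ∃ r : Polynomial ℂ, r ≠ 0 ∧ ∀ x y, evalXY F x y = 0 → evalXY G x y = 0 → r.eval x = 0 := by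
  classical
  have hndvd : ¬ asPolyInY F ∣ asPolyInY G := fun h => hFG <|
    (map_dvd_iff (Polynomial.Bivariate.equivMvPolynomial ℂ).symm).mp h
  obtain ⟨A, B, r, hr, h⟩ :=
    Polynomial.exists_mul_add_mul_eq_C (irreducible_asPolyInY hF) hdeg hndvd
  refine ⟨r, hr, fun x y hFx hGx => ?_⟩
  have h2 := congrArg (fun P => (P.map (Polynomial.evalRingHom x)).eval y) h
  simp only [Polynomial.map_add, Polynomial.map_mul, Polynomial.eval_add, Polynomial.eval_mul,
    eval_map_asPolyInY, hFx, hGx, mul_zero, add_zero, Polynomial.map_C, Polynomial.eval_C] at h2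
  exact h2.symm

/-- A curve with points over infinitely many `x` is not a vertical line. -/
theorem natDegree_asPolyInY_ne_zero {F : MvPolynomial (Fin 2) ℂ} (hF : Irreducible F)
    {S : Set ℂ} (hS : S.Infinite) (h : ∀ x ∈ S, ∃ y, evalXY F x y = 0) :
    (asPolyInY F).natDegree ≠ 0 := by
  intro h0
  obtain ⟨f, hf⟩ := Polynomial.natDegree_eq_zero.mp h0
  have hz : f = 0 := Polynomial.eq_zero_of_infinite_isRoot f <| hS.mono fun x hx => by
    obtain ⟨y, hy⟩ := h x hx
    rw [← eval_map_asPolyInY, ← hf] at hy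
    simpa using hy
  rw [hz, Polynomial.C_0] at hf
  exact (irreducible_asPolyInY hF).ne_zero hf.symm

/-- A polynomial `G` which vanishes at points of the irreducible curve `F = 0` over infinitely many
`x` vanishes on the whole curve. -/
theorem dvd_of_infinite {F G : MvPolynomial (Fin 2) ℂ} (hF : Irreducible F) {S : Set ℂ}
    (hS : S.Infinite) (h : ∀ x ∈ S, ∃ y, evalXY F x y = 0 ∧ evalXY G x y = 0) : F ∣ G := by
  by_contra hFG
  obtain ⟨r, hr, hr'⟩ := exists_eval_eq_zero_of_not_dvd hF
    (natDegree_asPolyInY_ne_zero hF hS fun x hx => (h x hx).imp fun _ h => h.1) hFG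
  exact hr <| Polynomial.eq_zero_of_infinite_isRoot r <| hS.mono fun x hx => by
    obtain ⟨y, hy1, hy2⟩ := h x hx
    exact hr' x y hy1 hy2

theorem evalXY_eq_zero_of_dvd {F G : MvPolynomial (Fin 2) ℂ} (h : F ∣ G) {x y : ℂ}
    (hF : evalXY F x y = 0) : evalXY G x y = 0 := by
  obtain ⟨H, rfl⟩ := h
  rw [evalXY_mul, hF, zero_mul]

/-- By comparison of degrees. -/
theorem not_dvd_pderiv {F : MvPolynomial (Fin 2) ℂ} (i : Fin 2)
    (h : MvPolynomial.pderiv i F ≠ 0) : ¬ F ∣ MvPolynomial.pderiv i F := by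
  rintro ⟨H, hH⟩
  have hF0 : F ≠ 0 := by
    rintro rfl
    simp at h
  have hH0 : H ≠ 0 := by
    rintro rfl
    exact h (by simpa using hH)
  have hdeg := MvPolynomial.degreeOf_mul_eq (n := i) hF0 hH0
  have hpos : 0 < F.degreeOf i := by
    by_contra h0
    have h1 : F.degreeOf i = 0 := by omega
    apply h
    refine MvPolynomial.pderiv_eq_zero_of_notMem_vars fun hi => ?_
    obtain ⟨d, hd, hid⟩ := (MvPolynomial.mem_vars_iff_mem_support i).mp hi
    have := MvPolynomial.monomial_le_degreeOf i hd
    rw [Finsupp.mem_support_iff] at hid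
    omega
  have hlt : (MvPolynomial.pderiv i F).degreeOf i < F.degreeOf i := by
    rw [MvPolynomial.degreeOf_lt_iff hpos]
    intro m hm
    rw [MvPolynomial.mem_support_iff, MvPolynomial.coeff_pderiv] at hm
    have := MvPolynomial.monomial_le_degreeOf i
      (MvPolynomial.mem_support_iff.mpr (left_ne_zero_of_mul hm))
    simp at this
    omega
  rw [hH] at hlt
  omega

theorem pderiv_one_ne_zero {F : MvPolynomial (Fin 2) ℂ}
    (hdeg : (asPolyInY F).natDegree ≠ 0) : MvPolynomial.pderiv 1 F ≠ 0 := by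
  intro h
  have h1 := asPolyInY_pderiv_one F
  rw [h, asPolyInY, map_zero] at h1
  exact hdeg (Polynomial.derivative_eq_zero.mp h1.symm)

/-- Along a non-constant parametrization of the curve `F = 0`, polynomials which are not divisible
by `F` have isolated zeros. -/
theorem eventually_evalXY_ne_zero {F G : MvPolynomial (Fin 2) ℂ} (hF : Irreducible F)
    (hdeg : (asPolyInY F).natDegree ≠ 0) (hFG : ¬ F ∣ G) {ξ υ : ℂ → ℂ} {t : ℂ}
    (hξ : MeromorphicAt ξ t) (hc : ¬ ∃ c : ℂ, ∀ᶠ s in 𝓝[≠] t, ξ s = c)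
    (h : ∀ᶠ s in 𝓝[≠] t, evalXY F (ξ s) (υ s) = 0) :
    ∀ᶠ s in 𝓝[≠] t, evalXY G (ξ s) (υ s) ≠ 0 := by
  classical
  obtain ⟨r, hr, hr'⟩ := exists_eval_eq_zero_of_not_dvd hF hdeg hFG
  have hroots : ∀ᶠ s in 𝓝[≠] t, ∀ c ∈ r.roots.toFinset, ξ s ≠ c :=
    (Finset.eventually_all _).mpr fun c _ => eventually_ne_of_not_eventuallyConst hξ hc c
  filter_upwards [h, hroots] with s hs hs' hG
  exact hs' (ξ s) (by simpa [hr] using hr' _ _ hs hG) rfl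

/-- A curve which is not a vertical line has no parametrization with `x` constant and `y` not. -/
theorem not_eventuallyConst_of_curve {F : MvPolynomial (Fin 2) ℂ} (hF : Irreducible F)
    (hdeg : (asPolyInY F).natDegree ≠ 0) {ξ υ : ℂ → ℂ} {t : ℂ} (hυ : MeromorphicAt υ t)
    (h : ∀ᶠ s in 𝓝[≠] t, evalXY F (ξ s) (υ s) = 0)
    (hc : ¬ ∃ c : ℂ, ∀ᶠ s in 𝓝[≠] t, υ s = c) : ¬ ∃ c : ℂ, ∀ᶠ s in 𝓝[≠] t, ξ s = c := by
  classical
  rintro ⟨c, hξ⟩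
  let p := (asPolyInY F).map (Polynomial.evalRingHom c)
  have hp : p ≠ 0 := by
    intro h0
    have h1 : Polynomial.C (Polynomial.X - Polynomial.C c) ∣ asPolyInY F := by
      rw [Polynomial.C_dvd_iff_dvd_coeff]
      intro i
      rw [Polynomial.dvd_iff_isRoot]
      have := congrArg (fun q => q.coeff i) h0
      simpa [p] using this
    obtain ⟨Q, hQ⟩ := h1
    rcases (irreducible_asPolyInY hF).isUnit_or_isUnit hQ with h2 | h2
    · rw [Polynomial.isUnit_C] at h2
      exact Polynomial.not_isUnit_X_sub_C c h2
    · obtain ⟨q, -, rfl⟩ := Polynomial.isUnit_iff.mp h2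
      rw [← Polynomial.C_mul] at hQ
      rw [hQ, Polynomial.natDegree_C] at hdeg
      exact hdeg rfl
  have hroots : ∀ᶠ s in 𝓝[≠] t, ∀ c ∈ p.roots.toFinset, υ s ≠ c :=
    (Finset.eventually_all _).mpr fun c _ => eventually_ne_of_not_eventuallyConst hυ hc c
  obtain ⟨s, hs, hs1, hs2⟩ := (h.and (hξ.and hroots)).exists
  rw [← eval_map_asPolyInY, hs1] at hs
  exact hs2 (υ s) (by simpa [hp] using hs) rfl

/-- The curve must not be a line `x = c` or `y = c`, on which `F_y` or `F_x` vanishes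
identically. -/
theorem isFuchsianOnCurve_fuchsRHS {F : MvPolynomial (Fin 2) ℂ} (hF : Irreducible F)
    (hdeg : (asPolyInY F).natDegree ≠ 0) (hX : MvPolynomial.pderiv 0 F ≠ 0) :
    IsFuchsianOnCurve F (fuchsRHS F) :=
  isFuchsianOnCurve_of_eventually_ne_zero
    (fun _ _ _ hυ h hc => not_eventuallyConst_of_curve hF hdeg hυ h hc)
    (fun _ _ hξ _ h hc =>
      (eventually_evalXY_ne_zero hF hdeg (not_dvd_pderiv 0 hX) hξ hc h).and
        (eventually_evalXY_ne_zero hF hdeg (not_dvd_pderiv 1 (pderiv_one_ne_zero hdeg)) hξ hc h))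

/-! ### Formal solutions of second order equations -/

namespace PowerSeries

/-- The derivation `(t / n) d/dt` of `ℂ⟦t⟧`; it extends `X d/dX` for `X = t ^ n`. -/
noncomputable def euler (n : ℕ) : Derivation ℂ ℂ⟦X⟧ ℂ⟦X⟧ :=
  (C (n : ℂ)⁻¹ * X) • derivative ℂ

theorem euler_apply (n : ℕ) (a : ℂ⟦X⟧) :
    euler n a = C (n : ℂ)⁻¹ * X * derivative ℂ a := rfl

@[simp] theorem constantCoeff_euler (n : ℕ) (a : ℂ⟦X⟧) : constantCoeff (euler n a) = 0 := by
  simp [euler_apply]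

@[simp] theorem euler_C (n : ℕ) (c : ℂ) : euler n (C c) = 0 := by
  simp [euler_apply]

theorem euler_X_pow_mul (n k : ℕ) (a : ℂ⟦X⟧) :
    euler n (X ^ k * a) = X ^ k * (C ((k : ℂ) / n) * a + euler n a) := by
  rw [Derivation.leibniz, euler_apply n (X ^ k), derivative_pow, derivative_X]
  rcases k with _ | k
  · simp
  · simp only [smul_eq_mul, div_eq_mul_inv, map_mul, Nat.add_sub_cancel]
    rw [show (C ((k + 1 : ℕ) : ℂ) : ℂ⟦X⟧) = ((k + 1 : ℕ) : ℂ⟦X⟧) from map_natCast _ _]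
    ring

theorem euler_rescale (n : ℕ) (ζ : ℂ) (a : ℂ⟦X⟧) :
    euler n (rescale ζ a) = rescale ζ (euler n a) := by
  ext k
  rcases k with _ | k
  · simp [euler_apply]
  · simp only [euler_apply, mul_assoc, coeff_C_mul, coeff_succ_X_mul, coeff_derivative,
      coeff_rescale]
    ring

theorem exists_eq_X_pow_mul {a : ℂ⟦X⟧} (ha : a ≠ 0) :
    ∃ (m : ℕ) (u : ℂ⟦X⟧), a = X ^ m * u ∧ constantCoeff u ≠ 0 :=
  ⟨_, _, X_pow_order_mul_divXPowOrder.symm, by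
    rwa [Ne, constantCoeff_divXPowOrder_eq_zero_iff]⟩

/-- The order of `a(ζ t) - a(t)` is not divisible by the order of the root of unity `ζ`. -/
theorem exists_rescale_eq_add {n : ℕ} {ζ : ℂ} (hζ : IsPrimitiveRoot ζ n) {a : ℂ⟦X⟧}
    (ha : rescale ζ a ≠ a) :
    ∃ (k : ℕ) (e : ℂ⟦X⟧), rescale ζ a = a + X ^ k * e ∧ constantCoeff e ≠ 0 ∧ ¬ n ∣ k := by
  obtain ⟨k, e, hk, he⟩ := exists_eq_X_pow_mul (sub_ne_zero.mpr ha)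
  refine ⟨k, e, by rw [← hk]; ring, he, fun hn => he ?_⟩
  have h := congrArg (coeff k) hk
  rw [map_sub, coeff_rescale, (hζ.pow_eq_one_iff_dvd k).mpr hn, one_mul, sub_self,
    coeff_X_pow_mul'] at h
  simpa using h.symm

variable (x₀ r : ℂ) (n : ℕ)

/-- The value `G(x₀ + r t ^ n, v(t))` of a polynomial, as a formal power series. -/
noncomputable def evalAlong (v : ℂ⟦X⟧) : MvPolynomial (Fin 2) ℂ →ₐ[ℂ] ℂ⟦X⟧ :=
  MvPolynomial.aeval ![C x₀ + C r * X ^ n, v]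

theorem constantCoeff_evalAlong (hn : n ≠ 0) (v : ℂ⟦X⟧) (G : MvPolynomial (Fin 2) ℂ) :
    constantCoeff (evalAlong x₀ r n v G) = evalXY G x₀ (constantCoeff v) := by
  induction G using MvPolynomial.induction_on with
  | C a => simp [evalAlong, evalXY]
  | add p q hp hq => rw [map_add, map_add, hp, hq, evalXY_add]
  | mul_X p i hp =>
    rw [map_mul, map_mul, hp, evalXY_mul]
    fin_cases i <;> simp [evalAlong, evalXY, hn]

theorem rescale_evalAlong {ζ : ℂ} (hζ : ζ ^ n = 1) (v : ℂ⟦X⟧) (G : MvPolynomial (Fin 2) ℂ) :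
    rescale ζ (evalAlong x₀ r n v G) = evalAlong x₀ r n (rescale ζ v) G := by
  have hC : ∀ c : ℂ, rescale ζ (C c) = C c := fun c => by
    ext k
    rw [coeff_rescale, coeff_C]
    split_ifs with hk <;> simp [hk]
  induction G using MvPolynomial.induction_on with
  | C a => simp [evalAlong, hC]
  | add p q hp hq => rw [map_add, map_add, hp, hq, map_add]
  | mul_X p i hp =>
    rw [map_mul, map_mul, hp, map_mul]
    congr 1
    fin_cases i
    · have hX : rescale ζ ((X : ℂ⟦X⟧) ^ n) = X ^ n := by
        rw [map_pow, rescale_X, mul_pow, ← map_pow, hζ, map_one, one_mul]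
      simp [evalAlong, hC, hX, -map_pow]
    · simp [evalAlong]

/-- Taylor's formula of order zero. -/
theorem exists_evalAlong_add (v d : ℂ⟦X⟧) (G : MvPolynomial (Fin 2) ℂ) :
    ∃ g, evalAlong x₀ r n (v + d) G = evalAlong x₀ r n v G + d * g := by
  induction G using MvPolynomial.induction_on with
  | C a => exact ⟨0, by simp [evalAlong]⟩
  | add p q hp hq =>
    obtain ⟨g, hg⟩ := hp
    obtain ⟨h, hh⟩ := hq
    exact ⟨g + h, by rw [map_add, map_add, hg, hh]; ring⟩
  | mul_X p i hp =>
    obtain ⟨g, hg⟩ := hp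
    rw [map_mul, map_mul, hg]
    fin_cases i
    · exact ⟨g * (C x₀ + C r * X ^ n), by simp [evalAlong]; ring⟩
    · exact ⟨g * (v + d) + evalAlong x₀ r n v p, by simp [evalAlong]; ring⟩

variable {x₀ r n}

/-- A formal solution of a second order equation at a regular point has no ramification: two
distinct solutions `v(t)` and `v(ζ t)` would differ by `c t ^ k + ⋯` with `(k / n)² = k / n`. -/
theorem rescale_eq_of_regular (hn : n ≠ 0) {ζ : ℂ} (hζ : IsPrimitiveRoot ζ n) {v : ℂ⟦X⟧}
    {P Q R S : MvPolynomial (Fin 2) ℂ} (hP : evalXY P x₀ (constantCoeff v) ≠ 0)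
    (h : evalAlong x₀ r n v P * (euler n (euler n v) - euler n v)
      = evalAlong x₀ r n v Q * euler n v ^ 2 + C r * X ^ n * evalAlong x₀ r n v R * euler n v
        + (C r * X ^ n) ^ 2 * evalAlong x₀ r n v S) :
    rescale ζ v = v := by
  by_contra hne
  obtain ⟨k, e, hv, he, hk⟩ := exists_rescale_eq_add hζ hne
  have h2 := congrArg (rescale ζ) h
  simp only [map_mul, map_add, map_sub, map_pow, ← euler_rescale,
    rescale_evalAlong x₀ r n hζ.pow_eq_one] at h2
  have hC : rescale ζ (C r) * rescale ζ X ^ n = C r * X ^ n := by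
    have := rescale_evalAlong 0 r n hζ.pow_eq_one 0 (MvPolynomial.X 0)
    simpa [evalAlong] using this
  rw [hC, hv] at h2
  obtain ⟨p, hp⟩ := exists_evalAlong_add x₀ r n v (X ^ k * e) P
  obtain ⟨q, hq⟩ := exists_evalAlong_add x₀ r n v (X ^ k * e) Q
  obtain ⟨b, hb⟩ := exists_evalAlong_add x₀ r n v (X ^ k * e) R
  obtain ⟨s, hs⟩ := exists_evalAlong_add x₀ r n v (X ^ k * e) S
  rw [hp, hq, hb, hs] at h2
  set ρ : ℂ := (k : ℂ) / n with hρ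
  set e₁ := C ρ * e + euler n e with he₁
  set e₂ := C ρ * e₁ + euler n e₁ with he₂
  rw [map_add (euler n) v, euler_X_pow_mul, ← hρ, ← he₁, map_add (euler n) (euler n v),
    euler_X_pow_mul, ← hρ, ← he₂] at h2
  have h3 : evalAlong x₀ r n v P * (e₂ - e₁)
      + e * p * (euler n (euler n v) + X ^ k * e₂ - (euler n v + X ^ k * e₁))
      = evalAlong x₀ r n v Q * (2 * euler n v + X ^ k * e₁) * e₁
        + e * q * (euler n v + X ^ k * e₁) ^ 2
        + C r * X ^ n * (evalAlong x₀ r n v R * e₁ + e * b * (euler n v + X ^ k * e₁))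
        + (C r * X ^ n) ^ 2 * (e * s) := by
    refine mul_left_cancel₀ (pow_ne_zero k (X_ne_zero (R := ℂ))) ?_
    linear_combination h2 - h
  have hk0 : k ≠ 0 := by
    rintro rfl
    exact hk (dvd_zero n)
  have h4 := congrArg constantCoeff h3
  simp [he₂, he₁, constantCoeff_evalAlong _ _ _ hn, hn, hk0] at h4
  have hn' : (n : ℂ) ≠ 0 := Nat.cast_ne_zero.mpr hn
  have h5 : ρ * ρ * constantCoeff e - ρ * constantCoeff e = 0 := by
    rcases h4 with h4 | h4
    · exact absurd h4 hP
    · linear_combination h4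
  have h6 : ρ * (ρ - 1) = 0 := by
    have : (ρ * (ρ - 1)) * constantCoeff e = 0 := by linear_combination h5
    exact (mul_eq_zero.mp this).resolve_right he
  rcases mul_eq_zero.mp h6 with h7 | h7
  · rw [hρ, div_eq_zero_iff] at h7
    simp [hk0, hn] at h7
  · rw [hρ, sub_eq_zero, div_eq_one_iff_eq hn', Nat.cast_inj] at h7
    exact hk (by rw [h7])

/-- The order in `t` of a formal solution at a singular point of the equation is that of `X` or
of `X ^ 2`, according to whether the term `c₀` is present. -/
theorem order_eq_of_singular (hr : r ≠ 0) (hn : n ≠ 0) {m : ℕ} (hm : m ≠ 0) {v u : ℂ⟦X⟧}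
    (hv : v = X ^ m * u) (hu : constantCoeff u ≠ 0)
    {p a b c e : ℂ⟦X⟧} {c₀ : ℂ}
    (hp : constantCoeff p ≠ 0) (he : constantCoeff e ≠ 0)
    (h : v * p * (euler n (euler n v) - euler n v)
      = (C (1 / 2) * p + v * a) * euler n v ^ 2 + C r * X ^ n * v * b * euler n v
        + (C r * X ^ n) ^ 2 * (C c₀ * e + v ^ 2 * c)) :
    m = n ∨ (c₀ = 0 ∧ m = 2 * n) := by
  have hX : ∀ i : ℕ, (X : ℂ⟦X⟧) ^ i ≠ 0 := fun i => pow_ne_zero i X_ne_zero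
  have hn' : (n : ℂ) ≠ 0 := Nat.cast_ne_zero.mpr hn
  set μ : ℂ := (m : ℂ) / n with hμ
  set u₁ := C μ * u + euler n u with hu₁
  set u₂ := C μ * u₁ + euler n u₁ with hu₂
  have hv₁ : euler n v = X ^ m * u₁ := by rw [hv, euler_X_pow_mul]
  have hv₂ : euler n (euler n v) = X ^ m * u₂ := by rw [hv₁, euler_X_pow_mul]
  rw [hv₁] at hv₂
  rw [hv₁, hv₂, hv] at h
  -- if the last term is of higher order, the exponent `m / n` is `0` or `2`
  have key : ∀ s : ℂ⟦X⟧, constantCoeff s = 0 →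
      u * p * (u₂ - u₁) = (C (1 / 2) * p + X ^ m * u * a) * u₁ ^ 2
        + C r * X ^ n * u * b * u₁ + s → m = 2 * n := by
    intro s hs h1
    have h2 := congrArg constantCoeff h1
    simp [hu₂, hu₁, hs, hn, hm] at h2
    have h3 : μ * (μ - 2) * (constantCoeff p * constantCoeff u ^ 2) = 0 := by
      linear_combination 2 * h2
    have h4 : μ * (μ - 2) = 0 :=
      (mul_eq_zero.mp h3).resolve_right (mul_ne_zero hp (pow_ne_zero 2 hu))
    have hμ0 : μ ≠ 0 := div_ne_zero (Nat.cast_ne_zero.mpr hm) hn'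
    have h5 : μ = 2 := sub_eq_zero.mp ((mul_eq_zero.mp h4).resolve_left hμ0)
    rw [hμ, div_eq_iff hn'] at h5
    exact_mod_cast h5
  by_cases hc : c₀ = 0
  · refine Or.inr ⟨hc, key (C r ^ 2 * (X ^ n) ^ 2 * u ^ 2 * c) (by simp [hn]) ?_⟩
    refine mul_left_cancel₀ (hX (2 * m)) ?_
    rw [hc, map_zero] at h
    linear_combination h
  · left
    rcases lt_trichotomy m n with hmn | hmn | hmn
    · obtain ⟨j, hj⟩ := Nat.exists_eq_add_of_lt hmn
      have := key (C r ^ 2 * ((X ^ (j + 1)) ^ 2 * C c₀ * e + (X ^ n) ^ 2 * u ^ 2 * c))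
        (by simp [hn]) (by
          refine mul_left_cancel₀ (hX (2 * m)) ?_
          have : (X : ℂ⟦X⟧) ^ n = X ^ m * X ^ (j + 1) := by rw [← pow_add, hj, add_assoc]
          linear_combination h + C r ^ 2 * C c₀ * e * (X ^ n + X ^ m * X ^ (j + 1)) * this)
      omega
    · exact hmn
    · obtain ⟨j, hj⟩ := Nat.exists_eq_add_of_lt hmn
      have h1 : X ^ (j + 1) * X ^ (j + 1) * (u * p * (u₂ - u₁)
          - (C (1 / 2) * p + X ^ m * u * a) * u₁ ^ 2 - C r * X ^ n * u * b * u₁)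
          = C r ^ 2 * (C c₀ * e + X ^ m * X ^ m * u ^ 2 * c) := by
        refine mul_left_cancel₀ (hX (2 * n)) ?_
        have : (X : ℂ⟦X⟧) ^ m = X ^ n * X ^ (j + 1) := by rw [← pow_add, hj, add_assoc]
        linear_combination h - (X ^ m + X ^ n * X ^ (j + 1)) * (u * p * (u₂ - u₁)
          - (C (1 / 2) * p + X ^ m * u * a) * u₁ ^ 2 - C r * X ^ n * u * b * u₁) * this
      have h2 := congrArg constantCoeff h1
      simp [hr, hc, hm, he] at h2

/-- A formal solution of the equation
`v P (v'' - v') = (P / 2 + v A) v' ^ 2 + X v B v' + X ^ 2 (c₀ E + v ^ 2 D)`, with `' = X d/dX`,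
which vanishes at the singular point has no ramification: by comparison of the leading terms of
the difference of the solutions `v(t)` and `v(ζ t)`, the order of this difference would be `0`,
`1` or `2` times that of `X`. -/
theorem rescale_eq_of_singular (hr : r ≠ 0) (hn : n ≠ 0) {ζ : ℂ} (hζ : IsPrimitiveRoot ζ n)
    {v : ℂ⟦X⟧} (hv0 : constantCoeff v = 0) {P A B D E : MvPolynomial (Fin 2) ℂ} {c₀ : ℂ}
    (hP : evalXY P x₀ 0 ≠ 0) (hE : evalXY E x₀ 0 ≠ 0)
    (h : v * evalAlong x₀ r n v P * (euler n (euler n v) - euler n v)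
      = (C (1 / 2) * evalAlong x₀ r n v P + v * evalAlong x₀ r n v A) * euler n v ^ 2
        + C r * X ^ n * v * evalAlong x₀ r n v B * euler n v
        + (C r * X ^ n) ^ 2 * (C c₀ * evalAlong x₀ r n v E + v ^ 2 * evalAlong x₀ r n v D)) :
    rescale ζ v = v := by
  by_contra hne
  obtain ⟨k, e, hv, he, hk⟩ := exists_rescale_eq_add hζ hne
  have hv' : v ≠ 0 := by
    rintro rfl
    exact hne (map_zero _)
  obtain ⟨m, u, hvu, hu⟩ := exists_eq_X_pow_mul hv'
  have hm : m ≠ 0 := by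
    rintro rfl
    rw [hvu] at hv0
    exact hu (by simpa using hv0)
  have hPv : constantCoeff (evalAlong x₀ r n v P) ≠ 0 := by
    rwa [constantCoeff_evalAlong _ _ _ hn, hv0]
  have hEv : constantCoeff (evalAlong x₀ r n v E) ≠ 0 := by
    rwa [constantCoeff_evalAlong _ _ _ hn, hv0]
  have hmn := order_eq_of_singular hr hn hm hvu hu hPv hEv h
  have hk0 : k ≠ 0 := by
    rintro rfl
    exact hk (dvd_zero n)
  have hn' : (n : ℂ) ≠ 0 := Nat.cast_ne_zero.mpr hn
  have h2 := congrArg (rescale ζ) h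
  have hCC : ∀ c : ℂ, rescale ζ (C c) = C c := fun c => by
    ext k
    rw [coeff_rescale, coeff_C]
    split_ifs with hk <;> simp [hk]
  simp only [map_mul, map_add, map_sub, map_pow, ← euler_rescale, hCC,
    rescale_evalAlong x₀ r n hζ.pow_eq_one] at h2
  have hX : rescale ζ (X : ℂ⟦X⟧) ^ n = X ^ n := by
    rw [rescale_X, mul_pow, ← map_pow, hζ.pow_eq_one, map_one, one_mul]
  rw [hX, hv] at h2
  obtain ⟨p, hp⟩ := exists_evalAlong_add x₀ r n v (X ^ k * e) P
  obtain ⟨a, ha⟩ := exists_evalAlong_add x₀ r n v (X ^ k * e) A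
  obtain ⟨b, hb⟩ := exists_evalAlong_add x₀ r n v (X ^ k * e) B
  obtain ⟨d, hd⟩ := exists_evalAlong_add x₀ r n v (X ^ k * e) D
  obtain ⟨f, hf⟩ := exists_evalAlong_add x₀ r n v (X ^ k * e) E
  rw [hp, ha, hb, hd, hf] at h2
  set μ : ℂ := (m : ℂ) / n with hμ
  set u₁ := C μ * u + euler n u with hu₁
  set u₂ := C μ * u₁ + euler n u₁ with hu₂
  set ρ : ℂ := (k : ℂ) / n with hρ
  set e₁ := C ρ * e + euler n e with he₁
  set e₂ := C ρ * e₁ + euler n e₁ with he₂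
  -- as `n` divides `m`, the second solution `v(ζ t)` has the same leading term as `v`
  have hnm : n ∣ m := by
    rcases hmn with h1 | ⟨-, h1⟩
    · exact h1 ▸ dvd_rfl
    · exact h1 ▸ Dvd.intro_left 2 rfl
  obtain ⟨U, hU, hU0⟩ : ∃ U, X ^ k * e = X ^ m * U - X ^ m * u ∧
      constantCoeff U = constantCoeff u := by
    refine ⟨rescale ζ u, ?_, by rw [← coeff_zero_eq_constantCoeff, coeff_rescale]; simp⟩
    have h1 : rescale ζ v = X ^ m * rescale ζ u := by
      rw [hvu, map_mul, map_pow, rescale_X, mul_pow, ← map_pow,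
        (hζ.pow_eq_one_iff_dvd m).mpr hnm, map_one, one_mul]
    rw [← h1, hv, ← hvu]
    ring
  set U₁ := C μ * U + euler n U with hU₁
  set U₂ := C μ * U₁ + euler n U₁ with hU₂
  have hX₁ : X ^ k * e₁ = X ^ m * U₁ - X ^ m * u₁ := by
    have := congrArg (euler n) hU
    rwa [map_sub, euler_X_pow_mul, euler_X_pow_mul, euler_X_pow_mul] at this
  have hX₂ : X ^ k * e₂ = X ^ m * U₂ - X ^ m * u₂ := by
    have := congrArg (euler n) hX₁
    rwa [map_sub, euler_X_pow_mul, euler_X_pow_mul, euler_X_pow_mul] at this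
  have hv₁ : euler n v = X ^ m * u₁ := by rw [hvu, euler_X_pow_mul]
  have hv₂ : euler n (X ^ m * u₁) = X ^ m * u₂ := by rw [euler_X_pow_mul]
  have hw₁ : euler n (v + X ^ k * e) = X ^ m * U₁ := by
    rw [map_add, euler_X_pow_mul, ← hρ, ← he₁, hX₁, hv₁]
    ring
  have hw₂ : euler n (X ^ m * U₁) = X ^ m * U₂ := by rw [euler_X_pow_mul]
  rw [hw₁, hw₂] at h2
  rw [hv₁, hv₂] at h
  -- the term with `c₀` is present only if `m = n`, and its increment then has higher order
  have hE0 : ∃ g, (C r * X ^ n) ^ 2 * C c₀ * f = X ^ m * g ∧ constantCoeff g = 0 := by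
    rcases hmn with h1 | ⟨h1, -⟩
    · exact ⟨C r ^ 2 * X ^ n * C c₀ * f, by rw [h1]; ring, by simp [hn]⟩
    · exact ⟨0, by simp [h1], map_zero _⟩
  obtain ⟨g, hg, hg0⟩ := hE0
  rw [hvu] at h hPv
  rw [hU, hvu] at h2
  generalize evalAlong x₀ r n (X ^ m * u) P = P' at *
  generalize evalAlong x₀ r n (X ^ m * u) A = A' at *
  generalize evalAlong x₀ r n (X ^ m * u) B = B' at *
  generalize evalAlong x₀ r n (X ^ m * u) D = D' at *
  generalize evalAlong x₀ r n (X ^ m * u) E = E' at *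
  have h3 : X ^ m * U * e * p * (U₂ - U₁) + P' * (U * (e₂ - e₁) + e * (u₂ - u₁))
      = C (1 / 2) * e * p * X ^ m * U₁ ^ 2 + C (1 / 2) * P' * (U₁ + u₁) * e₁
        + X ^ (2 * m) * U * e * a * U₁ ^ 2 + A' * X ^ m * (U * (U₁ + u₁) * e₁ + e * u₁ ^ 2)
        + C r * X ^ n * (X ^ m * U * e * b * U₁ + B' * (U * e₁ + e * u₁))
        + e * g + (C r * X ^ n) ^ 2 * (X ^ m * U ^ 2 * e * d + D' * (U + u) * e) := by
    refine mul_left_cancel₀ (pow_ne_zero (m + k) (X_ne_zero (R := ℂ))) ?_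
    linear_combination h2 - h
      + X ^ m * (X ^ m * U * p * (U₂ - U₁) + P' * (u₂ - u₁)
        - (C (1 / 2) * p * X ^ m * U₁ ^ 2 + X ^ (2 * m) * U * a * U₁ ^ 2 + A' * X ^ m * u₁ ^ 2)
        - C r * X ^ n * (X ^ m * U * b * U₁ + B' * u₁) - g
        - (C r * X ^ n) ^ 2 * (X ^ m * U ^ 2 * d + D' * (U + u))) * hU
      + X ^ m * (-P' * U - C (1 / 2) * P' * (U₁ + u₁) - A' * X ^ m * U * (U₁ + u₁)
        - C r * X ^ n * B' * U) * hX₁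
      + X ^ m * P' * U * hX₂ + (X ^ m * U - X ^ m * u) * hg
  have h4 := congrArg constantCoeff h3
  simp [hU₂, hU₁, hu₂, hu₁, he₂, he₁, hU0, hg0, hn, hm] at h4
  have h5 : (ρ ^ 2 - ρ + μ ^ 2 - μ - μ * ρ) *
      (constantCoeff P' * constantCoeff u * constantCoeff e) = 0 := by
    linear_combination h4
  have h6 := (mul_eq_zero.mp h5).resolve_right (mul_ne_zero (mul_ne_zero hPv hu) he)
  have hρ1 : ∀ j : ℕ, ρ ≠ j := by
    intro j hj
    rw [hρ, div_eq_iff hn'] at hj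
    exact hk (Dvd.intro_left j (by exact_mod_cast hj.symm))
  rcases hmn with h1 | ⟨-, h1⟩
  · have hμ1 : μ = 1 := by rw [hμ, h1, div_self hn']
    have h7 : ρ * (ρ - 2) = 0 := by rw [hμ1] at h6; linear_combination h6
    rcases mul_eq_zero.mp h7 with h8 | h8
    · exact hρ1 0 (by simpa using h8)
    · exact hρ1 2 (by simpa using sub_eq_zero.mp h8)
  · have hμ2 : μ = 2 := by rw [hμ, h1]; push_cast; field_simp
    have h7 : (ρ - 1) * (ρ - 2) = 0 := by rw [hμ2] at h6; linear_combination h6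
    rcases mul_eq_zero.mp h7 with h8 | h8
    · exact hρ1 1 (by simpa using sub_eq_zero.mp h8)
    · exact hρ1 2 (by simpa using sub_eq_zero.mp h8)

end PowerSeries

/-! ### Taylor series -/

/-- The Taylor series of a function at the origin. -/
noncomputable def taylorSeries (f : ℂ → ℂ) : PowerSeries ℂ :=
  PowerSeries.mk fun k => iteratedDeriv k f 0 / k.factorial

@[simp] theorem constantCoeff_taylorSeries (f : ℂ → ℂ) :
    PowerSeries.constantCoeff (taylorSeries f) = f 0 := by
  simp [taylorSeries, ← PowerSeries.coeff_zero_eq_constantCoeff_apply]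

theorem taylorSeries_congr {f g : ℂ → ℂ} (h : f =ᶠ[𝓝 0] g) :
    taylorSeries f = taylorSeries g := by
  ext k
  simp only [taylorSeries, PowerSeries.coeff_mk, h.iteratedDeriv_eq k]

theorem eventuallyEq_of_taylorSeries_eq {f g : ℂ → ℂ} (hf : AnalyticAt ℂ f 0)
    (hg : AnalyticAt ℂ g 0) (h : taylorSeries f = taylorSeries g) : f =ᶠ[𝓝 0] g := by
  have hf' := hf.hasFPowerSeriesAt
  have hg' := hg.hasFPowerSeriesAt
  have he : (fun k => iteratedDeriv k f 0 / (k.factorial : ℂ)) =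
      fun k => iteratedDeriv k g 0 / (k.factorial : ℂ) := by
    funext k
    simpa [taylorSeries] using congrArg (PowerSeries.coeff k) h
  rw [← he] at hg'
  filter_upwards [hf'.eventually_hasSum, hg'.eventually_hasSum] with t h1 h2
  simpa using h1.unique h2

theorem taylorSeries_const (c : ℂ) : taylorSeries (fun _ => c) = PowerSeries.C c := by
  ext k
  rcases k with _ | k <;>
    simp [taylorSeries, PowerSeries.coeff_C, iteratedDeriv_const]

theorem taylorSeries_id : taylorSeries (fun t => t) = PowerSeries.X := by
  ext k
  rcases k with _ | _ | k <;>
    simp [taylorSeries, PowerSeries.coeff_X, iteratedDeriv_succ', iteratedDeriv_const]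

theorem taylorSeries_add {f g : ℂ → ℂ} (hf : AnalyticAt ℂ f 0) (hg : AnalyticAt ℂ g 0) :
    taylorSeries (fun t => f t + g t) = taylorSeries f + taylorSeries g := by
  ext k
  simp only [taylorSeries, PowerSeries.coeff_mk, map_add]
  rw [iteratedDeriv_fun_add hf.contDiffAt hg.contDiffAt, add_div]

theorem taylorSeries_sub {f g : ℂ → ℂ} (hf : AnalyticAt ℂ f 0) (hg : AnalyticAt ℂ g 0) :
    taylorSeries (fun t => f t - g t) = taylorSeries f - taylorSeries g := by
  ext k
  simp only [taylorSeries, PowerSeries.coeff_mk, map_sub]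
  rw [iteratedDeriv_fun_sub hf.contDiffAt hg.contDiffAt, sub_div]

theorem taylorSeries_mul {f g : ℂ → ℂ} (hf : AnalyticAt ℂ f 0) (hg : AnalyticAt ℂ g 0) :
    taylorSeries (fun t => f t * g t) = taylorSeries f * taylorSeries g := by
  ext k
  simp only [taylorSeries, PowerSeries.coeff_mk, PowerSeries.coeff_mul]
  rw [iteratedDeriv_fun_mul hf.contDiffAt hg.contDiffAt,
    Finset.Nat.sum_antidiagonal_eq_sum_range_succ
      (fun i j => iteratedDeriv i f 0 / (i.factorial : ℂ) *
        (iteratedDeriv j g 0 / (j.factorial : ℂ))), Finset.sum_div]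
  refine Finset.sum_congr rfl fun i hi => ?_
  rw [Nat.cast_choose ℂ (Nat.le_of_lt_succ (Finset.mem_range.mp hi))]
  have := Nat.cast_ne_zero (R := ℂ).mpr k.factorial_ne_zero
  field_simp

theorem taylorSeries_pow {f : ℂ → ℂ} (hf : AnalyticAt ℂ f 0) (m : ℕ) :
    taylorSeries (fun t => f t ^ m) = taylorSeries f ^ m := by
  induction m with
  | zero => simpa using taylorSeries_const 1
  | succ m ih => simp only [pow_succ, taylorSeries_mul (hf.fun_pow m) hf, ih]

theorem taylorSeries_deriv (f : ℂ → ℂ) :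
    taylorSeries (deriv f) = PowerSeries.derivative ℂ (taylorSeries f) := by
  ext k
  rw [PowerSeries.coeff_derivative]
  simp only [taylorSeries, PowerSeries.coeff_mk, ← iteratedDeriv_succ', Nat.factorial_succ]
  push_cast
  have := Nat.cast_ne_zero (R := ℂ).mpr k.factorial_ne_zero
  have : (k : ℂ) + 1 ≠ 0 := Nat.cast_add_one_ne_zero k
  field_simp

theorem taylorSeries_comp_mul (ζ : ℂ) (f : ℂ → ℂ) :
    taylorSeries (fun t => f (ζ * t)) = PowerSeries.rescale ζ (taylorSeries f) := by
  have h : ∀ k, iteratedDeriv k (fun t => f (ζ * t)) =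
      fun t => ζ ^ k * iteratedDeriv k f (ζ * t) := by
    intro k
    induction k with
    | zero => simp
    | succ k ih =>
      funext t
      rw [iteratedDeriv_succ, ih, deriv_const_mul_field,
        deriv_comp_mul_left ζ (iteratedDeriv k f) t,
        iteratedDeriv_succ, smul_eq_mul]
      ring
  ext k
  rw [PowerSeries.coeff_rescale]
  simp only [taylorSeries, PowerSeries.coeff_mk, h, mul_zero]
  ring

theorem taylorSeries_monomial_add (x₀ r : ℂ) (n : ℕ) :
    taylorSeries (fun t => x₀ + r * t ^ n) =
      PowerSeries.C x₀ + PowerSeries.C r * PowerSeries.X ^ n := by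
  rw [taylorSeries_add (by fun_prop) (by fun_prop),
    taylorSeries_mul (by fun_prop) (by fun_prop), taylorSeries_pow (by fun_prop),
    taylorSeries_const, taylorSeries_const, taylorSeries_id]

theorem taylorSeries_evalXY {ξ υ : ℂ → ℂ} {x₀ r : ℂ} {n : ℕ}
    (hξ : ξ = fun t => x₀ + r * t ^ n) (hυ : AnalyticAt ℂ υ 0)
    (G : MvPolynomial (Fin 2) ℂ) :
    taylorSeries (fun t => evalXY G (ξ t) (υ t)) =
      PowerSeries.evalAlong x₀ r n (taylorSeries υ) G := by
  have hξ' : AnalyticAt ℂ ξ 0 := by rw [hξ]; fun_prop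
  induction G using MvPolynomial.induction_on with
  | C a => simpa [evalXY, PowerSeries.evalAlong] using taylorSeries_const a
  | add p q hp hq =>
    simp only [evalXY_add]
    rw [taylorSeries_add (analyticAt_evalXY p hξ' hυ) (analyticAt_evalXY q hξ' hυ), hp, hq, map_add]
  | mul_X p i hp =>
    simp only [evalXY_mul]
    rw [taylorSeries_mul (analyticAt_evalXY p hξ' hυ) (analyticAt_evalXY _ hξ' hυ), hp, map_mul]
    congr 1
    fin_cases i
    · have h1 := taylorSeries_monomial_add x₀ r n
      rw [← hξ] at h1
      simpa [evalXY, PowerSeries.evalAlong] using h1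
    · simp [evalXY, PowerSeries.evalAlong]

namespace PowerSeries

/-- The expression `X ^ 2 d²v/dX²` for `X = r t ^ n` through derivatives in `t`; in a parametrized
equation `d²y/dx²` appears as `(y'' x' - y' x'') / x' ^ 3`. -/
theorem euler_wronskian (r : ℂ) {n : ℕ} (hn : n ≠ 0) (v x : ℂ⟦X⟧)
    (hx : euler n x = C r * X ^ n) :
    C r * X ^ n * (euler n (euler n v) - euler n v) =
      (C (n : ℂ)⁻¹ * X) ^ 3 * (derivative ℂ (derivative ℂ v) * derivative ℂ x
        - derivative ℂ v * derivative ℂ (derivative ℂ x)) := by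
  have h1 : ∀ a : ℂ⟦X⟧, euler n (euler n a) = (C (n : ℂ)⁻¹ * X) *
      (C (n : ℂ)⁻¹ * derivative ℂ a + C (n : ℂ)⁻¹ * X * derivative ℂ (derivative ℂ a)) := by
    intro a
    simp only [euler_apply, Derivation.leibniz, derivative_C, derivative_X, smul_eq_mul]
    ring
  have h2 : euler n (C r * X ^ n) = C r * X ^ n := by
    have h3 := euler_X_pow_mul n n (C r)
    rw [div_self (Nat.cast_ne_zero.mpr hn), euler_C, map_one] at h3
    rw [mul_comm, h3]
    ring
  have h3 := h1 x
  rw [hx, h2] at h3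
  have h4 := hx
  rw [euler_apply] at h4
  rw [h1, euler_apply n v]
  linear_combination (-(C (n : ℂ)⁻¹ * X * derivative ℂ v)) * h3
    - (C (n : ℂ)⁻¹ * X) ^ 2 * derivative ℂ (derivative ℂ v) * h4
    - C (n : ℂ)⁻¹ ^ 2 * X * derivative ℂ v * h4

end PowerSeries

/-! ### Convergent solutions of second order equations -/

theorem euler_taylorSeries_monomial_add (x₀ r : ℂ) {n : ℕ} (hn : n ≠ 0) :
    PowerSeries.euler n (taylorSeries (fun t => x₀ + r * t ^ n)) =
      PowerSeries.C r * PowerSeries.X ^ n := by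
  have h3 := PowerSeries.euler_X_pow_mul n n (PowerSeries.C r)
  rw [div_self (Nat.cast_ne_zero.mpr hn), PowerSeries.euler_C, map_one] at h3
  rw [taylorSeries_monomial_add, map_add, PowerSeries.euler_C, mul_comm, h3]
  ring

/-- Solutions of the equation `P v'' = Q v' ^ 2 + R v' + S` with polynomial coefficients in `x`, `v`
are not ramified at points with `P ≠ 0`. A solution ramified over `x₀` is given by
`x = ξ(t) = x₀ + r t ^ n`, `v = v(t)`. -/
theorem eventually_comp_mul_eq_of_regular {x₀ r ζ : ℂ} {n : ℕ} (hr : r ≠ 0) (hn : n ≠ 0)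
    (hζ : IsPrimitiveRoot ζ n) {ξ v : ℂ → ℂ} (hξ : ξ = fun t => x₀ + r * t ^ n)
    (hv : AnalyticAt ℂ v 0) {P Q R S : MvPolynomial (Fin 2) ℂ} (hP : evalXY P x₀ (v 0) ≠ 0)
    (h : ∀ᶠ t in 𝓝[≠] 0, evalXY P (ξ t) (v t) *
        (deriv (deriv v) t * deriv ξ t - deriv v t * deriv (deriv ξ) t)
      = evalXY Q (ξ t) (v t) * deriv v t ^ 2 * deriv ξ t
        + evalXY R (ξ t) (v t) * deriv v t * deriv ξ t ^ 2
        + evalXY S (ξ t) (v t) * deriv ξ t ^ 3) :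
    ∀ᶠ t in 𝓝[≠] 0, v (ζ * t) = v t := by
  have hξ' : AnalyticAt ℂ ξ 0 := by rw [hξ]; fun_prop
  have hG : ∀ G : MvPolynomial (Fin 2) ℂ, AnalyticAt ℂ (fun t => evalXY G (ξ t) (v t)) 0 :=
    fun G => analyticAt_evalXY G hξ' hv
  have hP' := hG P
  have hQ' := hG Q
  have hR' := hG R
  have hS' := hG S
  have hv₁ := hv.deriv
  have hv₂ := hv₁.deriv
  have hξ₁ := hξ'.deriv
  have hξ₂ := hξ₁.deriv
  have h1 : ∀ᶠ t in 𝓝 0, evalXY P (ξ t) (v t) *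
        (deriv (deriv v) t * deriv ξ t - deriv v t * deriv (deriv ξ) t)
      = evalXY Q (ξ t) (v t) * deriv v t ^ 2 * deriv ξ t
        + evalXY R (ξ t) (v t) * deriv v t * deriv ξ t ^ 2
        + evalXY S (ξ t) (v t) * deriv ξ t ^ 3 :=
    (AnalyticAt.frequently_eq_iff_eventually_eq (by fun_prop) (by fun_prop)).mp h.frequently
  have h2 := taylorSeries_congr h1
  simp (disch := fun_prop) only [taylorSeries_add, taylorSeries_sub, taylorSeries_mul,
    taylorSeries_pow, taylorSeries_deriv, taylorSeries_evalXY hξ hv] at h2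
  have hx := euler_taylorSeries_monomial_add x₀ r hn
  rw [← hξ] at hx
  have h3 := PowerSeries.euler_wronskian r hn (taylorSeries v) _ hx
  have hX : PowerSeries.C r * PowerSeries.X ^ n ≠ 0 :=
    mul_ne_zero (by simpa using hr) (pow_ne_zero _ PowerSeries.X_ne_zero)
  have hx' := hx
  rw [PowerSeries.euler_apply] at hx'
  have h4 := PowerSeries.rescale_eq_of_regular (x₀ := x₀) (r := r) hn hζ
    (v := taylorSeries v) (P := P) (Q := Q) (R := R) (S := S) (by simpa using hP) (by
      refine mul_left_cancel₀ hX ?_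
      rw [PowerSeries.euler_apply n (taylorSeries v)] at h3 ⊢
      rw [← hx'] at h3 ⊢
      linear_combination PowerSeries.evalAlong x₀ r n (taylorSeries v) P * h3 +
        (PowerSeries.C (n : ℂ)⁻¹ * PowerSeries.X) ^ 3 * h2)
  refine (eventuallyEq_of_taylorSeries_eq ?_ hv ?_).filter_mono nhdsWithin_le_nhds
  · exact AnalyticAt.fun_comp (by simpa using hv) (by fun_prop)
  · rw [taylorSeries_comp_mul, h4]

/-- Solutions of the equation `v P v'' = (P / 2 + v A) v' ^ 2 + v B v' + c₀ E + v ^ 2 D` with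
polynomial coefficients are not ramified at points where they vanish. -/
theorem eventually_comp_mul_eq_of_singular {x₀ r ζ : ℂ} {n : ℕ} (hr : r ≠ 0) (hn : n ≠ 0)
    (hζ : IsPrimitiveRoot ζ n) {ξ v : ℂ → ℂ} (hξ : ξ = fun t => x₀ + r * t ^ n)
    (hv : AnalyticAt ℂ v 0) (hv0 : v 0 = 0) {P A B D E : MvPolynomial (Fin 2) ℂ} {c₀ : ℂ}
    (hP : evalXY P x₀ 0 ≠ 0) (hE : evalXY E x₀ 0 ≠ 0)
    (h : ∀ᶠ t in 𝓝[≠] 0, v t * evalXY P (ξ t) (v t) *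
        (deriv (deriv v) t * deriv ξ t - deriv v t * deriv (deriv ξ) t)
      = (1 / 2 * evalXY P (ξ t) (v t) + v t * evalXY A (ξ t) (v t)) * deriv v t ^ 2 * deriv ξ t
        + v t * evalXY B (ξ t) (v t) * deriv v t * deriv ξ t ^ 2
        + (c₀ * evalXY E (ξ t) (v t) + v t ^ 2 * evalXY D (ξ t) (v t)) * deriv ξ t ^ 3) :
    ∀ᶠ t in 𝓝[≠] 0, v (ζ * t) = v t := by
  have hξ' : AnalyticAt ℂ ξ 0 := by rw [hξ]; fun_prop
  have hG : ∀ G : MvPolynomial (Fin 2) ℂ, AnalyticAt ℂ (fun t => evalXY G (ξ t) (v t)) 0 :=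
    fun G => analyticAt_evalXY G hξ' hv
  have hP' := hG P
  have hA' := hG A
  have hB' := hG B
  have hD' := hG D
  have hE' := hG E
  have hv₁ := hv.deriv
  have hv₂ := hv₁.deriv
  have hξ₁ := hξ'.deriv
  have hξ₂ := hξ₁.deriv
  have h1 : ∀ᶠ t in 𝓝 0, v t * evalXY P (ξ t) (v t) *
        (deriv (deriv v) t * deriv ξ t - deriv v t * deriv (deriv ξ) t)
      = (1 / 2 * evalXY P (ξ t) (v t) + v t * evalXY A (ξ t) (v t)) * deriv v t ^ 2 * deriv ξ t
        + v t * evalXY B (ξ t) (v t) * deriv v t * deriv ξ t ^ 2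
        + (c₀ * evalXY E (ξ t) (v t) + v t ^ 2 * evalXY D (ξ t) (v t)) * deriv ξ t ^ 3 :=
    (AnalyticAt.frequently_eq_iff_eventually_eq (by fun_prop) (by fun_prop)).mp h.frequently
  have h2 := taylorSeries_congr h1
  simp (disch := fun_prop) only [taylorSeries_add, taylorSeries_sub, taylorSeries_mul,
    taylorSeries_pow, taylorSeries_deriv, taylorSeries_const, taylorSeries_evalXY hξ hv] at h2
  have hx := euler_taylorSeries_monomial_add x₀ r hn
  rw [← hξ] at hx
  have h3 := PowerSeries.euler_wronskian r hn (taylorSeries v) _ hx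
  have hX : PowerSeries.C r * PowerSeries.X ^ n ≠ 0 :=
    mul_ne_zero (by simpa using hr) (pow_ne_zero _ PowerSeries.X_ne_zero)
  have hx' := hx
  rw [PowerSeries.euler_apply] at hx'
  have h4 := PowerSeries.rescale_eq_of_singular (x₀ := x₀) (r := r) hr hn hζ
    (v := taylorSeries v) (P := P) (A := A) (B := B) (D := D) (E := E) (c₀ := c₀)
    (by simpa using hv0) hP hE (by
      refine mul_left_cancel₀ hX ?_
      rw [PowerSeries.euler_apply n (taylorSeries v)] at h3 ⊢
      rw [← hx'] at h3 ⊢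
      linear_combination taylorSeries v * PowerSeries.evalAlong x₀ r n (taylorSeries v) P * h3 +
        (PowerSeries.C (n : ℂ)⁻¹ * PowerSeries.X) ^ 3 * h2)
  refine (eventuallyEq_of_taylorSeries_eq ?_ hv ?_).filter_mono nhdsWithin_le_nhds
  · exact AnalyticAt.fun_comp (by simpa using hv) (by fun_prop)
  · rw [taylorSeries_comp_mul, h4]

/-! ### The sixth Painlevé equation on an algebraic curve -/

section

open MvPolynomial (X C)

/-- The coefficient of `y''` in the sixth Painlevé equation, cleared of denominators:
`p y'' = q y' ^ 2 + r y' + s`. -/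
noncomputable def painleveP : MvPolynomial (Fin 2) ℂ :=
  2 * X 0 ^ 2 * (X 0 - 1) ^ 2 * (X 1 * (X 1 - 1) * (X 1 - X 0))

/-- The coefficient of `y' ^ 2`. -/
noncomputable def painleveQ : MvPolynomial (Fin 2) ℂ :=
  X 0 ^ 2 * (X 0 - 1) ^ 2 *
    ((X 1 - 1) * (X 1 - X 0) + X 1 * (X 1 - X 0) + X 1 * (X 1 - 1))

/-- The coefficient of `y'`. -/
noncomputable def painleveR : MvPolynomial (Fin 2) ℂ :=
  -(2 * X 0 * (X 0 - 1)) * ((2 * X 0 - 1) * (X 1 * (X 1 - 1) * (X 1 - X 0))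
    + X 0 * (X 0 - 1) * (X 1 * (X 1 - 1)))

/-- The term free of derivatives. -/
noncomputable def painleveS (α β γ δ : ℂ) : MvPolynomial (Fin 2) ℂ :=
  2 * (C α * (X 1 * (X 1 - 1) * (X 1 - X 0)) ^ 2 - C β * X 0 * ((X 1 - 1) * (X 1 - X 0)) ^ 2
    + C γ * (X 0 - 1) * (X 1 * (X 1 - X 0)) ^ 2
    - C (δ - 1 / 2) * X 0 * (X 0 - 1) * (X 1 * (X 1 - 1)) ^ 2)

theorem evalXY_painleveP (x y : ℂ) : evalXY painleveP x y =
    2 * x ^ 2 * (x - 1) ^ 2 * (y * (y - 1) * (y - x)) := by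
  simp [evalXY, painleveP]

theorem evalXY_painleveQ (x y : ℂ) : evalXY painleveQ x y =
    x ^ 2 * (x - 1) ^ 2 * ((y - 1) * (y - x) + y * (y - x) + y * (y - 1)) := by
  simp [evalXY, painleveQ]

theorem evalXY_painleveR (x y : ℂ) : evalXY painleveR x y =
    -(2 * x * (x - 1)) * ((2 * x - 1) * (y * (y - 1) * (y - x)) + x * (x - 1) * (y * (y - 1))) := by
  simp [evalXY, painleveR]

theorem evalXY_painleveS (α β γ δ x y : ℂ) : evalXY (painleveS α β γ δ) x y =
    2 * (α * (y * (y - 1) * (y - x)) ^ 2 - β * x * ((y - 1) * (y - x)) ^ 2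
      + γ * (x - 1) * (y * (y - x)) ^ 2 - (δ - 1 / 2) * x * (x - 1) * (y * (y - 1)) ^ 2) := by
  simp [evalXY, painleveS]

/-- The sixth Painlevé equation, cleared of denominators, for a parametrized curve
`x = ξ(t)`, `y = υ(t)`, at the parameter `t`. -/
def PainleveVIAlong (α β γ δ : ℂ) (ξ υ : ℂ → ℂ) (t : ℂ) : Prop :=
  evalXY painleveP (ξ t) (υ t) *
      (deriv (deriv υ) t * deriv ξ t - deriv υ t * deriv (deriv ξ) t)
    = evalXY painleveQ (ξ t) (υ t) * deriv υ t ^ 2 * deriv ξ t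
      + evalXY painleveR (ξ t) (υ t) * deriv υ t * deriv ξ t ^ 2
      + evalXY (painleveS α β γ δ) (ξ t) (υ t) * deriv ξ t ^ 3

/-- The polynomial which vanishes at a point of the curve `F = 0` with `F_y ≠ 0` if the curve
satisfies the sixth Painlevé equation there; the derivatives of `y` are expressed through the
partial derivatives of `F`. -/
noncomputable def painleveObstruction (α β γ δ : ℂ) (F : MvPolynomial (Fin 2) ℂ) :
    MvPolynomial (Fin 2) ℂ :=
  -painleveP * (MvPolynomial.pderiv 0 (MvPolynomial.pderiv 0 F) * MvPolynomial.pderiv 1 F ^ 2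
      - 2 * MvPolynomial.pderiv 0 (MvPolynomial.pderiv 1 F) * MvPolynomial.pderiv 0 F
        * MvPolynomial.pderiv 1 F
      + MvPolynomial.pderiv 1 (MvPolynomial.pderiv 1 F) * MvPolynomial.pderiv 0 F ^ 2)
    - painleveQ * MvPolynomial.pderiv 0 F ^ 2 * MvPolynomial.pderiv 1 F
    + painleveR * MvPolynomial.pderiv 0 F * MvPolynomial.pderiv 1 F ^ 2
    - painleveS α β γ δ * MvPolynomial.pderiv 1 F ^ 3

end

/-- Two applications of the chain rule to `F(ξ, υ) = 0`. -/
theorem painleveObstruction_mul_eq (α β γ δ : ℂ) (F : MvPolynomial (Fin 2) ℂ)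
    {ξ υ : ℂ → ℂ} {t : ℂ}
    (hξ : AnalyticAt ℂ ξ t) (hυ : AnalyticAt ℂ υ t)
    (hF : ∀ᶠ s in 𝓝 t, evalXY F (ξ s) (υ s) = 0) :
    evalXY (painleveObstruction α β γ δ F) (ξ t) (υ t) * deriv ξ t ^ 3 =
      partialY F (ξ t) (υ t) ^ 3 * (evalXY painleveP (ξ t) (υ t) *
          (deriv (deriv υ) t * deriv ξ t - deriv υ t * deriv (deriv ξ) t)
        - (evalXY painleveQ (ξ t) (υ t) * deriv υ t ^ 2 * deriv ξ t
          + evalXY painleveR (ξ t) (υ t) * deriv υ t * deriv ξ t ^ 2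
          + evalXY (painleveS α β γ δ) (ξ t) (υ t) * deriv ξ t ^ 3)) := by
  have hd : ∀ {f : ℂ → ℂ}, AnalyticAt ℂ f t → ∀ᶠ s in 𝓝 t, HasDerivAt f (deriv f s) s :=
    fun hf => hf.eventually_analyticAt.mono fun s hs => hs.differentiableAt.hasDerivAt
  have hzero : ∀ {f g : ℂ → ℂ}, (∀ᶠ s in 𝓝 t, f s = 0) → (∀ᶠ s in 𝓝 t, HasDerivAt f (g s) s) →
      ∀ᶠ s in 𝓝 t, g s = 0 := by
    intro f g hf hfg
    filter_upwards [hf.eventually_nhds, hfg] with s hs hs'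
    have : f =ᶠ[𝓝 s] fun _ => 0 := hs
    rw [← hs'.deriv, this.deriv_eq, deriv_const]
  have x1 := hd hξ
  have x2 := hd hξ.deriv
  have y1 := hd hυ
  have y2 := hd hυ.deriv
  have e1 := hzero hF (x1.and y1 |>.mono fun s hs => hasDerivAt_evalXY F hs.1 hs.2)
  have e2 := hzero e1 (by
    filter_upwards [x1, x2, y1, y2] with s x1 x2 y1 y2
    exact ((hasDerivAt_evalXY (MvPolynomial.pderiv 0 F) x1 y1).mul x2).add
      ((hasDerivAt_evalXY (MvPolynomial.pderiv 1 F) x1 y1).mul y2))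
  replace e1 := e1.self_of_nhds
  replace e2 := e2.self_of_nhds
  have h2 : ∀ x y, evalXY (2 : MvPolynomial (Fin 2) ℂ) x y = 2 := fun x y => map_ofNat _ 2
  have hsub : ∀ G H : MvPolynomial (Fin 2) ℂ, ∀ x y,
      evalXY (G - H) x y = evalXY G x y - evalXY H x y := fun G H x y => map_sub _ _ _
  have hneg : ∀ G : MvPolynomial (Fin 2) ℂ, ∀ x y,
      evalXY (-G) x y = -evalXY G x y := fun G x y => map_neg _ _
  have hpow : ∀ G : MvPolynomial (Fin 2) ℂ, ∀ (k : ℕ) (x y),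
      evalXY (G ^ k) x y = evalXY G x y ^ k := fun G k x y => map_pow _ _ _
  simp only [painleveObstruction, partialX, partialY, pderiv_comm, hsub, hneg, hpow, h2,
    evalXY_add, evalXY_mul] at e1 e2 ⊢
  generalize evalXY (MvPolynomial.pderiv 0 (MvPolynomial.pderiv 0 F)) (ξ t) (υ t) = Fxx at *
  generalize evalXY (MvPolynomial.pderiv 0 (MvPolynomial.pderiv 1 F)) (ξ t) (υ t) = Fxy at *
  generalize evalXY (MvPolynomial.pderiv 1 (MvPolynomial.pderiv 1 F)) (ξ t) (υ t) = Fyy at *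
  generalize evalXY (MvPolynomial.pderiv 0 F) (ξ t) (υ t) = Fx at *
  generalize evalXY (MvPolynomial.pderiv 1 F) (ξ t) (υ t) = Fy at *
  generalize evalXY painleveP (ξ t) (υ t) = p at *
  generalize evalXY painleveQ (ξ t) (υ t) = q at *
  generalize evalXY painleveR (ξ t) (υ t) = r at *
  generalize evalXY (painleveS α β γ δ) (ξ t) (υ t) = s at *
  generalize deriv (deriv ξ) t = x2 at *
  generalize deriv ξ t = x1 at *
  generalize deriv (deriv υ) t = y2 at *
  generalize deriv υ t = y1 at *
  have hx : Fx * x1 = -(Fy * y1) := by linear_combination e1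
  linear_combination (2 * p * Fxy * Fy * x1 ^ 2 - p * Fyy * x1 * (Fx * x1 - Fy * y1)
    - q * Fy * x1 * (Fx * x1 - Fy * y1) + r * Fy ^ 2 * x1 ^ 2 + p * Fy ^ 2 * x2) * hx
    - p * x1 * Fy ^ 2 * e2

/-- An algebraic curve satisfies the sixth Painlevé equation at all of its points with `F_y ≠ 0`, if
it contains the graph of one solution. -/
theorem painleveVIAlong_of_solution {α β γ δ : ℂ} {F : MvPolynomial (Fin 2) ℂ} (hF : Irreducible F)
    {U : Set ℂ} (hU : IsOpen U) (hUne : U.Nonempty) {y₀ : ℂ → ℂ}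
    (hP : IsPainleveVISolutionOn α β γ δ y₀ U) (hFy : ∀ x ∈ U, evalXY F x (y₀ x) = 0)
    {ξ υ : ℂ → ℂ} {t : ℂ} (hξ : AnalyticAt ℂ ξ t) (hυ : AnalyticAt ℂ υ t)
    (h : ∀ᶠ s in 𝓝 t, evalXY F (ξ s) (υ s) = 0) (hY : partialY F (ξ t) (υ t) ≠ 0) :
    PainleveVIAlong α β γ δ ξ υ t := by
  have hdvd : F ∣ painleveObstruction α β γ δ F := by
    obtain ⟨x₀, hx₀⟩ := hUne
    refine dvd_of_infinite hF (infinite_of_mem_nhds x₀ (hU.mem_nhds hx₀)) fun x hx =>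
      ⟨y₀ x, hFy x hx, ?_⟩
    have h1 := painleveObstruction_mul_eq α β γ δ F (analyticAt_id (z := x)) (hP.analytic x hx) (by
      filter_upwards [hU.mem_nhds hx] with s hs using hFy s hs)
    have h2 := hP.equation x hx
    have hx0 := hP.indep_ne_zero x hx
    have hx1 := sub_ne_zero.mpr (hP.indep_ne_one x hx)
    have hy0 := hP.ne_zero x hx
    have hy1 := sub_ne_zero.mpr (hP.ne_one x hx)
    have hyx := sub_ne_zero.mpr (hP.ne_self x hx)
    rw [iteratedDeriv_succ, iteratedDeriv_one] at h2
    have hid : deriv (id : ℂ → ℂ) = fun _ => 1 := by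
      funext s
      exact deriv_id s
    simp only [id, hid, deriv_const, one_pow, mul_one, mul_zero, sub_zero, evalXY_painleveP,
      evalXY_painleveQ, evalXY_painleveR, evalXY_painleveS, h2] at h1
    rw [h1]
    field_simp
    ring
  have h1 := painleveObstruction_mul_eq α β γ δ F hξ hυ h
  rw [evalXY_eq_zero_of_dvd hdvd h.self_of_nhds, zero_mul] at h1
  exact sub_eq_zero.mp ((mul_eq_zero.mp h1.symm).resolve_left (pow_ne_zero 3 hY))

/-! ### Algebraic solutions are unramified over `x₀ ≠ 0, 1` -/

section

open MvPolynomial (X C)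

variable {α β γ δ x₀ r ζ : ℂ} {n : ℕ} {ξ υ : ℂ → ℂ}

/-- The equation is singular at `y = 0`; the constant `c₀` of
`eventually_comp_mul_eq_of_singular` is `-β`. -/
theorem eventually_comp_mul_eq_of_value_zero (h0 : x₀ ≠ 0) (h1 : x₀ ≠ 1) (hr : r ≠ 0)
    (hn : n ≠ 0) (hζ : IsPrimitiveRoot ζ n) (hξ : ξ = fun t => x₀ + r * t ^ n)
    (hυ : AnalyticAt ℂ υ 0) (hυ0 : υ 0 = 0)
    (h : ∀ᶠ t in 𝓝[≠] 0, PainleveVIAlong α β γ δ ξ υ t) :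
    ∀ᶠ t in 𝓝[≠] 0, υ (ζ * t) = υ t := by
  have h1' := sub_ne_zero.mpr h1
  refine eventually_comp_mul_eq_of_singular (c₀ := -β)
    (P := 2 * X 0 ^ 2 * (X 0 - 1) ^ 2 * (X 1 - 1) * (X 1 - X 0))
    (A := X 0 ^ 2 * (X 0 - 1) ^ 2 * ((X 1 - X 0) + (X 1 - 1)))
    (B := -(2 * X 0 * (X 0 - 1)) *
      ((2 * X 0 - 1) * (X 1 - 1) * (X 1 - X 0) + X 0 * (X 0 - 1) * (X 1 - 1)))
    (D := 2 * (C α * (X 1 - 1) ^ 2 * (X 1 - X 0) ^ 2 + C γ * (X 0 - 1) * (X 1 - X 0) ^ 2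
      - C (δ - 1 / 2) * X 0 * (X 0 - 1) * (X 1 - 1) ^ 2))
    (E := 2 * X 0 * ((X 1 - 1) * (X 1 - X 0)) ^ 2)
    hr hn hζ hξ hυ hυ0 (by simp [evalXY, h0, h1']) (by simp [evalXY, h0]) ?_
  filter_upwards [h] with t ht
  rw [PainleveVIAlong, evalXY_painleveP, evalXY_painleveQ, evalXY_painleveR,
    evalXY_painleveS] at ht
  simp [evalXY, -one_div]
  linear_combination ht

/-- The equation is singular at `y = 1`; in terms of `v = y - 1` one has `c₀ = γ`. -/
theorem eventually_comp_mul_eq_of_value_one (h0 : x₀ ≠ 0) (h1 : x₀ ≠ 1) (hr : r ≠ 0)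
    (hn : n ≠ 0) (hζ : IsPrimitiveRoot ζ n) (hξ : ξ = fun t => x₀ + r * t ^ n)
    (hυ : AnalyticAt ℂ υ 0) (hυ0 : υ 0 = 1)
    (h : ∀ᶠ t in 𝓝[≠] 0, PainleveVIAlong α β γ δ ξ υ t) :
    ∀ᶠ t in 𝓝[≠] 0, υ (ζ * t) = υ t := by
  have h1' := sub_ne_zero.mpr h1
  have hd : deriv (fun t => υ t - 1) = deriv υ := by
    funext t
    exact deriv_sub_const _
  have key := eventually_comp_mul_eq_of_singular (c₀ := γ) (v := fun t => υ t - 1)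
    (P := 2 * X 0 ^ 2 * (X 0 - 1) ^ 2 * (X 1 + 1) * (X 1 + 1 - X 0))
    (A := X 0 ^ 2 * (X 0 - 1) ^ 2 * ((X 1 + 1 - X 0) + (X 1 + 1)))
    (B := -(2 * X 0 * (X 0 - 1)) *
      ((2 * X 0 - 1) * (X 1 + 1) * (X 1 + 1 - X 0) + X 0 * (X 0 - 1) * (X 1 + 1)))
    (D := 2 * (C α * (X 1 + 1) ^ 2 * (X 1 + 1 - X 0) ^ 2 - C β * X 0 * (X 1 + 1 - X 0) ^ 2
      - C (δ - 1 / 2) * X 0 * (X 0 - 1) * (X 1 + 1) ^ 2))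
    (E := 2 * (X 0 - 1) * ((X 1 + 1) * (X 1 + 1 - X 0)) ^ 2)
    hr hn hζ hξ (by fun_prop) (by simp [hυ0])
    (by simp [evalXY, h0, h1', sub_ne_zero.mpr h1.symm])
    (by simp [evalXY, h1', sub_ne_zero.mpr h1.symm]) (by
      filter_upwards [h] with t ht
      rw [PainleveVIAlong, evalXY_painleveP, evalXY_painleveQ, evalXY_painleveR,
        evalXY_painleveS] at ht
      simp [evalXY, hd, -one_div]
      linear_combination ht)
  simpa using key

/-- The equation is singular at `y = x`; in terms of `v = y - x` one has `c₀ = -2 δ`, where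
`-2 (δ - 1 / 2)` comes from the last term of the equation, and `-1` from `y' = v' + 1`. -/
theorem eventually_comp_mul_eq_of_value_self (h0 : x₀ ≠ 0) (h1 : x₀ ≠ 1) (hr : r ≠ 0)
    (hn : n ≠ 0) (hζ : IsPrimitiveRoot ζ n) (hξ : ξ = fun t => x₀ + r * t ^ n)
    (hυ : AnalyticAt ℂ υ 0) (hυ0 : υ 0 = x₀)
    (h : ∀ᶠ t in 𝓝[≠] 0, PainleveVIAlong α β γ δ ξ υ t) :
    ∀ᶠ t in 𝓝[≠] 0, υ (ζ * t) = υ t := by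
  have h1' := sub_ne_zero.mpr h1
  have hξ' : AnalyticAt ℂ ξ 0 := by rw [hξ]; fun_prop
  have hξ0 : ξ 0 = x₀ := by simp [hξ, hn]
  have hd : ∀ᶠ t in 𝓝 0, deriv (fun t => υ t - ξ t) t = deriv υ t - deriv ξ t := by
    filter_upwards [hυ.eventually_analyticAt, hξ'.eventually_analyticAt] with t h1 h2
    exact deriv_fun_sub h1.differentiableAt h2.differentiableAt
  have hd2 : ∀ᶠ t in 𝓝 0, deriv (deriv (fun t => υ t - ξ t)) t =
      deriv (deriv υ) t - deriv (deriv ξ) t := by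
    filter_upwards [hd.eventually_nhds, hυ.eventually_analyticAt,
      hξ'.eventually_analyticAt] with t h0 h1 h2
    rw [EventuallyEq.deriv_eq h0]
    exact deriv_fun_sub h1.deriv.differentiableAt h2.deriv.differentiableAt
  have key := eventually_comp_mul_eq_of_singular (c₀ := -(2 * δ)) (v := fun t => υ t - ξ t)
    (P := 2 * X 0 ^ 2 * (X 0 - 1) ^ 2 * (X 1 + X 0) * (X 1 + X 0 - 1))
    (A := X 0 ^ 2 * (X 0 - 1) ^ 2 * (2 * (X 1 + X 0) - 1))
    (B := 2 * X 0 ^ 2 * (X 0 - 1) ^ 2 * (2 * (X 1 + X 0) - 1)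
      - 2 * X 0 * (X 0 - 1) * (2 * X 0 - 1) * (X 1 + X 0) * (X 1 + X 0 - 1))
    (D := 2 * (C α * ((X 1 + X 0) * (X 1 + X 0 - 1)) ^ 2 - C β * X 0 * (X 1 + X 0 - 1) ^ 2
      + C γ * (X 0 - 1) * (X 1 + X 0) ^ 2)
      + X 0 * (X 0 - 1) * (3 * X 0 * (X 0 - 1) + X 1 ^ 2 - (2 * X 0 - 1) ^ 2))
    (E := X 0 * (X 0 - 1) * ((X 1 + X 0) * (X 1 + X 0 - 1)) ^ 2)
    hr hn hζ hξ (by fun_prop) (by simp [hυ0, hξ0])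
    (by simp [evalXY, h0, h1']) (by simp [evalXY, h0, h1']) (by
      filter_upwards [h, hd.filter_mono nhdsWithin_le_nhds,
        hd2.filter_mono nhdsWithin_le_nhds] with t ht hdt hdt2
      rw [PainleveVIAlong, evalXY_painleveP, evalXY_painleveQ, evalXY_painleveR,
        evalXY_painleveS] at ht
      rw [hdt, hdt2]
      simp [evalXY, -one_div]
      linear_combination ht)
  filter_upwards [key] with t ht
  have : ξ (ζ * t) = ξ t := by simp only [hξ, mul_pow, hζ.pow_eq_one, one_mul]
  rw [this] at ht
  exact sub_left_injective ht

/-- The equation is singular at `y = ∞`; in terms of `v = 1 / y` one has `c₀ = -α`. -/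
theorem eventually_comp_mul_eq_of_pole (h0 : x₀ ≠ 0) (h1 : x₀ ≠ 1) (hr : r ≠ 0)
    (hn : n ≠ 0) (hζ : IsPrimitiveRoot ζ n) (hξ : ξ = fun t => x₀ + r * t ^ n) {v : ℂ → ℂ}
    (hv : AnalyticAt ℂ v 0) (hv0 : v 0 = 0) (hv' : ∀ᶠ t in 𝓝[≠] 0, v t ≠ 0)
    (h : ∀ᶠ t in 𝓝[≠] 0, PainleveVIAlong α β γ δ ξ (fun t => (v t)⁻¹) t) :
    ∀ᶠ t in 𝓝[≠] 0, v (ζ * t) = v t := by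
  have h1' := sub_ne_zero.mpr h1
  have hd : ∀ᶠ t in 𝓝 0, v t ≠ 0 → deriv (fun t => (v t)⁻¹) t = -deriv v t / v t ^ 2 := by
    filter_upwards [hv.eventually_analyticAt] with t h1 h2
    exact deriv_fun_inv'' h1.differentiableAt h2
  have hd2 : ∀ᶠ t in 𝓝 0, v t ≠ 0 → deriv (deriv (fun t => (v t)⁻¹)) t =
      -deriv (deriv v) t / v t ^ 2 + 2 * deriv v t ^ 2 / v t ^ 3 := by
    filter_upwards [hd.eventually_nhds, hv.eventually_analyticAt] with t h0 h1 h2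
    have h3 : deriv (fun t => (v t)⁻¹) =ᶠ[𝓝 t] fun t => -deriv v t / v t ^ 2 := by
      filter_upwards [h0, h1.continuousAt.eventually_ne h2] with s hs hs' using hs hs'
    rw [h3.deriv_eq]
    have h4 := (h1.deriv.differentiableAt.hasDerivAt.neg).div
      (h1.differentiableAt.hasDerivAt.pow 2) (pow_ne_zero 2 h2)
    refine h4.deriv.trans ?_
    simp only [Pi.neg_apply, Pi.pow_apply]
    field_simp
    ring
  refine eventually_comp_mul_eq_of_singular (c₀ := -α)
    (P := 2 * X 0 ^ 2 * (X 0 - 1) ^ 2 * (1 - X 1) * (1 - X 0 * X 1))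
    (A := X 0 ^ 2 * (X 0 - 1) ^ 2 * (2 * X 0 * X 1 - 1 - X 0))
    (B := -(2 * X 0 * (X 0 - 1)) *
      ((2 * X 0 - 1) * (1 - X 1) * (1 - X 0 * X 1) + X 0 * (X 0 - 1) * (1 - X 1) * X 1))
    (D := -2 * (-C β * X 0 * ((1 - X 1) * (1 - X 0 * X 1)) ^ 2
      + C γ * (X 0 - 1) * (1 - X 0 * X 1) ^ 2
      - C (δ - 1 / 2) * X 0 * (X 0 - 1) * (1 - X 1) ^ 2))
    (E := 2 * ((1 - X 1) * (1 - X 0 * X 1)) ^ 2)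
    hr hn hζ hξ hv hv0 (by simp [evalXY, h0, h1']) (by simp [evalXY]) ?_
  filter_upwards [h, hv', hd.filter_mono nhdsWithin_le_nhds,
    hd2.filter_mono nhdsWithin_le_nhds] with t ht hvt hdt hdt2
  rw [PainleveVIAlong, evalXY_painleveP, evalXY_painleveQ, evalXY_painleveR,
    evalXY_painleveS, hdt hvt, hdt2 hvt] at ht
  simp [evalXY, -one_div]
  generalize deriv (deriv v) t = v2 at *
  generalize deriv v t = v1 at *
  generalize v t = w at *
  field_simp at ht
  linear_combination -ht

theorem PainleveVIAlong.congr {w : ℂ → ℂ} {t : ℂ} (h : υ =ᶠ[𝓝 t] w) :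
    PainleveVIAlong α β γ δ ξ υ t ↔ PainleveVIAlong α β γ δ ξ w t := by
  rw [PainleveVIAlong, PainleveVIAlong, h.eq_of_nhds, h.deriv.deriv_eq, h.deriv_eq]

theorem eventually_comp_mul_eq_of_congr {w : ℂ → ℂ} (hζ : ζ ≠ 0) (h : υ =ᶠ[𝓝[≠] 0] w)
    (hw : ∀ᶠ t in 𝓝[≠] 0, w (ζ * t) = w t) : ∀ᶠ t in 𝓝[≠] 0, υ (ζ * t) = υ t := by
  have h1 : Tendsto (fun t : ℂ => ζ * t) (𝓝[≠] 0) (𝓝[≠] 0) := by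
    refine tendsto_nhdsWithin_iff.mpr ⟨?_, ?_⟩
    · refine Tendsto.mono_left ?_ nhdsWithin_le_nhds
      have : Continuous fun t : ℂ => ζ * t := by fun_prop
      simpa using this.tendsto 0
    · filter_upwards [self_mem_nhdsWithin] with t ht using mul_ne_zero hζ ht
  filter_upwards [h, hw, h1.eventually h] with t ht1 ht2 ht3
  rw [ht3, ht2, ht1]

/-- **Painlevé property** for solutions with an algebraic singularity: a solution of the sixth
Painlevé equation which is meromorphic in a root of `x - x₀` is invariant under the monodromy
around `x₀ ≠ 0, 1`. -/
theorem eventually_comp_mul_eq (h0 : x₀ ≠ 0) (h1 : x₀ ≠ 1) (hr : r ≠ 0)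
    (hn : n ≠ 0) (hζ : IsPrimitiveRoot ζ n) (hξ : ξ = fun t => x₀ + r * t ^ n)
    (hυ : MeromorphicAt υ 0) (h : ∀ᶠ t in 𝓝[≠] 0, PainleveVIAlong α β γ δ ξ υ t) :
    ∀ᶠ t in 𝓝[≠] 0, υ (ζ * t) = υ t := by
  have hζ0 : ζ ≠ 0 := hζ.ne_zero hn
  rcases le_or_gt 0 (meromorphicOrderAt υ 0) with hord | hord
  · set w := toMeromorphicNFAt υ 0
    have hw : υ =ᶠ[𝓝[≠] 0] w := hυ.eq_nhdsNE_toMeromorphicNFAt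
    have hwa : AnalyticAt ℂ w 0 := by
      rw [← (meromorphicNFAt_toMeromorphicNFAt).meromorphicOrderAt_nonneg_iff_analyticAt]
      rwa [meromorphicOrderAt_congr hw.symm]
    have hP : ∀ᶠ t in 𝓝[≠] 0, PainleveVIAlong α β γ δ ξ w t := by
      filter_upwards [h, eventually_eventually_nhdsWithin.mpr hw, self_mem_nhdsWithin]
        with t h1 h2 h3
      rw [isOpen_compl_singleton.nhdsWithin_eq h3] at h2
      exact (PainleveVIAlong.congr h2).mp h1
    refine eventually_comp_mul_eq_of_congr hζ0 hw ?_
    by_cases hw0 : w 0 = 0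
    · exact eventually_comp_mul_eq_of_value_zero h0 h1 hr hn hζ hξ hwa hw0 hP
    by_cases hw1 : w 0 = 1
    · exact eventually_comp_mul_eq_of_value_one h0 h1 hr hn hζ hξ hwa hw1 hP
    by_cases hwx : w 0 = x₀
    · exact eventually_comp_mul_eq_of_value_self h0 h1 hr hn hζ hξ hwa hwx hP
    · refine eventually_comp_mul_eq_of_regular hr hn hζ hξ hwa ?_ hP
      rw [evalXY_painleveP]
      simp [h0, sub_eq_zero, h1, hw0, hw1, hwx]
  · have hυ' := hυ.inv
    set v := toMeromorphicNFAt υ⁻¹ 0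
    have hv : υ⁻¹ =ᶠ[𝓝[≠] 0] v := hυ'.eq_nhdsNE_toMeromorphicNFAt
    have hordv : 0 < meromorphicOrderAt v 0 := by
      rw [meromorphicOrderAt_congr hv.symm, meromorphicOrderAt_inv]
      cases hm : meromorphicOrderAt υ 0 with
      | top => simp [hm] at hord
      | coe m =>
        rw [hm] at hord
        have : m < 0 := by exact_mod_cast hord
        have : (0 : ℤ) < -m := by omega
        exact_mod_cast this
    have hvNF : MeromorphicNFAt v 0 := meromorphicNFAt_toMeromorphicNFAt
    have hva : AnalyticAt ℂ v 0 :=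
      hvNF.meromorphicOrderAt_nonneg_iff_analyticAt.mp hordv.le
    have hv0 : v 0 = 0 := by
      by_contra hne
      exact hordv.ne' (hvNF.meromorphicOrderAt_eq_zero_iff.mpr hne)
    have hυne : ∀ᶠ t in 𝓝[≠] 0, υ t ≠ 0 :=
      (meromorphicOrderAt_ne_top_iff_eventually_ne_zero hυ).mp hord.ne_top
    have hw : υ =ᶠ[𝓝[≠] 0] fun t => (v t)⁻¹ := by
      filter_upwards [hv] with t ht
      rw [← ht, Pi.inv_apply, inv_inv]
    refine eventually_comp_mul_eq_of_congr hζ0 hw ?_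
    have key := eventually_comp_mul_eq_of_pole (α := α) (β := β) (γ := γ) (δ := δ)
      h0 h1 hr hn hζ hξ hva hv0
      (by
        filter_upwards [hv, hυne] with t ht1 ht2
        rw [← ht1]
        exact inv_ne_zero ht2) (by
        filter_upwards [h, eventually_eventually_nhdsWithin.mpr hw,
          self_mem_nhdsWithin] with t h1 h2 h3
        rw [isOpen_compl_singleton.nhdsWithin_eq h3] at h2
        exact (PainleveVIAlong.congr h2).mp h1)
    filter_upwards [key] with t ht
    rw [ht]

end

/-! ### Continuation of the branches of a multivalued meromorphic function -/

/-- The identity theorem for meromorphic functions in normal form. -/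
theorem MeromorphicNFOn.eqOn_of_eventuallyEq {f g : ℂ → ℂ} {V : Set ℂ}
    (hf : MeromorphicNFOn f V) (hg : MeromorphicNFOn g V) (hV : IsPreconnected V)
    {p : ℂ} (hp : p ∈ V) (h : f =ᶠ[𝓝 p] g) : Set.EqOn f g V := by
  have hsub : MeromorphicOn (f - g) V := fun z hz =>
    (hf hz).meromorphicAt.sub (hg hz).meromorphicAt
  have htop : ∀ z : V, meromorphicOrderAt (f - g) z = ⊤ := by
    by_contra! hz
    refine (hsub.exists_meromorphicOrderAt_ne_top_iff_forall ⟨⟨p, hp⟩, hV⟩).mp hz ⟨p, hp⟩ ?_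
    rw [meromorphicOrderAt_eq_top_iff]
    filter_upwards [h.filter_mono nhdsWithin_le_nhds] with z hz
    simp [hz]
  intro z hz
  have h1 : f =ᶠ[𝓝[≠] z] g := by
    filter_upwards [meromorphicOrderAt_eq_top_iff.mp (htop ⟨z, hz⟩)] with w hw
    exact sub_eq_zero.mp hw
  exact (((hf hz).eventuallyEq_nhdsNE_iff_eventuallyEq_nhds (hg hz)).mp h1).eq_of_nhds

/-- A function whose values are taken from finitely many others agrees with one of them. -/
theorem MeromorphicNFAt.exists_eventuallyEq_of_frequently {f : ℂ → ℂ} {p : ℂ} {L : Set (ℂ → ℂ)}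
    (hL : L.Finite) (hf : MeromorphicNFAt f p) (hg : ∀ g ∈ L, MeromorphicNFAt g p)
    (h : ∃ᶠ z in 𝓝[≠] p, ∃ g ∈ L, g z = f z) : ∃ g ∈ L, f =ᶠ[𝓝 p] g := by
  by_contra! hne
  refine h ?_
  have h1 : ∀ᶠ z in 𝓝[≠] p, ∀ g ∈ L, ¬ g z = f z := by
    rw [eventually_all_finite hL]
    intro g hgL
    by_contra hfr
    have h2 : ∃ᶠ z in 𝓝[≠] p, f z = g z := by
      refine (not_eventually.mp hfr).mono fun z hz => ?_
      exact (not_not.mp hz).symm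
    refine hne g hgL ((hf.eventuallyEq_nhdsNE_iff_eventuallyEq_nhds (hg g hgL)).mp ?_)
    exact (hf.meromorphicAt.frequently_eq_iff_eventuallyEq (hg g hgL).meromorphicAt).mp h2
  filter_upwards [h1] with z hz ⟨g, hgL, hgz⟩ using hz g hgL hgz

/-- The finite set `L` of functions consists of all the local branches at `p` of the multivalued
function with graph `R`. The values at `p` itself are left out, as branches may have poles there or
coincide. -/
structure IsBranchSet (R : ℂ → ℂ → Prop) (p : ℂ) (L : Set (ℂ → ℂ)) : Prop where
  finite : L.Finite
  normalForm : ∀ g ∈ L, MeromorphicNFAt g p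
  eventually_iff : ∀ᶠ z in 𝓝[≠] p, ∀ y, R z y ↔ ∃ g ∈ L, g z = y

/-- A meromorphic branch on `V` of the multivalued function with graph `R`. -/
structure IsBranchOn (R : ℂ → ℂ → Prop) (f : ℂ → ℂ) (V : Set ℂ) : Prop where
  normalForm : MeromorphicNFOn f V
  eventually_graph : ∀ p ∈ V, ∀ᶠ z in 𝓝[≠] p, R z (f z)

section

variable {R : ℂ → ℂ → Prop}

theorem IsBranchOn.mono {f : ℂ → ℂ} {V W : Set ℂ} (h : IsBranchOn R f V) (hW : W ⊆ V) :
    IsBranchOn R f W :=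
  ⟨fun _ hz => h.normalForm (hW hz), fun p hp => h.eventually_graph p (hW hp)⟩

theorem IsBranchSet.exists_eventuallyEq {p : ℂ} {L : Set (ℂ → ℂ)} (hL : IsBranchSet R p L)
    {f : ℂ → ℂ} (hf : MeromorphicNFAt f p) (h : ∀ᶠ z in 𝓝[≠] p, R z (f z)) :
    ∃ g ∈ L, f =ᶠ[𝓝 p] g := by
  refine hf.exists_eventuallyEq_of_frequently hL.finite hL.normalForm (Eventually.frequently ?_)
  filter_upwards [h, hL.eventually_iff] with z hz hz' using (hz' _).mp hz

theorem MeromorphicNFAt.eventually_meromorphicNFAt {f : ℂ → ℂ} {p : ℂ} (hf : MeromorphicNFAt f p) :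
    ∀ᶠ z in 𝓝 p, MeromorphicNFAt f z := by
  have h := eventually_nhdsWithin_iff.mp hf.meromorphicAt.eventually_analyticAt
  filter_upwards [h] with z hz
  by_cases hzp : z = p
  · rwa [hzp]
  · exact (hz hzp).meromorphicNFAt

theorem IsBranchSet.exists_ball {p : ℂ} {L : Set (ℂ → ℂ)} (hL : IsBranchSet R p L)
    {Ω : Set ℂ} (hΩ : Ω ∈ 𝓝 p) :
    ∃ ρ > 0, Metric.ball p ρ ⊆ Ω ∧ (∀ g ∈ L, IsBranchOn R g (Metric.ball p ρ)) ∧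
      ∀ z ∈ Metric.ball p ρ, z ≠ p → ∀ y, R z y ↔ ∃ g ∈ L, g z = y := by
  have h1 : ∀ᶠ z in 𝓝 p, ∀ g ∈ L, MeromorphicNFAt g z := by
    rw [eventually_all_finite hL.finite]
    exact fun g hg => (hL.normalForm g hg).eventually_meromorphicNFAt
  obtain ⟨ρ, hρ, h⟩ := Metric.eventually_nhds_iff_ball.mp
    (h1.and ((eventually_nhdsWithin_iff.mp hL.eventually_iff).and hΩ))
  refine ⟨ρ, hρ, fun z hz => (h z hz).2.2, fun g hg => ⟨fun z hz => (h z hz).1 g hg, ?_⟩,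
    fun z hz hzp => (h z hz).2.1 hzp⟩
  intro q hq
  have hne : ∀ᶠ z in 𝓝[≠] q, z ≠ p := by
    by_cases hqp : q = p
    · rw [hqp]
      exact self_mem_nhdsWithin
    · exact (eventually_ne_nhds hqp).filter_mono nhdsWithin_le_nhds
  filter_upwards [hne, (Metric.isOpen_ball.eventually_mem hq).filter_mono nhdsWithin_le_nhds]
    with z hz hzB
  exact ((h z hzB).2.1 hz _).mpr ⟨g, hg, rfl⟩

/-- Branches which agree at a point of the intersection of two convex domains can be glued. -/
theorem IsBranchOn.exists_glue {V B : Set ℂ} (hV : IsOpen V) (hB : IsOpen B)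
    (hVc : Convex ℝ V) (hBc : Convex ℝ B) {f g : ℂ → ℂ} (hf : IsBranchOn R f V)
    (hg : IsBranchOn R g B) {p : ℂ} (hpV : p ∈ V) (hpB : p ∈ B) (hfg : f =ᶠ[𝓝 p] g) :
    ∃ h, IsBranchOn R h (V ∪ B) ∧ Set.EqOn h f V := by
  classical
  have heq : Set.EqOn f g (V ∩ B) :=
    MeromorphicNFOn.eqOn_of_eventuallyEq (hf.mono Set.inter_subset_left).normalForm
      (hg.mono Set.inter_subset_right).normalForm (hVc.inter hBc).isPreconnected ⟨hpV, hpB⟩ hfg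
  set h : ℂ → ℂ := V.piecewise f g
  have hhV : Set.EqOn h f V := V.piecewise_eqOn f g
  have hhB : Set.EqOn h g B := by
    intro z hz
    by_cases hzV : z ∈ V
    · rw [hhV hzV, heq ⟨hzV, hz⟩]
    · exact V.piecewise_eq_of_notMem f g hzV
  refine ⟨h, ⟨?_, ?_⟩, hhV⟩
  · rintro z (hz | hz)
    · exact (meromorphicNFAt_congr (hhV.eventuallyEq_of_mem (hV.mem_nhds hz))).mpr
        (hf.normalForm hz)
    · exact (meromorphicNFAt_congr (hhB.eventuallyEq_of_mem (hB.mem_nhds hz))).mpr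
        (hg.normalForm hz)
  · rintro z (hz | hz)
    · filter_upwards [hf.eventually_graph z hz,
        nhdsWithin_le_nhds (hV.mem_nhds hz)] with w hw hwV
      rwa [hhV hwV]
    · filter_upwards [hg.eventually_graph z hz,
        nhdsWithin_le_nhds (hB.mem_nhds hz)] with w hw hwB
      rwa [hhB hwB]

open AffineMap in
/-- Continuation of a branch along a segment, through convex domains. -/
theorem exists_isBranchOn_convex {Ω : Set ℂ} (hΩ : IsOpen Ω) (hΩc : Convex ℝ Ω)
    (hR : ∀ p ∈ Ω, ∃ L, IsBranchSet R p L) {a b : ℂ} (ha : a ∈ Ω) (hb : b ∈ Ω) {f₀ : ℂ → ℂ}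
    (hf₀ : MeromorphicNFAt f₀ a) (hf₀R : ∀ᶠ z in 𝓝[≠] a, R z (f₀ z)) :
    ∃ (V : Set ℂ) (f : ℂ → ℂ), IsOpen V ∧ Convex ℝ V ∧ V ⊆ Ω ∧ a ∈ V ∧ b ∈ V ∧
      IsBranchOn R f V ∧ f =ᶠ[𝓝 a] f₀ := by
  let P : ℝ → Prop := fun t => ∃ (V : Set ℂ) (f : ℂ → ℂ), IsOpen V ∧ Convex ℝ V ∧ V ⊆ Ω ∧ a ∈ V ∧
    lineMap a b t ∈ V ∧ IsBranchOn R f V ∧ f =ᶠ[𝓝 a] f₀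
  have hγ : Continuous fun t : ℝ => (lineMap a b t : ℂ) := AffineMap.lineMap_continuous
  have hγΩ : ∀ t ∈ Set.Icc (0 : ℝ) 1, lineMap a b t ∈ Ω := fun t ht =>
    hΩc.lineMap_mem ha hb ht
  have hP0 : P 0 := by
    obtain ⟨L, hL⟩ := hR a ha
    obtain ⟨g, hg, hfg⟩ := hL.exists_eventuallyEq hf₀ hf₀R
    obtain ⟨ρ, hρ, hsub, hbr, -⟩ := hL.exists_ball (hΩ.mem_nhds ha)
    exact ⟨Metric.ball a ρ, g, Metric.isOpen_ball, convex_ball a ρ, hsub,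
      Metric.mem_ball_self hρ, by simpa using hρ, hbr g hg, hfg.symm⟩
  have hstep : ∀ t ∈ Set.Icc (0 : ℝ) 1, ∃ N ∈ 𝓝 t, ∀ s ∈ N ∩ Set.Icc 0 1,
      ∀ s' ∈ N ∩ Set.Icc 0 1, P s → P s' := by
    intro t ht
    obtain ⟨L, hL⟩ := hR _ (hγΩ t ht)
    obtain ⟨ρ, hρ, hsub, hbr, hiff⟩ := hL.exists_ball (hΩ.mem_nhds (hγΩ t ht))
    set B := Metric.ball (lineMap a b t : ℂ) ρ with hB
    refine ⟨(fun t : ℝ => (lineMap a b t : ℂ)) ⁻¹' B,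
      hγ.continuousAt.preimage_mem_nhds (Metric.ball_mem_nhds _ hρ), ?_⟩
    rintro s ⟨hsB, hs⟩ s' ⟨hsB', hs'⟩ ⟨V, f, hV, hVc, hVΩ, haV, hsV, hf, hff₀⟩
    simp only [Set.mem_preimage] at hsB hsB'
    -- the point with parameter `u ≤ s` lies in `V`, those between `s` and `s'` in the ball
    have hmemV : ∀ u ∈ Set.Icc 0 s, lineMap a b u ∈ V := by
      intro u hu
      rcases hs.1.eq_or_lt with h0 | h0
      · obtain rfl : u = 0 := le_antisymm (h0 ▸ hu.2) hu.1
        simpa using haV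
      · have := hVc.lineMap_mem haV hsV (t := u / s)
          ⟨div_nonneg hu.1 h0.le, (div_le_one h0).mpr hu.2⟩
        rwa [AffineMap.lineMap_lineMap_right, div_mul_cancel₀ _ h0.ne'] at this
    rcases le_total s' s with hle | hle
    · exact ⟨V, f, hV, hVc, hVΩ, haV, hmemV s' ⟨hs'.1, hle⟩, hf, hff₀⟩
    obtain ⟨g, hg, hfg⟩ : ∃ g ∈ L, f =ᶠ[𝓝 (lineMap a b s)] g := by
      refine (hf.normalForm hsV).exists_eventuallyEq_of_frequently hL.finite
        (fun g hg => (hbr g hg).normalForm hsB) (Eventually.frequently ?_)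
      have hne : ∀ᶠ z in 𝓝[≠] (lineMap a b s : ℂ), z ≠ lineMap a b t := by
        by_cases hqp : (lineMap a b s : ℂ) = lineMap a b t
        · rw [hqp]
          exact self_mem_nhdsWithin
        · exact (eventually_ne_nhds hqp).filter_mono nhdsWithin_le_nhds
      filter_upwards [hne, hf.eventually_graph _ hsV,
        (Metric.isOpen_ball.eventually_mem hsB).filter_mono nhdsWithin_le_nhds] with z h1 h2 h3
      exact (hiff z h3 h1 _).mp h2
    obtain ⟨h, hh, hhf⟩ := hf.exists_glue hV Metric.isOpen_ball hVc (convex_ball _ ρ) (hbr g hg)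
      hsV hsB hfg
    -- the segment is compact, so a convex neighbourhood of it lies in `V ∪ B`
    have hK : segment ℝ a (lineMap a b s' : ℂ) ⊆ V ∪ B := by
      rw [segment_eq_image_lineMap]
      rintro _ ⟨v, hv, rfl⟩
      rw [AffineMap.lineMap_lineMap_right]
      have hu : v * s' ∈ Set.Icc 0 s' := ⟨mul_nonneg hv.1 hs'.1, mul_le_of_le_one_left hs'.1 hv.2⟩
      rcases le_total (v * s') s with hus | hus
      · exact Or.inl (hmemV _ ⟨hu.1, hus⟩)
      · right
        have hconv : Convex ℝ ((lineMap a b : ℝ →ᵃ[ℝ] ℂ) ⁻¹' B) :=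
          (convex_ball _ ρ).affine_preimage _
        exact hconv.ordConnected.out hsB hsB' ⟨hus, hu.2⟩
    have hKc : IsCompact (segment ℝ a (lineMap a b s' : ℂ)) := by
      rw [segment_eq_image_lineMap]
      exact isCompact_Icc.image AffineMap.lineMap_continuous
    obtain ⟨ε, hε, hεsub⟩ := hKc.exists_thickening_subset_open (hV.union Metric.isOpen_ball) hK
    have hKsub := Metric.self_subset_thickening hε (segment ℝ a (lineMap a b s' : ℂ))
    refine ⟨Metric.thickening ε (segment ℝ a (lineMap a b s' : ℂ)), h, Metric.isOpen_thickening,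
      (convex_segment _ _).thickening ε, hεsub.trans (Set.union_subset hVΩ hsub),
      hKsub (left_mem_segment ℝ _ _), hKsub (right_mem_segment ℝ _ _), hh.mono hεsub, ?_⟩
    exact (hhf.eventuallyEq_of_mem (hV.mem_nhds haV)).trans hff₀
  have hP1 : P 1 := by
    refine isPreconnected_Icc.induction₂' (fun s s' => P s → P s') (fun t ht => ?_)
      (fun _ _ _ _ _ _ h1 h2 h => h2 (h1 h)) (Set.left_mem_Icc.mpr zero_le_one)
      (Set.right_mem_Icc.mpr zero_le_one) hP0
    obtain ⟨N, hN, h⟩ := hstep t ht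
    have htN := mem_of_mem_nhds hN
    filter_upwards [mem_nhdsWithin_of_mem_nhds hN, self_mem_nhdsWithin] with s hs hs'
    exact ⟨h t ⟨htN, ht⟩ s ⟨hs, hs'⟩, h s ⟨hs, hs'⟩ t ⟨htN, ht⟩⟩
  simpa [P] using hP1

/-- **Monodromy theorem** for a multivalued meromorphic function on a convex domain: if it splits
locally into finitely many meromorphic branches, each local branch extends to the domain. -/
theorem exists_isBranchOn {Ω : Set ℂ} (hΩ : IsOpen Ω) (hΩc : Convex ℝ Ω)
    (hR : ∀ p ∈ Ω, ∃ L, IsBranchSet R p L) {a : ℂ} (ha : a ∈ Ω) {f₀ : ℂ → ℂ}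
    (hf₀ : MeromorphicNFAt f₀ a) (hf₀R : ∀ᶠ z in 𝓝[≠] a, R z (f₀ z)) :
    ∃ f, IsBranchOn R f Ω ∧ f =ᶠ[𝓝 a] f₀ := by
  have h : ∀ b : Ω, ∃ (V : Set ℂ) (f : ℂ → ℂ), IsOpen V ∧ Convex ℝ V ∧ V ⊆ Ω ∧ a ∈ V ∧ ↑b ∈ V ∧
      IsBranchOn R f V ∧ f =ᶠ[𝓝 a] f₀ :=
    fun b => exists_isBranchOn_convex hΩ hΩc hR ha b.2 hf₀ hf₀R
  choose V f hV hVc hVΩ haV hbV hf hff₀ using h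
  classical
  let F : ℂ → ℂ := fun z => if hz : z ∈ Ω then f ⟨z, hz⟩ z else 0
  have hF : ∀ b : Ω, Set.EqOn F (f b) (V b) := by
    intro b z hz
    have hzΩ : z ∈ Ω := hVΩ b hz
    have heq := MeromorphicNFOn.eqOn_of_eventuallyEq
      ((hf ⟨z, hzΩ⟩).mono (Set.inter_subset_left (t := V b))).normalForm
      ((hf b).mono Set.inter_subset_right).normalForm
      ((hVc ⟨z, hzΩ⟩).inter (hVc b)).isPreconnected ⟨haV _, haV b⟩
      ((hff₀ _).trans (hff₀ b).symm)
    simp only [F, hzΩ, dif_pos]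
    exact heq ⟨hbV ⟨z, hzΩ⟩, hz⟩
  have hnear : ∀ b : Ω, ∀ z ∈ V b, F =ᶠ[𝓝 z] f b := fun b z hz =>
    (hF b).eventuallyEq_of_mem ((hV b).mem_nhds hz)
  refine ⟨F, ⟨fun z hz => ?_, fun z hz => ?_⟩, (hnear ⟨a, ha⟩ a (haV _)).trans (hff₀ _)⟩
  · exact (meromorphicNFAt_congr (hnear ⟨z, hz⟩ z (hbV _))).mpr ((hf _).normalForm (hbV _))
  · filter_upwards [(hf ⟨z, hz⟩).eventually_graph z (hbV _),
      (hnear ⟨z, hz⟩ z (hbV _)).filter_mono nhdsWithin_le_nhds] with w h1 h2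
    rwa [h2]

/-- On a convex domain there are finitely many branches, as a branch is determined by its germ at
one point. -/
theorem exists_finite_branches {Ω : Set ℂ} (hΩ : IsOpen Ω) (hΩc : Convex ℝ Ω)
    (hR : ∀ p ∈ Ω, ∃ L, IsBranchSet R p L) (hne : Ω.Nonempty) :
    ∃ L : Set (ℂ → ℂ), L.Finite ∧ (∀ f ∈ L, IsBranchOn R f Ω) ∧
      ∀ f, IsBranchOn R f Ω → ∃ g ∈ L, Set.EqOn f g Ω := by
  obtain ⟨a, ha⟩ := hne
  obtain ⟨L, hL⟩ := hR a ha
  obtain ⟨ρ, hρ, -, hbr, -⟩ := hL.exists_ball (hΩ.mem_nhds ha)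
  have h : ∀ g ∈ L, ∃ f, IsBranchOn R f Ω ∧ f =ᶠ[𝓝 a] g := fun g hg =>
    exists_isBranchOn hΩ hΩc hR ha (hL.normalForm g hg)
      ((hbr g hg).eventually_graph a (Metric.mem_ball_self hρ))
  choose! c hc hca using h
  refine ⟨c '' L, hL.finite.image c, ?_, fun f hf => ?_⟩
  · rintro _ ⟨g, hg, rfl⟩
    exact hc g hg
  · obtain ⟨g, hg, hfg⟩ := hL.exists_eventuallyEq (hf.normalForm ha) (hf.eventually_graph a ha)
    exact ⟨c g, ⟨g, hg, rfl⟩, MeromorphicNFOn.eqOn_of_eventuallyEq hf.normalForm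
      (hc g hg).normalForm hΩc.isPreconnected ha (hfg.trans (hca g hg).symm)⟩

end

/-! ### The branches of an algebraic function -/

theorem contDiff_evalXY (F : MvPolynomial (Fin 2) ℂ) {n : WithTop ℕ∞} :
    ContDiff ℂ n fun p : ℂ × ℂ => evalXY F p.1 p.2 := by
  induction F using MvPolynomial.induction_on with
  | C a => simpa [evalXY] using contDiff_const
  | add p q hp hq => simpa only [evalXY_add] using! hp.add hq
  | mul_X p i hp =>
    simp only [evalXY_mul]
    refine hp.mul ?_
    fin_cases i
    · simpa [evalXY] using contDiff_fst
    · simpa [evalXY] using contDiff_snd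

/-- The implicit function theorem for plane curves. -/
theorem exists_analyticAt_root (F : MvPolynomial (Fin 2) ℂ) {x₀ y₀ : ℂ}
    (h : evalXY F x₀ y₀ = 0) (hY : partialY F x₀ y₀ ≠ 0) :
    ∃ g : ℂ → ℂ, AnalyticAt ℂ g x₀ ∧ g x₀ = y₀ ∧ ∀ᶠ x in 𝓝 x₀, evalXY F x (g x) = 0 := by
  let f : ℂ × ℂ → ℂ := fun p => evalXY F p.1 p.2
  have hf : ContDiffAt ℂ ⊤ f (x₀, y₀) := (contDiff_evalXY F).contDiffAt
  have hd : (fderiv ℂ f (x₀, y₀) ∘L .inr ℂ ℂ ℂ) =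
      (ContinuousLinearEquiv.unitsEquivAut ℂ (Units.mk0 _ hY) : ℂ →L[ℂ] ℂ) := by
    ext
    have h1 : HasFDerivAt (fun y : ℂ => (x₀, y)) (ContinuousLinearMap.inr ℂ ℂ ℂ) y₀ :=
      hasFDerivAt_prodMk_right x₀ y₀
    have h2 := (hf.differentiableAt (by simp)).hasFDerivAt.comp y₀ h1
    have h3 := h2.hasDerivAt.unique (hasDerivAt_evalXY_right F x₀ y₀)
    simpa using h3
  have hinv : (fderiv ℂ f (x₀, y₀) ∘L .inr ℂ ℂ ℂ).IsInvertible := ⟨_, hd.symm⟩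
  refine ⟨hf.implicitFunction (by simp) hinv, ?_, hf.implicitFunction_apply_self _ hinv, ?_⟩
  · exact (hf.contDiffAt_implicitFunction (by simp) hinv).analyticAt
  · have := hf.eventually_apply_implicitFunction (by simp) hinv
    filter_upwards [this] with x hx
    exact hx.trans h

/-- Away from the zeros of the leading coefficient and of the discriminant, the roots `y` of
`F(x, y) = 0` are analytic functions of `x`. There are no others than those of the implicit function
theorem, by counting. -/
theorem exists_analyticAt_roots (F : MvPolynomial (Fin 2) ℂ) {x₀ : ℂ}
    (hlc : (asPolyInY F).leadingCoeff.eval x₀ ≠ 0)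
    (hY : ∀ y, evalXY F x₀ y = 0 → partialY F x₀ y ≠ 0) :
    ∃ L : Set (ℂ → ℂ), L.Finite ∧ (∀ g ∈ L, AnalyticAt ℂ g x₀) ∧
      ∀ᶠ x in 𝓝 x₀, ∀ y, evalXY F x y = 0 ↔ ∃ g ∈ L, g x = y := by
  classical
  let P : ℂ → Polynomial ℂ := fun x => (asPolyInY F).map (Polynomial.evalRingHom x)
  have hev : ∀ x y, (P x).eval y = evalXY F x y := eval_map_asPolyInY F
  have hdeg : (P x₀).natDegree = (asPolyInY F).natDegree :=
    Polynomial.natDegree_map_of_leadingCoeff_ne_zero _ (by simpa using hlc)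
  have hP : ∀ᶠ x in 𝓝 x₀, P x ≠ 0 := by
    have h1 : ContinuousAt (fun x => (asPolyInY F).leadingCoeff.eval x) x₀ := by fun_prop
    filter_upwards [h1.eventually_ne hlc] with x hx h0
    have := congrArg (fun q => q.coeff (asPolyInY F).natDegree) h0
    simp only [P, Polynomial.coeff_map, Polynomial.coeff_zero] at this
    exact hx this
  have hP0 : P x₀ ≠ 0 := hP.self_of_nhds
  let S := (P x₀).roots.toFinset
  have hS : ∀ y, y ∈ S ↔ evalXY F x₀ y = 0 := fun y => by
    simp only [S, Multiset.mem_toFinset, Polynomial.mem_roots hP0, Polynomial.IsRoot.def, hev]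
  have hcard : S.card = (asPolyInY F).natDegree := by
    have hnodup : (P x₀).roots.Nodup := by
      refine Multiset.nodup_iff_count_le_one.mpr fun y => ?_
      rw [Polynomial.count_roots]
      by_contra! hy
      obtain ⟨h1, h2⟩ := (Polynomial.one_lt_rootMultiplicity_iff_isRoot hP0).mp hy
      rw [Polynomial.IsRoot.def, hev] at h1
      rw [Polynomial.IsRoot.def, Polynomial.derivative_map, ← asPolyInY_pderiv_one,
        eval_map_asPolyInY] at h2
      exact hY y h1 h2
    rw [Multiset.toFinset_card_of_nodup hnodup, ← hdeg]
    exact IsAlgClosed.card_roots_eq_natDegree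
  have hg : ∀ y ∈ S, ∃ g : ℂ → ℂ, AnalyticAt ℂ g x₀ ∧ g x₀ = y ∧
      ∀ᶠ x in 𝓝 x₀, evalXY F x (g x) = 0 := fun y hy =>
    exists_analyticAt_root F ((hS y).mp hy) (hY y ((hS y).mp hy))
  choose! g hga hg0 hgF using hg
  refine ⟨g '' S, S.finite_toSet.image g, ?_, ?_⟩
  · rintro _ ⟨y, hy, rfl⟩
    exact hga y hy
  have hroot : ∀ᶠ x in 𝓝 x₀, ∀ y ∈ S, evalXY F x (g y x) = 0 :=
    (Finset.eventually_all S).mpr hgF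
  have hinj : ∀ᶠ x in 𝓝 x₀, ∀ y ∈ S, ∀ y' ∈ S, y ≠ y' → g y x ≠ g y' x := by
    refine (Finset.eventually_all S).mpr fun y hy => (Finset.eventually_all S).mpr fun y' hy' => ?_
    by_cases hyy : y = y'
    · exact Eventually.of_forall fun _ h => absurd hyy h
    · have h1 : ContinuousAt (fun x => g y x - g y' x) x₀ :=
        (hga y hy).continuousAt.sub (hga y' hy').continuousAt
      filter_upwards [h1.eventually_ne (y := 0)
        (by rw [hg0 y hy, hg0 y' hy']; exact sub_ne_zero.mpr hyy)] with x hx _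
      exact sub_ne_zero.mp hx
  filter_upwards [hroot, hinj, hP] with x hx1 hx2 hx3 y
  have hmem : ∀ y, y ∈ (P x).roots.toFinset ↔ evalXY F x y = 0 := fun y => by
    simp only [Multiset.mem_toFinset, Polynomial.mem_roots hx3, Polynomial.IsRoot.def, hev]
  have hsub : S.image (fun y => g y x) ⊆ (P x).roots.toFinset := by
    intro z hz
    obtain ⟨y, hy, rfl⟩ := Finset.mem_image.mp hz
    exact (hmem _).mpr (hx1 y hy)
  have hcard2 : (S.image fun y => g y x).card = S.card :=
    Finset.card_image_of_injOn fun y hy y' hy' h => by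
      by_contra hne
      exact hx2 y hy y' hy' hne h
  have heq := Finset.eq_of_subset_of_card_le hsub (by
    rw [hcard2, hcard]
    exact (Multiset.toFinset_card_le _).trans
      ((Polynomial.card_roots' _).trans Polynomial.natDegree_map_le))
  rw [← hmem, ← heq, Finset.mem_image]
  exact ⟨fun ⟨z, hz, h⟩ => ⟨g z, ⟨z, hz, rfl⟩, h⟩, fun ⟨_, ⟨z, hz, h⟩, h'⟩ => ⟨z, hz, h ▸ h'⟩⟩

/-- The hypotheses of `exists_analyticAt_roots` fail only at isolated points. -/
theorem eventually_analytic_roots {F : MvPolynomial (Fin 2) ℂ} (hF : Irreducible F)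
    (hdeg : (asPolyInY F).natDegree ≠ 0) (x₀ : ℂ) :
    ∀ᶠ x in 𝓝[≠] x₀, (asPolyInY F).leadingCoeff.eval x ≠ 0 ∧
      ∀ y, evalXY F x y = 0 → partialY F x y ≠ 0 := by
  classical
  obtain ⟨s, hs, hs'⟩ := exists_eval_eq_zero_of_not_dvd hF hdeg
    (not_dvd_pderiv 1 (pderiv_one_ne_zero hdeg))
  have hne : ∀ q : Polynomial ℂ, q ≠ 0 → ∀ᶠ x in 𝓝[≠] x₀, q.eval x ≠ 0 := by
    intro q hq
    have h1 : ∀ᶠ x in 𝓝[≠] x₀, ∀ c ∈ q.roots.toFinset, x ≠ c :=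
      (Finset.eventually_all _).mpr fun c _ => by
        by_cases hc : x₀ = c
        · rw [hc]
          exact self_mem_nhdsWithin
        · exact (eventually_ne_nhds hc).filter_mono nhdsWithin_le_nhds
    filter_upwards [h1] with x hx h0
    exact hx x (by simpa [hq] using h0) rfl
  have hlc : (asPolyInY F).leadingCoeff ≠ 0 :=
    Polynomial.leadingCoeff_ne_zero.mpr (irreducible_asPolyInY hF).ne_zero
  filter_upwards [hne _ hlc, hne s hs] with x h1 h2
  exact ⟨h1, fun y hy hy' => h2 (hs' x y hy hy')⟩

/-- A bound for the roots of a polynomial. It is not assumed that the coefficient of degree `d` is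
different from zero. -/
theorem Polynomial.norm_coeff_mul_le {p : Polynomial ℂ} {d : ℕ} (hd : p.natDegree ≤ d) {y : ℂ}
    (hy : p.eval y = 0) : ‖p.coeff d * y‖ ≤ ∑ i ∈ Finset.range (d + 1), ‖p.coeff i‖ := by
  have hsum := p.eval_eq_sum_range' (Nat.lt_succ_of_le hd) y
  rw [hy, Nat.succ_eq_add_one, Finset.sum_range_succ] at hsum
  have hle : ‖p.coeff d‖ ≤ ∑ i ∈ Finset.range (d + 1), ‖p.coeff i‖ :=
    Finset.single_le_sum (f := fun i => ‖p.coeff i‖) (fun i _ => norm_nonneg _)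
      (Finset.self_mem_range_succ d)
  rcases le_or_gt ‖y‖ 1 with h1 | h1
  · rw [norm_mul]
    exact (mul_le_of_le_one_right (norm_nonneg _) h1).trans hle
  rcases d with _ | e
  · have : p.coeff 0 = 0 := by simpa using hsum.symm
    simp [this]
  · have hpow : 0 < ‖y‖ ^ e := by positivity
    have h2 : p.coeff (e + 1) * y * y ^ e = -∑ i ∈ Finset.range (e + 1), p.coeff i * y ^ i := by
      linear_combination -hsum
    have h3 : ‖p.coeff (e + 1) * y‖ * ‖y‖ ^ e ≤
        (∑ i ∈ Finset.range (e + 1), ‖p.coeff i‖) * ‖y‖ ^ e := by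
      rw [← norm_pow, ← norm_mul, h2, norm_neg, Finset.sum_mul]
      refine (norm_sum_le _ _).trans (Finset.sum_le_sum fun i hi => ?_)
      rw [norm_mul, norm_pow, norm_pow]
      gcongr
      · exact h1.le
      · exact Nat.le_of_lt_succ (Finset.mem_range.mp hi)
    refine (le_of_mul_le_mul_right h3 hpow).trans ?_
    rw [Finset.sum_range_succ _ (e + 1)]
    exact le_add_of_nonneg_right (norm_nonneg _)

theorem Function.Periodic.qParam_add (h : ℝ) (τ σ : ℂ) :
    qParam h (τ + σ) = qParam h τ * qParam h σ := by
  rw [qParam, qParam, qParam, ← Complex.exp_add]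
  congr 1
  ring

theorem Function.Periodic.qParam_self {h : ℝ} (hh : h ≠ 0) : qParam h h = 1 := by
  rw [qParam, mul_div_assoc, div_self (Complex.ofReal_ne_zero.mpr hh), mul_one,
    Complex.exp_two_pi_mul_I]

theorem Function.Periodic.qParam_natCast_pow {n : ℕ} (hn : n ≠ 0) (τ : ℂ) :
    qParam n τ ^ n = qParam 1 τ := by
  rw [qParam, qParam, ← Complex.exp_nat_mul]
  congr 1
  have : (n : ℂ) ≠ 0 := Nat.cast_ne_zero.mpr hn
  push_cast
  field_simp

theorem Function.Periodic.invQParam_mem_upperHalf {h : ℝ} (hh : 0 < h) {q : ℂ} (hq : q ≠ 0)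
    (hq1 : ‖q‖ < 1) : invQParam h q ∈ upperHalf := by
  have h1 := (norm_qParam_lt_iff hh 0 (invQParam h q)).mp (by
    rw [qParam_right_inv hh.ne' hq]
    simpa using hq1)
  exact h1

/-! ### Branches at a ramification point -/

open Function.Periodic in
/-- A periodic holomorphic function on the half-plane with at most a pole at the cusp is a
meromorphic function of the local parameter. -/
theorem exists_meromorphicAt_of_periodic {f a : ℂ → ℂ} {n : ℕ} (hn : n ≠ 0)
    (hf : ∀ τ ∈ upperHalf, AnalyticAt ℂ f τ) (hper : ∀ τ ∈ upperHalf, f (τ + n) = f τ)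
    (ha : Differentiable ℂ a) (ha0 : ∀ τ ∈ upperHalf, a (qParam n τ) ≠ 0) {M : ℝ}
    (hM : ∀ᶠ τ in comap Complex.im atTop, ‖a (qParam n τ) * f τ‖ ≤ M) :
    ∃ h : ℂ → ℂ, MeromorphicAt h 0 ∧ ∀ τ ∈ upperHalf, f τ = h (qParam n τ) := by
  classical
  have hn' : (0 : ℝ) < n := Nat.cast_pos.mpr (Nat.pos_of_ne_zero hn)
  set g : ℂ → ℂ := upperHalf.piecewise (fun τ => a (qParam n τ) * f τ) 0 with hg
  have hgH : Set.EqOn g (fun τ => a (qParam n τ) * f τ) upperHalf := Set.piecewise_eqOn _ _ _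
  have hupper := eventually_mem_upperHalf
  have hmem : ∀ τ : ℂ, τ + n ∈ upperHalf ↔ τ ∈ upperHalf := fun τ => by simp [upperHalf]
  have hgper : Function.Periodic g (n : ℝ) := by
    intro τ
    by_cases hτ : τ ∈ upperHalf
    · have hτ' := (hmem τ).mpr hτ
      have hq : qParam n (τ + n) = qParam n τ := by
        have := qParam_self hn'.ne'
        rw [Complex.ofReal_natCast] at this
        rw [qParam_add, this, mul_one]
      rw [Complex.ofReal_natCast, hgH hτ', hgH hτ]
      simp only [hper τ hτ, hq]
    · have hτ' : τ + ((n : ℝ) : ℂ) ∉ upperHalf := by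
        rw [Complex.ofReal_natCast, hmem]
        exact hτ
      rw [hg, Set.piecewise_eq_of_notMem _ _ _ hτ', Set.piecewise_eq_of_notMem _ _ _ hτ,
        Pi.zero_apply, Pi.zero_apply]
  have hgd : ∀ τ ∈ upperHalf, DifferentiableAt ℂ g τ := by
    intro τ hτ
    refine DifferentiableAt.congr_of_eventuallyEq ?_
      (hgH.eventuallyEq_of_mem (isOpen_upperHalf.mem_nhds hτ))
    exact ((ha _).comp τ (differentiable_qParam τ)).mul (hf τ hτ).differentiableAt
  have hbd : BoundedAtFilter (comap Complex.im atTop) g := by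
    refine Asymptotics.IsBigO.of_bound M ?_
    filter_upwards [hM, hupper] with τ h1 h2
    rw [hgH h2]
    simpa using h1
  have hev : ∀ᶠ τ in comap Complex.im atTop, DifferentiableAt ℂ g τ := hupper.mono hgd
  have hcusp : AnalyticAt ℂ (cuspFunction n g) 0 := by
    rw [Complex.analyticAt_iff_eventually_differentiableAt]
    have h1 := differentiableAt_cuspFunction_zero hn' hgper hev hbd
    have h2 := eventually_differentiableAt_cuspFunction_nhds_ne_zero hn' hgper hev
    rw [eventually_nhdsWithin_iff] at h2
    filter_upwards [h2] with t ht
    by_cases h0 : t = 0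
    · rwa [h0]
    · exact ht h0
  refine ⟨fun t => cuspFunction n g t / a t,
    hcusp.meromorphicAt.div (ha.analyticAt 0).meromorphicAt, fun τ hτ => ?_⟩
  have := ha0 τ hτ
  simp only
  rw [eq_cuspFunction hn'.ne' hgper τ, hgH hτ]
  field_simp

open Function.Periodic in
/-- Local branches at a point `x₀` which is possibly a branch point: the algebraic function is
uniformized on a punctured disc by the half-plane, where it splits into branches; these are
meromorphic functions of a root of `x - x₀`, and `hmon` provides the triviality of their
monodromy. -/
theorem exists_isBranchSet_of_monodromy {F : MvPolynomial (Fin 2) ℂ} (hF : Irreducible F)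
    (hdeg : (asPolyInY F).natDegree ≠ 0) {x₀ : ℂ}
    (hmon : ∀ (r ζ : ℂ) (n : ℕ) (υ : ℂ → ℂ), r ≠ 0 → n ≠ 0 → IsPrimitiveRoot ζ n →
      MeromorphicAt υ 0 → (∀ᶠ t in 𝓝[≠] 0, evalXY F (x₀ + r * t ^ n) (υ t) = 0) →
      ∀ᶠ t in 𝓝[≠] 0, υ (ζ * t) = υ t) :
    ∃ L, IsBranchSet (fun x y => evalXY F x y = 0) x₀ L := by
  classical
  obtain ⟨ρ, hρ, hgood⟩ := Metric.eventually_nhds_iff_ball.mp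
    (eventually_nhdsWithin_iff.mp (eventually_analytic_roots hF hdeg x₀))
  set r : ℂ := (ρ : ℂ) with hr
  have hr0 : r ≠ 0 := Complex.ofReal_ne_zero.mpr hρ.ne'
  set φ : ℂ → ℂ := fun τ => x₀ + r * qParam 1 τ with hφ
  have hφd : Differentiable ℂ φ := by
    have := differentiable_qParam (h := 1)
    fun_prop
  have hφgood : ∀ τ ∈ upperHalf, (asPolyInY F).leadingCoeff.eval (φ τ) ≠ 0 ∧
      ∀ y, evalXY F (φ τ) y = 0 → partialY F (φ τ) y ≠ 0 := by
    intro τ hτ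
    have hq := norm_qParam_lt_one one_pos hτ
    refine hgood (φ τ) ?_ ?_
    · rw [Metric.mem_ball, dist_eq_norm, hφ]
      simp only [add_sub_cancel_left, norm_mul, hr, Complex.norm_real, Real.norm_eq_abs,
        abs_of_pos hρ]
      exact mul_lt_of_lt_one_right hρ hq
    · simp [hφ, hr0, qParam_ne_zero]
  let R : ℂ → ℂ → Prop := fun τ y => evalXY F (φ τ) y = 0
  have hloc : ∀ τ ∈ upperHalf, ∃ L : Set (ℂ → ℂ), L.Finite ∧ (∀ g ∈ L, AnalyticAt ℂ g τ) ∧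
      ∀ᶠ z in 𝓝 τ, ∀ y, R z y ↔ ∃ g ∈ L, g z = y := by
    intro τ hτ
    obtain ⟨L, hL, hLa, hLiff⟩ := exists_analyticAt_roots F (hφgood τ hτ).1 (hφgood τ hτ).2
    refine ⟨(fun g => g ∘ φ) '' L, hL.image _, ?_, ?_⟩
    · rintro _ ⟨g, hg, rfl⟩
      exact (hLa g hg).comp (hφd.analyticAt τ)
    · filter_upwards [hφd.continuous.continuousAt.eventually hLiff] with z hz y
      rw [Set.exists_mem_image]
      exact hz y
  have hset : ∀ τ ∈ upperHalf, ∃ L, IsBranchSet R τ L := fun τ hτ => by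
    obtain ⟨L, hL, hLa, hLiff⟩ := hloc τ hτ
    exact ⟨L, hL, fun g hg => (hLa g hg).meromorphicNFAt, hLiff.filter_mono nhdsWithin_le_nhds⟩
  have hbranch : ∀ f, IsBranchOn R f upperHalf →
      ∀ τ ∈ upperHalf, AnalyticAt ℂ f τ ∧ evalXY F (φ τ) (f τ) = 0 := by
    intro f hf τ hτ
    obtain ⟨L, hL, hLa, hLiff⟩ := hloc τ hτ
    have hL' : IsBranchSet R τ L :=
      ⟨hL, fun g hg => (hLa g hg).meromorphicNFAt, hLiff.filter_mono nhdsWithin_le_nhds⟩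
    obtain ⟨g, hg, hfg⟩ := hL'.exists_eventuallyEq (hf.normalForm hτ) (hf.eventually_graph τ hτ)
    refine ⟨(hLa g hg).congr hfg.symm, ?_⟩
    rw [hfg.eq_of_nhds]
    exact (hLiff.self_of_nhds _).mpr ⟨g, hg, rfl⟩
  have hI : Complex.I ∈ upperHalf := by simp [upperHalf]
  obtain ⟨L, hL, hLbr, hLall⟩ :=
    exists_finite_branches isOpen_upperHalf convex_upperHalf hset ⟨_, hI⟩
  have hLval : ∀ τ ∈ upperHalf, ∀ y, R τ y → ∃ f ∈ L, f τ = y := by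
    intro τ hτ y hy
    obtain ⟨Lτ, -, hLa, hLiff⟩ := hloc τ hτ
    obtain ⟨g, hg, hgy⟩ := (hLiff.self_of_nhds y).mp hy
    obtain ⟨f, hf, hfg⟩ := exists_isBranchOn isOpen_upperHalf convex_upperHalf hset hτ
      (hLa g hg).meromorphicNFAt (by
        filter_upwards [hLiff.filter_mono nhdsWithin_le_nhds] with z hz
        exact (hz _).mpr ⟨g, hg, rfl⟩)
    obtain ⟨f', hf', hff'⟩ := hLall f hf
    exact ⟨f', hf', by rw [← hff' hτ, hfg.eq_of_nhds, hgy]⟩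
  have hmem : ∀ (k : ℕ) {τ : ℂ}, τ ∈ upperHalf → τ + k ∈ upperHalf := fun k τ hτ => by
    simpa [upperHalf] using hτ
  have hφper : ∀ (k : ℕ) (τ : ℂ), φ (τ + k) = φ τ := by
    intro k τ
    have h1 : qParam 1 ((1 : ℕ) : ℂ) = 1 := by simpa using qParam_self (h := 1) one_ne_zero
    have h2 : qParam 1 (k : ℂ) = 1 := by
      induction k with
      | zero => simp [qParam]
      | succ k ih => rw [Nat.cast_add, qParam_add, ih, h1, mul_one]
    simp only [hφ, qParam_add, h2, mul_one]
  have hshift : ∀ f, IsBranchOn R f upperHalf → ∀ k : ℕ,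
      IsBranchOn R (fun τ => f (τ + k)) upperHalf := by
    intro f hf k
    refine ⟨fun τ hτ => ?_, fun τ hτ => ?_⟩
    · have h1 : AnalyticAt ℂ (fun τ : ℂ => τ + k) τ := by fun_prop
      exact (AnalyticAt.fun_comp (g := f) (f := fun τ => τ + k) (hbranch f hf _ (hmem k hτ)).1
        h1).meromorphicNFAt
    · filter_upwards [nhdsWithin_le_nhds (isOpen_upperHalf.mem_nhds hτ)] with z hz
      have := (hbranch f hf _ (hmem k hz)).2
      rwa [hφper] at this
  -- two of the infinitely many translates of a branch coincide
  have hperiod : ∀ f, IsBranchOn R f upperHalf → ∃ n : ℕ, n ≠ 0 ∧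
      ∀ τ ∈ upperHalf, f (τ + n) = f τ := by
    intro f hf
    choose c hcL hc using fun k : ℕ => hLall _ (hshift f hf k)
    obtain ⟨j, -, k, -, hjk, hcjk⟩ := Set.infinite_univ.exists_ne_map_eq_of_mapsTo
      (f := c) (fun k _ => hcL k) hL
    wlog hlt : j < k generalizing j k
    · exact this k j hjk.symm hcjk.symm (lt_of_le_of_ne (not_lt.mp hlt) hjk.symm)
    refine ⟨k - j, by omega, fun τ hτ => ?_⟩
    have h1 : τ - j ∈ upperHalf := by simpa [upperHalf] using hτ
    have h2 := (hc j h1).trans ((congrFun hcjk _).trans (hc k h1).symm)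
    simp only [sub_add_cancel] at h2
    rw [h2, Nat.cast_sub hlt.le]
    congr 1
    ring
  -- a branch of period `n` is a meromorphic function of `t = exp (2 π i τ / n)`
  have hmero : ∀ f, IsBranchOn R f upperHalf → ∀ n : ℕ, n ≠ 0 →
      (∀ τ ∈ upperHalf, f (τ + n) = f τ) →
      ∃ h : ℂ → ℂ, MeromorphicAt h 0 ∧ ∀ τ ∈ upperHalf, f τ = h (qParam n τ) := by
    intro f hf n hn hper
    set d := (asPolyInY F).natDegree with hd
    have hpow : ∀ τ, x₀ + r * qParam n τ ^ n = φ τ := fun τ => by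
      rw [qParam_natCast_pow hn]
    set S : ℂ → ℝ := fun x => ∑ i ∈ Finset.range (d + 1), ‖((asPolyInY F).coeff i).eval x‖ with hS
    have hScont : Continuous S := by fun_prop
    have hφlim : Tendsto φ (comap Complex.im atTop) (𝓝 x₀) := by
      have h1 : Tendsto (qParam 1) (comap Complex.im atTop) (𝓝 0) :=
        (qParam_tendsto one_pos).mono_right nhdsWithin_le_nhds
      simpa [hφ] using (h1.const_mul r).const_add x₀
    refine exists_meromorphicAt_of_periodic hn (fun τ hτ => (hbranch f hf τ hτ).1) hper
      (a := fun t => (asPolyInY F).leadingCoeff.eval (x₀ + r * t ^ n)) (by fun_prop)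
      (fun τ hτ => by
        simp only [hpow]
        exact (hφgood τ hτ).1) (M := S x₀ + 1) ?_
    have h1 : ∀ᶠ τ in comap Complex.im atTop, S (φ τ) < S x₀ + 1 :=
      (hScont.continuousAt.tendsto.comp hφlim).eventually (eventually_lt_nhds (lt_add_one _))
    filter_upwards [h1, (eventually_gt_atTop 0).comap Complex.im] with τ h2 hτ
    simp only [hpow]
    have h3 := Polynomial.norm_coeff_mul_le
      (p := (asPolyInY F).map (Polynomial.evalRingHom (φ τ))) (d := d)
      Polynomial.natDegree_map_le (y := f τ) (by
        rw [eval_map_asPolyInY]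
        exact (hbranch f hf τ hτ).2)
    simp only [Polynomial.coeff_map, Polynomial.coe_evalRingHom] at h3
    exact h3.trans h2.le
  -- the local parameter of the branch turns by a root of unity under `τ ↦ τ + 1`
  have hone : ∀ f, IsBranchOn R f upperHalf → ∀ τ ∈ upperHalf, f (τ + (1 : ℕ)) = f τ := by
    intro f hf
    obtain ⟨n, hn, hper⟩ := hperiod f hf
    obtain ⟨h, hh, hfh⟩ := hmero f hf n hn hper
    have hn' : (0 : ℝ) < n := Nat.cast_pos.mpr (Nat.pos_of_ne_zero hn)
    have hζ : IsPrimitiveRoot (qParam n 1) n := by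
      have := Complex.isPrimitiveRoot_exp n hn
      simpa [qParam] using this
    have hζ1 := hmon r (qParam n 1) n h hr0 hn hζ hh (by
      have hball : ∀ᶠ t in 𝓝[≠] (0 : ℂ), ‖t‖ < 1 := by
        filter_upwards [nhdsWithin_le_nhds (Metric.ball_mem_nhds (0 : ℂ) one_pos)] with t ht
        simpa using ht
      filter_upwards [hball, self_mem_nhdsWithin] with t ht1 ht0
      have hτ := invQParam_mem_upperHalf hn' ht0 ht1
      have h1 := (hbranch f hf _ hτ).2
      have h2 : φ (invQParam n t) = x₀ + r * t ^ n := by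
        simp only [hφ]
        rw [← qParam_natCast_pow hn, qParam_right_inv hn'.ne' ht0]
      rwa [hfh _ hτ, qParam_right_inv hn'.ne' ht0, h2] at h1)
    have h2 : ∀ᶠ τ in comap Complex.im atTop, f (τ + (1 : ℕ)) = f τ := by
      filter_upwards [(qParam_tendsto hn').eventually hζ1,
        (eventually_gt_atTop 0).comap Complex.im] with τ h1 hτ
      rw [hfh _ (hmem 1 hτ), hfh _ hτ, ← h1, qParam_add, mul_comm, Nat.cast_one]
    obtain ⟨M, hM⟩ := (eventually_comap.mp h2).exists_forall_of_atTop
    have hp : (((|M| + 1 : ℝ) : ℂ) * Complex.I) ∈ upperHalf := by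
      have : 0 < |M| + 1 := by positivity
      simpa [upperHalf] using this
    refine MeromorphicNFOn.eqOn_of_eventuallyEq (hshift f hf 1).normalForm hf.normalForm
      convex_upperHalf.isPreconnected hp ?_
    have hopen : IsOpen {z : ℂ | M < z.im} := isOpen_lt continuous_const Complex.continuous_im
    filter_upwards [hopen.mem_nhds (x := ((|M| + 1 : ℝ) : ℂ) * Complex.I) (by
      simpa using (le_abs_self M).trans_lt (lt_add_one _))] with z hz
    exact hM z.im (le_of_lt hz) z rfl
  choose! G hGm hG using fun f (hf : IsBranchOn R f upperHalf) =>
    hmero f hf 1 one_ne_zero (hone f hf)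
  have hmer : ∀ f ∈ L, MeromorphicAt (fun x => G f ((x - x₀) / r)) x₀ := by
    intro f hf
    have h1 : AnalyticAt ℂ (fun x => (x - x₀) / r) x₀ := by fun_prop (disch := exact hr0)
    refine MeromorphicAt.comp_analyticAt (f := G f) ?_ h1
    simpa using hGm f (hLbr f hf)
  refine ⟨(fun f => toMeromorphicNFAt (fun x => G f ((x - x₀) / r)) x₀) '' L, hL.image _, ?_, ?_⟩
  · rintro _ ⟨f, -, rfl⟩
    exact meromorphicNFAt_toMeromorphicNFAt
  · filter_upwards [self_mem_nhdsWithin, nhdsWithin_le_nhds (Metric.ball_mem_nhds x₀ hρ)]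
      with x hx hxρ y
    have hx0 : (x - x₀) / r ≠ 0 := div_ne_zero (sub_ne_zero.mpr hx) hr0
    have hx1 : ‖(x - x₀) / r‖ < 1 := by
      rw [norm_div, hr, Complex.norm_real, Real.norm_eq_abs, abs_of_pos hρ, div_lt_one hρ]
      simpa [dist_eq_norm] using hxρ
    have hτ := invQParam_mem_upperHalf one_pos hx0 hx1
    have hq := qParam_right_inv (h := 1) one_ne_zero hx0
    have hφx : φ (invQParam 1 ((x - x₀) / r)) = x := by
      simp only [hφ, hq]
      field_simp
      ring
    rw [Set.exists_mem_image]
    have hval : ∀ f ∈ L, toMeromorphicNFAt (fun x => G f ((x - x₀) / r)) x₀ x =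
        f (invQParam 1 ((x - x₀) / r)) := by
      intro f hf
      rw [← (hmer f hf).eqOn_compl_singleton_toMeromorphicNFAt hx, hG f (hLbr f hf) _ hτ,
        Nat.cast_one, hq]
    constructor
    · intro hxy
      obtain ⟨f, hf, hfy⟩ := hLval _ hτ y (by
        change evalXY F (φ _) y = 0
        rwa [hφx])
      exact ⟨f, hf, by rw [hval f hf, hfy]⟩
    · rintro ⟨f, hf, rfl⟩
      rw [hval f hf]
      have := (hbranch f (hLbr f hf) _ hτ).2
      rwa [hφx] at this

/-! ### Uniformization of the solution -/

/-- The local branches of a multivalued function, composed with a local biholomorphism. -/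
theorem IsBranchSet.comp {R : ℂ → ℂ → Prop} {φ : ℂ → ℂ} {p : ℂ} {L : Set (ℂ → ℂ)}
    (hL : IsBranchSet R (φ p) L)
    (hφ : AnalyticAt ℂ φ p) (hφ' : deriv φ p ≠ 0) :
    IsBranchSet (fun z y => R (φ z) y) p ((fun g => g ∘ φ) '' L) := by
  refine ⟨hL.finite.image _, ?_, ?_⟩
  · rintro _ ⟨g, hg, rfl⟩
    exact (hL.normalForm g hg).comp_analyticAt hφ
  · filter_upwards [(hφ.differentiableAt.hasDerivAt.tendsto_nhdsNE hφ').eventually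
      hL.eventually_iff] with z hz y
    rw [Set.exists_mem_image]
    exact hz y

/-- An algebraic function satisfying the sixth Painlevé equation is ramified at most over `0`, `1`
and `∞`. -/
theorem exists_isBranchSet_of_solution {α β γ δ : ℂ} {F : MvPolynomial (Fin 2) ℂ}
    (hF : Irreducible F) (hdeg : (asPolyInY F).natDegree ≠ 0) {U : Set ℂ} (hU : IsOpen U)
    (hUne : U.Nonempty) {y₀ : ℂ → ℂ} (hP : IsPainleveVISolutionOn α β γ δ y₀ U)
    (hFy : ∀ x ∈ U, evalXY F x (y₀ x) = 0) {x₀ : ℂ} (h0 : x₀ ≠ 0) (h1 : x₀ ≠ 1) :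
    ∃ L, IsBranchSet (fun x y => evalXY F x y = 0) x₀ L := by
  refine exists_isBranchSet_of_monodromy hF hdeg fun r ζ n υ hr hn hζ hυ hυF => ?_
  refine eventually_comp_mul_eq (α := α) (β := β) (γ := γ) (δ := δ) h0 h1 hr hn hζ rfl hυ ?_
  have hξ : Tendsto (fun t => x₀ + r * t ^ n) (𝓝[≠] 0) (𝓝[≠] x₀) := by
    refine tendsto_nhdsWithin_iff.mpr ⟨?_, ?_⟩
    · have : Continuous fun t : ℂ => x₀ + r * t ^ n := by fun_prop
      simpa [hn] using (this.tendsto 0).mono_left nhdsWithin_le_nhds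
    · filter_upwards [self_mem_nhdsWithin] with t ht
      simpa [hr, hn] using ht
  filter_upwards [hυ.eventually_analyticAt, eventually_eventually_nhdsWithin.mpr hυF,
    hξ.eventually (eventually_analytic_roots hF hdeg x₀), hυF, self_mem_nhdsWithin]
    with t ht1 ht2 ht3 ht4 ht5
  rw [isOpen_compl_singleton.nhdsWithin_eq ht5] at ht2
  exact painleveVIAlong_of_solution hF hU hUne hP hFy (by fun_prop) ht1 ht2 (ht3.2 _ ht4)

theorem theorem3 (α β γ δ : ℂ) (F : MvPolynomial (Fin 2) ℂ) (hF : Irreducible F)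
    (U : Set ℂ) (hU : IsOpen U) (y₀ : ℂ → ℂ)
    (hP : IsPainleveVISolutionOn α β γ δ y₀ U)
    (hFy : ∀ x ∈ U, evalXY F x (y₀ x) = 0)
    (τ₀ : ℂ) (hτ₀ : τ₀ ∈ upperHalf) (hxτ₀ : modularX τ₀ ∈ U) :
    ∃ y : ℂ → ℂ,
      MeromorphicNFOn y upperHalf ∧
      (∀ᶠ τ in 𝓝 τ₀, y τ = y₀ (modularX τ)) ∧
      (∀ τ ∈ upperHalf, AnalyticAt ℂ y τ → evalXY F (modularX τ) (y τ) = 0) ∧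
      (∀ τ ∈ upperHalf, AnalyticAt ℂ y τ →
        partialX F (modularX τ) (y τ) ≠ 0 → partialY F (modularX τ) (y τ) ≠ 0 →
        deriv y τ ≠ 0 ∧ merDeriv y τ = fuchsRHS F (modularX τ) (y τ)) ∧
      (MvPolynomial.pderiv 0 F ≠ 0 →
        (∀ᶠ τ in codiscreteWithin upperHalf, AnalyticAt ℂ y τ ∧
          partialX F (modularX τ) (y τ) ≠ 0 ∧ partialY F (modularX τ) (y τ) ≠ 0) ∧
        IsFuchsianOnCurve F (fuchsRHS F)) := by
  have hdeg : (asPolyInY F).natDegree ≠ 0 :=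
    natDegree_asPolyInY_ne_zero hF (infinite_of_mem_nhds _ (hU.mem_nhds hxτ₀))
      fun x hx => ⟨y₀ x, hFy x hx⟩
  have hlocal : ∀ τ ∈ upperHalf,
      ∃ L, IsBranchSet (fun τ y => evalXY F (modularX τ) y = 0) τ L := by
    intro τ hτ
    obtain ⟨L, hL⟩ := exists_isBranchSet_of_solution hF hdeg hU ⟨_, hxτ₀⟩ hP hFy
      (modularX_ne_zero hτ) (modularX_ne_one hτ)
    exact ⟨_, hL.comp (analyticAt_modularX hτ) (deriv_modularX_ne_zero hτ)⟩
  have hx₀ := analyticAt_modularX hτ₀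
  obtain ⟨y, hy, hyy₀⟩ := exists_isBranchOn (f₀ := fun τ => y₀ (modularX τ)) isOpen_upperHalf
    convex_upperHalf hlocal hτ₀ ((hP.analytic _ hxτ₀).fun_comp hx₀).meromorphicNFAt (by
      filter_upwards [nhdsWithin_le_nhds
        (hx₀.continuousAt.preimage_mem_nhds (hU.mem_nhds hxτ₀))] with τ hτ using hFy _ hτ)
  have hcurve : ∀ τ ∈ upperHalf, AnalyticAt ℂ y τ →
      ∀ᶠ s in 𝓝 τ, evalXY F (modularX s) (y s) = 0 := fun τ hτ hyτ =>
    (AnalyticAt.frequently_eq_iff_eventually_eq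
      (analyticAt_evalXY F (analyticAt_modularX hτ) hyτ) analyticAt_const).mp
      (hy.eventually_graph τ hτ).frequently
  refine ⟨y, hy.normalForm, hyy₀, fun τ hτ hyτ => (hcurve τ hτ hyτ).self_of_nhds, ?_, ?_⟩
  · intro τ hτ hyτ hX hY
    obtain ⟨h1, h2⟩ := deriv_ne_zero_and_merDeriv_eq F (analyticAt_modularX hτ) hyτ
      (hcurve τ hτ hyτ) (deriv_modularX_ne_zero hτ) hX hY
    refine ⟨h1, ?_⟩
    rw [h2, merDeriv_modularX hτ, modularSchwarzian, sub_self, zero_mul, add_zero]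
  · intro hX
    refine ⟨?_, isFuchsianOnCurve_fuchsRHS hF hdeg hX⟩
    rw [Filter.Eventually, mem_codiscreteWithin]
    intro τ hτ
    rw [disjoint_principal_right]
    have hxm := (analyticAt_modularX hτ).meromorphicAt
    have hconst : ¬ ∃ c : ℂ, ∀ᶠ s in 𝓝[≠] τ, modularX s = c := by
      rintro ⟨c, hc⟩
      have h1 : modularX =ᶠ[𝓝 τ] fun _ => c :=
        (AnalyticAt.frequently_eq_iff_eventually_eq (analyticAt_modularX hτ)
          analyticAt_const).mp hc.frequently
      exact deriv_modularX_ne_zero hτ (by rw [h1.deriv_eq, deriv_const])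
    filter_upwards [(hy.normalForm hτ).meromorphicAt.eventually_analyticAt,
      eventually_evalXY_ne_zero hF hdeg (not_dvd_pderiv 0 hX) hxm hconst
        (hy.eventually_graph τ hτ),
      eventually_evalXY_ne_zero hF hdeg (not_dvd_pderiv 1 (pderiv_one_ne_zero hdeg)) hxm hconst
        (hy.eventually_graph τ hτ)] with s h1 h2 h3 h4
    exact h4.2 ⟨h1, h2, h3⟩
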